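/- Let $n\ge 1$, let $s_k=(k\ k{+}1)$ ($1\le k<m$) denote the simple reflections of the symmetric group $S_m$, and let $\le$ be the Bruhat order. For $x\in S_n$ let $\tilde x\in S_{2n}$ be given by $\tilde x(2i)=2x(i)$, $\tilde x(2i-1)=2x(i)-1$. Let $j_1,\dots,j_l\in\{1,\dots,n-1\}$ be distinct and let $w=s_{j_1}\cdots s_{j_l}\in S_n$ (a Boolean permutation). Note that $\tilde s_k=s_{2k}s_{2k-1}s_{2k+1}s_{2k}$, so that $\tilde w$ is represented by the word $\tilde{\mathbf w}=\mathbf b_1\cdots\mathbf b_l$, $\mathbf b_i=\mathbf s_{2j_i}\mathbf s_{2j_i-1}\mathbf s_{2j_i+1}\mathbf s_{2j_i}$. For a mask $x\in(\{0,1\}^4)^l$ let $\pi(\tilde{\mathbf w}[x])\in S_{2n}$ be the product of the letters of $\tilde{\mathbf w}$ selected by $x$, and let $\operatorname{sgn}x=\prod_{i,k}(-1)^{x_{i,k}}$. *Neighbors.* For $A\subset B\subset\{1,\dots,l\}$ let $\overrightarrow N_A^B$ (resp. $\overleftarrow N_A^B$) be the set of $i\in B\setminus A$ for which there are $t>0$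 and (necessarily unique) indices $i<i_1<\dots<i_t$ (resp. $i>i_1>\dots>i_t$) with $i_1,\dots,i_{t-1}\in A$, $i_t\in B\setminus A$ and $j_{i_k}=j_i+k$ for $1\le k\le t$; put $\nu_A^B(i)=i_t$ and $N_A^B=\overrightarrow N_A^B\cup\overleftarrow N_A^B$. The superscript is omitted when $B=\{1,\dots,l\}$. Let $\mathcal T$ be the set of triplets $Q=(I_e,I,I_f)$ of subsets of $\{1,\dots,l\}$ with $I_f\subset I_e$ and $I\subset N_{I_f}^{I_e}$. *The maps $\mathbf p$ and $\mathbf q$.* For $u\le\tilde w$ let $\mathbf p(u)=(I_e,I,I_f)$, where $I_e=\{i:s_{2j_i}\le u\}$, $I_f=\{i:\tilde s_{j_i}\le u\}$ and $I$ consists of the $i\in\overrightarrow N_{I_f}$ such that, with $a=j_i$ and $b=j_{\nu_{I_f}(i)}$, $s_{2a}s_{2a+1}\tilde s_{a+1}\cdots\tilde s_{b-1}s_{2b}\le u$, together with the $i\in\overleftarrow N_{I_f}$ such that, with the same $a,b$, $s_{2b}\tilde s_{b-1}\cdots\tilde s_{a+1}s_{2a+1}s_{2a}\le u$. For $Q=(I_e,I,I_f)\in\mathcal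 T$ let $\mathbf q(Q)=y_1\cdots y_l\in S_{2n}$, where $y_i=1$ if $i\notin I_e$; $y_i=\tilde s_{j_i}$ if $i\in I_f$; $y_i=s_{2j_i}s_{2j_i+1}$ if $i\in I\cap\overrightarrow N_{I_f}$; $y_i=s_{2j_i+1}s_{2j_i}$ if $i\in I\cap\overleftarrow N_{I_f}$; and $y_i=s_{2j_i}$ otherwise. *The subgroups $H$ and $K$.* Let $H\subset S_{2n}$ be the subgroup of permutations preserving each of the sets $\{2i-1,2i\}$, $1\le i\le n$, and let $K\subset S_{2n}$ be the subgroup of permutations preserving $\{2,4,\dots,2n\}$. For $u\in K$ let $u_{\mathrm{odd}},u_{\mathrm{even}}\in S_n$ be given by $u(2i-1)=2u_{\mathrm{odd}}(i)-1$ and $u(2i)=2u_{\mathrm{even}}(i)$ (so $K\simeq S_n\times S_n$). Then: 1. For every $u\in K$, $u\le\tilde w$ if and only if $u_{\mathrm{even}}\le w$ and $u_{\mathrm{odd}}\le w$. 2. For every $Q=(I_e,I,I_f)\in\mathcal T$, $$\sum_{x\in(\{0,1\}^4)^l:\ \mathbf p(\pi(\tilde{\mathbf w}[x]))=Q}\operatorname{sgn}x\;=\;2^{|I_e\setminus(I_f\cup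 N_{I_f}^{I_e})|}(-1)^{|I_e\setminus I_f|}\;=\sum_{u\in K:\ u\le\tilde w,\ \mathbf p(u)=Q}\operatorname{sgn}u\;=\;\pm\,|H\,\mathbf q(Q)\,H\cap K|,$$ for a suitable sign (depending on $Q$). -/

import Mathlib

open Equiv Finset
open scoped Classical

noncomputable section

/-- The simple reflection `s_k = (k, k+1)` of `S_m` for `1 ≤ k ≤ m - 1`. The letters are
`1, …, m` and the letter `a` is the element `a - 1` of `Fin m`.
Other values of `k` never occur below and give the identity. -/
def simpleRefl (m k : ℕ) : Perm (Fin m) :=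
  if h : 1 ≤ k ∧ k < m then swap ⟨k - 1, by omega⟩ ⟨k, h.2⟩ else 1

/-- The element `π(𝐰) = s_{k_1} ⋯ s_{k_r}` of `S_m` for a word `𝐰 = k_1 … k_r`. -/
def wordProd (m : ℕ) (L : List ℕ) : Perm (Fin m) := (L.map (simpleRefl m)).prod

/-- An upward step in the Bruhat order of `S_m`: multiplication by a transposition `(a b)` that
increases the length (which means `a < b` and `u a < u b`). -/
def BruhatStep {m : ℕ} (u v : Perm (Fin m)) : Prop :=
  ∃ a b : Fin m, a < b ∧ u a < u b ∧ v = u * swap a b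

/-- The Bruhat order of `S_m`. -/
def BruhatLE {m : ℕ} (u v : Perm (Fin m)) : Prop := Relation.ReflTransGen BruhatStep u v

theorem val_div_two_lt {n : ℕ} (a : Fin (2 * n)) : a.val / 2 < n := by
  have := a.isLt
  omega

/-- The letter `2 i - 1` of `{1, …, 2 n}`, for the letter `i` of `{1, …, n}`. -/
def oddLetter {n : ℕ} (i : Fin n) : Fin (2 * n) := ⟨2 * i.val, by have := i.isLt; omega⟩

/-- The letter `2 i` of `{1, …, 2 n}`, for the letter `i` of `{1, …, n}`. -/
def evenLetter {n : ℕ} (i : Fin n) : Fin (2 * n) := ⟨2 * i.val + 1, by have := i.isLt; omega⟩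

/-- For a letter of `{1, …, 2 n}`, the index `i` of the pair `{2 i - 1, 2 i}` containing it. -/
def pairOf {n : ℕ} (a : Fin (2 * n)) : Fin n := ⟨a.val / 2, val_div_two_lt a⟩

/-- The permutation `w̃` of `{1, …, 2 n}` with `w̃(2i) = 2 w(i)`, `w̃(2i-1) = 2 w(i) - 1`. -/
def tilde {n : ℕ} (w : Perm (Fin n)) : Perm (Fin (2 * n)) where
  toFun a := if a.val % 2 = 0 then oddLetter (w (pairOf a)) else evenLetter (w (pairOf a))
  invFun a := if a.val % 2 = 0 then oddLetter (w.symm (pairOf a))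
    else evenLetter (w.symm (pairOf a))
  left_inv a := by
    rcases Nat.mod_two_eq_zero_or_one a.val with h | h <;> ext <;>
      simp [h, oddLetter, evenLetter, pairOf, Nat.mul_add_div] <;> omega
  right_inv a := by
    rcases Nat.mod_two_eq_zero_or_one a.val with h | h <;> ext <;>
      simp [h, oddLetter, evenLetter, pairOf, Nat.mul_add_div] <;> omega

/-- The subgroup `H` of `S_{2n}` of permutations preserving each of the sets `{2i-1, 2i}`. -/
def pairSubgroup (n : ℕ) : Subgroup (Perm (Fin (2 * n))) where
  carrier := {x | ∀ a, pairOf (x a) = pairOf a}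
  mul_mem' {x y} hx hy a := by
    rw [Perm.mul_apply, hx, hy]
  one_mem' _ := rfl
  inv_mem' {x} hx a := by
    have := hx (x⁻¹ a)
    rw [show x (x⁻¹ a) = a from x.apply_symm_apply a] at this
    exact this.symm

/-- The subgroup `K` of `S_{2n}` of permutations preserving the set `{2, 4, …, 2n}`
(equivalently, preserving the parity of the letters). -/
def paritySubgroup (n : ℕ) : Subgroup (Perm (Fin (2 * n))) where
  carrier := {x | ∀ a, (x a).val % 2 = a.val % 2}
  mul_mem' {x y} hx hy a := by
    rw [Perm.mul_apply, hx, hy]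
  one_mem' _ := rfl
  inv_mem' {x} hx a := by
    have := hx (x⁻¹ a)
    rw [show x (x⁻¹ a) = a from x.apply_symm_apply a] at this
    exact this.symm

theorem evenLetter_pairOf {n : ℕ} (a : Fin (2 * n)) (h : a.val % 2 = 1) :
    evenLetter (pairOf a) = a := by
  ext
  simp only [evenLetter, pairOf]
  omega

theorem oddLetter_pairOf {n : ℕ} (a : Fin (2 * n)) (h : a.val % 2 = 0) :
    oddLetter (pairOf a) = a := by
  ext
  simp only [oddLetter, pairOf]
  omega

theorem pairOf_evenLetter {n : ℕ} (i : Fin n) : pairOf (evenLetter i) = i := by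
  ext
  simp only [evenLetter, pairOf]
  omega

theorem pairOf_oddLetter {n : ℕ} (i : Fin n) : pairOf (oddLetter i) = i := by
  ext
  simp only [oddLetter, pairOf]
  omega

theorem evenLetter_mod {n : ℕ} (i : Fin n) : (evenLetter i).val % 2 = 1 := by
  simp only [evenLetter]
  omega

theorem oddLetter_mod {n : ℕ} (i : Fin n) : (oddLetter i).val % 2 = 0 := by
  simp only [oddLetter]
  omega

/-- For `x ∈ K`, the permutation `x_even` of `{1, …, n}` with `x(2i) = 2 x_even(i)`. -/
def evenPart {n : ℕ} (x : paritySubgroup n) : Perm (Fin n) where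
  toFun i := pairOf (x.1 (evenLetter i))
  invFun i := pairOf (x.1⁻¹ (evenLetter i))
  left_inv i := by
    beta_reduce
    rw [evenLetter_pairOf _ ((x.2 _).trans (evenLetter_mod i))]
    exact (congrArg pairOf (x.1.symm_apply_apply _)).trans (pairOf_evenLetter i)
  right_inv i := by
    beta_reduce
    rw [evenLetter_pairOf _ (((paritySubgroup n).inv_mem x.2 _).trans (evenLetter_mod i))]
    exact (congrArg pairOf (x.1.apply_symm_apply _)).trans (pairOf_evenLetter i)

/-- For `x ∈ K`, the permutation `x_odd` of `{1, …, n}` with `x(2i-1) = 2 x_odd(i) - 1`. -/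
def oddPart {n : ℕ} (x : paritySubgroup n) : Perm (Fin n) where
  toFun i := pairOf (x.1 (oddLetter i))
  invFun i := pairOf (x.1⁻¹ (oddLetter i))
  left_inv i := by
    beta_reduce
    rw [oddLetter_pairOf _ ((x.2 _).trans (oddLetter_mod i))]
    exact (congrArg pairOf (x.1.symm_apply_apply _)).trans (pairOf_oddLetter i)
  right_inv i := by
    beta_reduce
    rw [oddLetter_pairOf _ (((paritySubgroup n).inv_mem x.2 _).trans (oddLetter_mod i))]
    exact (congrArg pairOf (x.1.apply_symm_apply _)).trans (pairOf_oddLetter i)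

theorem apply_evenLetter {n : ℕ} (x : paritySubgroup n) (i : Fin n) :
    x.1 (evenLetter i) = evenLetter (evenPart x i) :=
  (evenLetter_pairOf _ ((x.2 _).trans (evenLetter_mod i))).symm

theorem apply_oddLetter {n : ℕ} (x : paritySubgroup n) (i : Fin n) :
    x.1 (oddLetter i) = oddLetter (oddPart x i) :=
  (oddLetter_pairOf _ ((x.2 _).trans (oddLetter_mod i))).symm

/-- The word `(2k) (2k-1) (2k+1) (2k)`, a decomposition of the doubled reflection `s̃_k`. -/
def block (k : ℕ) : List ℕ := [2 * k, 2 * k - 1, 2 * k + 1, 2 * k]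

/-- The subword of `block k` selected by `e ∈ {0,1}^4`. -/
def maskedBlock (k : ℕ) (e : Fin 4 → Fin 2) : List ℕ :=
  (if e 0 = 1 then [2 * k] else []) ++ (if e 1 = 1 then [2 * k - 1] else []) ++
    (if e 2 = 1 then [2 * k + 1] else []) ++ (if e 3 = 1 then [2 * k] else [])

/-- For the word `j_1 … j_l`, the subword `𝐰̃[x]` of the doubled word
`block j_1 … block j_l` selected by the mask `x ∈ ({0,1}^4)^l`. -/
def maskedWord {l : ℕ} (j : Fin l → ℕ) (x : Fin l → Fin 4 → Fin 2) : List ℕ :=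
  (List.ofFn fun i => maskedBlock (j i) (x i)).flatten

/-- The sign of a mask, `∏ (-1)^{x_{i,k}}`. -/
def maskSign {l : ℕ} (x : Fin l → Fin 4 → Fin 2) : ℤ := ∏ i, ∏ k, (-1) ^ (x i k).val

/-- `i` is in the right neighbor set of `A` in `B`, and `ν_A^B(i) = i'`: there are `t > 0` and
indices `i = i_0 < i_1 < ⋯ < i_t = i'` with `i, i' ∈ B \ A`, `i_1, …, i_{t-1} ∈ A` and
`j_{i_k} = j_i + k` for all `k`. When `j` is injective, `i'` is determined by `i`. -/
def IsRightNeighbor {l : ℕ} (j : Fin l → ℕ) (A B : Finset (Fin l)) (i i' : Fin l) : Prop :=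
  i ∈ B \ A ∧ i' ∈ B \ A ∧ ∃ (t : ℕ) (c : ℕ → Fin l), 0 < t ∧ c 0 = i ∧ c t = i' ∧
    (∀ k < t, c k < c (k + 1)) ∧ (∀ k, 0 < k → k < t → c k ∈ A) ∧ ∀ k ≤ t, j (c k) = j i + k

/-- The same for the left neighbor set, with `i = i_0 > i_1 > ⋯ > i_t = i'`. -/
def IsLeftNeighbor {l : ℕ} (j : Fin l → ℕ) (A B : Finset (Fin l)) (i i' : Fin l) : Prop :=
  i ∈ B \ A ∧ i' ∈ B \ A ∧ ∃ (t : ℕ) (c : ℕ → Fin l), 0 < t ∧ c 0 = i ∧ c t = i' ∧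
    (∀ k < t, c (k + 1) < c k) ∧ (∀ k, 0 < k → k < t → c k ∈ A) ∧ ∀ k ≤ t, j (c k) = j i + k

/-- The right neighbor set of `A` in `B`. -/
def rightNbrs {l : ℕ} (j : Fin l → ℕ) (A B : Finset (Fin l)) : Finset (Fin l) :=
  univ.filter fun i => ∃ i', IsRightNeighbor j A B i i'

/-- The left neighbor set of `A` in `B`. -/
def leftNbrs {l : ℕ} (j : Fin l → ℕ) (A B : Finset (Fin l)) : Finset (Fin l) :=
  univ.filter fun i => ∃ i', IsLeftNeighbor j A B i i'

/-- The neighbor set `N_A^B`. -/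
def nbrs {l : ℕ} (j : Fin l → ℕ) (A B : Finset (Fin l)) : Finset (Fin l) :=
  rightNbrs j A B ∪ leftNbrs j A B

/-- A triplet `(I_e, I, I_f)` of subsets of the index set of the word. -/
@[ext] structure Triplet (l : ℕ) where
  Ie : Finset (Fin l)
  I : Finset (Fin l)
  If : Finset (Fin l)

/-- The triplets with `I_f ⊆ I_e` and `I ⊆ N_{I_f}^{I_e}`; they form the set `𝒯`. -/
def Triplet.IsAdmissible {l : ℕ} (j : Fin l → ℕ) (Q : Triplet l) : Prop :=
  Q.If ⊆ Q.Ie ∧ Q.I ⊆ nbrs j Q.If Q.Ie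

/-- The word `(2a) (2a+1) block(a+1) … block(b-1) (2b)`. -/
def rightConnector (a b : ℕ) : List ℕ :=
  [2 * a, 2 * a + 1] ++ (List.range' (a + 1) (b - a - 1)).flatMap block ++ [2 * b]

/-- The word `(2b) block(b-1) … block(a+1) (2a+1) (2a)`. -/
def leftConnector (a b : ℕ) : List ℕ :=
  [2 * b] ++ (List.range' (a + 1) (b - a - 1)).reverse.flatMap block ++ [2 * a + 1, 2 * a]

/-- The set `{i : s_{2 j_i} ≤ u}`. -/
def setIe (n : ℕ) {l : ℕ} (j : Fin l → ℕ) (u : Perm (Fin (2 * n))) : Finset (Fin l) :=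
  univ.filter fun i => BruhatLE (simpleRefl (2 * n) (2 * j i)) u

/-- The set `{i : s̃_{j_i} ≤ u}`. -/
def setIf (n : ℕ) {l : ℕ} (j : Fin l → ℕ) (u : Perm (Fin (2 * n))) : Finset (Fin l) :=
  univ.filter fun i => BruhatLE (tilde (simpleRefl n (j i))) u

/-- The triplet `𝐩(u) = (I_e, I, I_f)` attached to `u ≤ w̃`, where `w = s_{j_1} ⋯ s_{j_l}`. -/
def tripletOf (n : ℕ) {l : ℕ} (j : Fin l → ℕ) (u : Perm (Fin (2 * n))) : Triplet l where
  Ie := setIe n j u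
  I := univ.filter fun i =>
    (∃ i', IsRightNeighbor j (setIf n j u) univ i i' ∧
      BruhatLE (wordProd (2 * n) (rightConnector (j i) (j i'))) u) ∨
    (∃ i', IsLeftNeighbor j (setIf n j u) univ i i' ∧
      BruhatLE (wordProd (2 * n) (leftConnector (j i) (j i'))) u)
  If := setIf n j u

/-- The `i`-th piece of the word representing `𝐪(Q)`. -/
def repBlock {l : ℕ} (j : Fin l → ℕ) (Q : Triplet l) (i : Fin l) : List ℕ :=
  if i ∉ Q.Ie then []
  else if i ∈ Q.If then block (j i)
  else if i ∈ Q.I ∩ rightNbrs j Q.If univ then [2 * j i, 2 * j i + 1]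
  else if i ∈ Q.I ∩ leftNbrs j Q.If univ then [2 * j i + 1, 2 * j i]
  else [2 * j i]

/-- The element `𝐪(Q)` of `S_{2n}`. -/
def repOf (n : ℕ) {l : ℕ} (j : Fin l → ℕ) (Q : Triplet l) : Perm (Fin (2 * n)) :=
  wordProd (2 * n) (List.ofFn fun i => repBlock j Q i).flatten

end

/-! Everything is read off from the ranks r_u(p,q) = #{x < p : u x ≥ q}, which determine the Bruhat
order (`bruhatLE_iff_rankCount_le`). For a product w of distinct simple reflections and a ≤ b,
r_w(a,b) is 1 or 0 according as b, b-1, …, a is a subword or not (`rankCount_wordProd`); ranks on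
the other side of the diagonal come from w⁻¹. The rank of an element (s,t) of K at an even position
is r_s + r_t. If r_s + r_t ≤ 2 r_w, then s, t ≤ w: a failure would need a rank of s above 1 on the
diagonal, which would make both a, a+1 and a+1, a subwords of w. This is claim 1, and it uses even
ranks only.

Even ranks are exactly the invariants of the H-double cosets (`mem_doubleCoset_of_evenRankEq`), and
every comparison defining 𝐩 can be tested on them, so 𝐩 is constant on double cosets. The signed
mask sum may therefore be computed modulo H on both sides. There a block (1-S)X(1-S), with S =
s_{2k} and X = (1-s_{2k-1})(1-s_{2k+1}), may be replaced by SXS, the signed sum of the four elements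
(s,t) of K with s, t ∈ {1, s_k}; the other three terms die. This is done from the largest letter
down, and it works because k+1 occurs on at most one side of k (`apply_prod_blockElt`). What remains
is a sum over pairs (E,O) of index sets, that is, over the u ∈ K below w̃.

For such a pair, I_e = E ∪ O, I_f = E ∩ O, and I consists of the neighbors i that lie on the same
side as ν(i) (`tripletOf_parityPerm`). So the pairs with triplet Q are the 2-colorings of I_e \ I_f
with equality or difference prescribed along the edges i — ν(i) of a forest. Each edge halves their
number, and all of them have the same sign.

Finally, tracing letters through a product of blocks (`rankCount_prod_blocks`) shows that 𝐪(Q) has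
the even ranks of each of these pairs, so H𝐪(Q)H ∩ K is precisely the set just counted. -/

noncomputable section

/-- The number of `x < p` with `q ≤ u x`; these numbers determine the Bruhat order. -/
def rankCount {m : ℕ} (u : Perm (Fin m)) (p q : ℕ) : ℕ :=
  (univ.filter fun x : Fin m => x.val < p ∧ q ≤ (u x).val).card

/-! ### Ranks and the Bruhat order -/

section RankCount

variable {m : ℕ}

theorem rankCount_eq_sum (u : Perm (Fin m)) (p q : ℕ) :
    rankCount u p q = ∑ x : Fin m, if x.val < p ∧ q ≤ (u x).val then 1 else 0 := by
  rw [rankCount, card_filter]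

theorem rankCount_mono (u : Perm (Fin m)) {p p' q q' : ℕ} (hp : p ≤ p') (hq : q' ≤ q) :
    rankCount u p q ≤ rankCount u p' q' := by
  apply card_le_card
  intro x
  simp only [mem_filter, mem_univ, true_and]
  omega

theorem rankCount_succ_left (u : Perm (Fin m)) (p q : ℕ) (hp : p < m) :
    rankCount u (p + 1) q = rankCount u p q + if q ≤ (u ⟨p, hp⟩).val then 1 else 0 := by
  have h1 : (if q ≤ (u ⟨p, hp⟩).val then 1 else 0) =
      ∑ x : Fin m, if x = ⟨p, hp⟩ then (if q ≤ (u x).val then 1 else 0) else 0 := by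
    simp
  rw [rankCount_eq_sum, rankCount_eq_sum, h1, ← sum_add_distrib]
  refine sum_congr rfl fun x _ => ?_
  by_cases hx : x = ⟨p, hp⟩
  · subst hx; simp
  · have : x.val ≠ p := fun h => hx (Fin.ext h)
    simp only [hx, if_false, add_zero]
    congr 1
    apply propext
    omega

theorem rankCount_of_le (u : Perm (Fin m)) (p q : ℕ) (hp : m ≤ p) :
    rankCount u p q = rankCount u m q := by
  unfold rankCount
  congr 1
  ext x
  have := x.isLt
  simp only [mem_filter, mem_univ, true_and]
  omega

theorem rankCount_eq_zero_of_le (u : Perm (Fin m)) (p q : ℕ) (hq : m ≤ q) :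
    rankCount u p q = 0 := by
  simp only [rankCount, card_eq_zero, filter_eq_empty_iff, mem_univ, true_implies]
  intro x
  have := (u x).isLt
  omega

theorem rankCount_zero_left (u : Perm (Fin m)) (q : ℕ) : rankCount u 0 q = 0 := by
  simp [rankCount]

theorem card_filter_val_lt (p : ℕ) (hp : p ≤ m) :
    (univ.filter fun x : Fin m => x.val < p).card = p := by
  rw [Fin.card_filter_val_lt, min_eq_right hp]

theorem rankCount_inv_aux (u : Perm (Fin m)) (p q : ℕ) :
    rankCount u⁻¹ q p = (univ.filter fun x : Fin m => p ≤ x.val ∧ (u x).val < q).card := by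
  unfold rankCount
  refine card_bij' (fun x _ => u⁻¹ x) (fun x _ => u x) ?_ ?_ ?_ ?_ <;> simp +contextual

/-- Both ranks are complementary to the number of `x < p` with `u x < q`. This exchanges the two
sides of the diagonal at the cost of passing to the inverse. -/
theorem rankCount_add (u : Perm (Fin m)) (p q : ℕ) (hp : p ≤ m) (hq : q ≤ m) :
    rankCount u p q + q = rankCount u⁻¹ q p + p := by
  have h1 : (univ.filter fun x : Fin m => x.val < p ∧ (u x).val < q).card + rankCount u p q = p := by
    have h3 := card_filter_val_lt (m := m) p hp
    rw [rankCount, ← card_union_of_disjoint]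
    · refine Eq.trans ?_ h3
      congr 1
      ext x
      simp only [mem_union, mem_filter, mem_univ, true_and]
      omega
    · rw [disjoint_left]
      intro x
      simp only [mem_filter, mem_univ, true_and]
      omega
  have h2 : (univ.filter fun x : Fin m => x.val < p ∧ (u x).val < q).card
      + rankCount u⁻¹ q p = q := by
    have h3 : (univ.filter fun x : Fin m => (u x).val < q).card = q := by
      refine Eq.trans ?_ (card_filter_val_lt (m := m) q hq)
      refine card_bij' (fun x _ => u x) (fun x _ => u⁻¹ x) ?_ ?_ ?_ ?_ <;> simp +contextual
    rw [rankCount_inv_aux, ← card_union_of_disjoint]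
    · refine Eq.trans ?_ h3
      congr 1
      ext x
      simp only [mem_union, mem_filter, mem_univ, true_and]
      omega
    · rw [disjoint_left]
      intro x
      simp only [mem_filter, mem_univ, true_and]
      omega
  omega

theorem rankCount_le_succ_left (u : Perm (Fin m)) (p q : ℕ) :
    rankCount u (p + 1) q ≤ rankCount u p q + 1 := by
  by_cases hp : p < m
  · rw [rankCount_succ_left u p q hp]
    split_ifs <;> omega
  · rw [rankCount_of_le u (p + 1) q (by omega), rankCount_of_le u p q (by omega)]
    omega

theorem rankCount_le_succ_right (u : Perm (Fin m)) (p q : ℕ) :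
    rankCount u p q ≤ rankCount u p (q + 1) + 1 := by
  by_cases hq : q < m
  · by_cases hp : p ≤ m
    · have h1 := rankCount_add u p q hp hq.le
      have h2 := rankCount_add u p (q + 1) hp hq
      have h3 := rankCount_mono u⁻¹ (le_refl p |>.trans (le_refl p)) (le_refl q)
      have h4 := rankCount_mono u⁻¹ (Nat.le_succ q) (le_refl p)
      simp only [Nat.succ_eq_add_one] at h4
      omega
    · rw [rankCount_of_le u p q (by omega), rankCount_of_le u p (q + 1) (by omega)]
      have h1 := rankCount_add u m q le_rfl hq.le
      have h2 := rankCount_add u m (q + 1) le_rfl hq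
      have h4 := rankCount_mono u⁻¹ (Nat.le_succ q) (le_refl m)
      simp only [Nat.succ_eq_add_one] at h4
      omega
  · rw [rankCount_eq_zero_of_le u p q (by omega)]
    omega

theorem sub_le_rankCount (u : Perm (Fin m)) (p q : ℕ) (hp : p ≤ m) : p ≤ rankCount u p q + q := by
  by_cases hq : q ≤ m
  · have := rankCount_add u p q hp hq
    omega
  · omega

/-- The effect of an upward step on the ranks. -/
theorem rankCount_mul_swap (u : Perm (Fin m)) (a b : Fin m) (hab : a < b) (huv : u a < u b)
    (p q : ℕ) : rankCount (u * swap a b) p q = rankCount u p q +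
      if (a.val < p ∧ p ≤ b.val) ∧ ((u a).val < q ∧ q ≤ (u b).val) then 1 else 0 := by
  have key : ∀ f : Fin m → ℕ, ∑ x, f x = f a + (f b + ∑ x ∈ (univ.erase a).erase b, f x) := by
    intro f
    rw [← add_sum_erase univ f (mem_univ a), ← add_sum_erase (univ.erase a) f (a := b)]
    simp [hab.ne']
  rw [rankCount_eq_sum, rankCount_eq_sum, key, key fun x => if x.val < p ∧ q ≤ (u x).val then 1 else 0]
  have hrest : ∑ x ∈ (univ.erase a).erase b,
      (if x.val < p ∧ q ≤ ((u * swap a b) x).val then 1 else 0) =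
      ∑ x ∈ (univ.erase a).erase b, (if x.val < p ∧ q ≤ (u x).val then 1 else 0) := by
    refine sum_congr rfl fun x hx => ?_
    simp only [mem_erase, mem_univ, and_true] at hx
    rw [Perm.mul_apply, swap_apply_of_ne_of_ne hx.2 hx.1]
  rw [hrest]
  simp only [Perm.mul_apply, swap_apply_left, swap_apply_right]
  have h1 : a.val < b.val := hab
  have h2 : (u a).val < (u b).val := huv
  split_ifs <;> omega

theorem BruhatStep.rankCount_le {u v : Perm (Fin m)} (h : BruhatStep u v) (p q : ℕ) :
    rankCount u p q ≤ rankCount v p q := by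
  obtain ⟨a, b, hab, huv, rfl⟩ := h
  rw [rankCount_mul_swap u a b hab huv]
  omega

theorem BruhatLE.rankCount_le {u v : Perm (Fin m)} (h : BruhatLE u v) (p q : ℕ) :
    rankCount u p q ≤ rankCount v p q := by
  induction h with
  | refl => rfl
  | tail _ h ih => exact ih.trans (h.rankCount_le p q)

/-- At the first position `a` where they differ, `u a < v a`. Exchange it with the first later
position `b` whose value lies above `u a` and not above `v a`; the ranks that grow are ones where
`v` has room to spare. -/
theorem exists_bruhatStep {u v : Perm (Fin m)} (h : ∀ p q, rankCount u p q ≤ rankCount v p q)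
    (hne : u ≠ v) : ∃ u', BruhatStep u u' ∧ ∀ p q, rankCount u' p q ≤ rankCount v p q := by
  have hex : ∃ k, ∃ hk : k < m, u ⟨k, hk⟩ ≠ v ⟨k, hk⟩ := by
    by_contra hcon
    push Not at hcon
    exact hne (Equiv.ext fun x => hcon x.val x.isLt)
  obtain ⟨ha, hav⟩ := Nat.find_spec hex
  set a : Fin m := ⟨Nat.find hex, ha⟩ with ha_def
  have hlt : ∀ x : Fin m, x < a → u x = v x := by
    intro x hx
    by_contra hcon
    exact Nat.find_min hex (m := x.val) hx ⟨x.isLt, hcon⟩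
  have hagree : ∀ q, rankCount u a.val q = rankCount v a.val q := by
    intro q
    unfold rankCount
    congr 1
    ext x
    simp only [mem_filter, mem_univ, true_and]
    constructor <;> rintro ⟨h1, h2⟩
    · rw [← hlt x h1]; exact ⟨h1, h2⟩
    · rw [hlt x h1]; exact ⟨h1, h2⟩
  have huva : u a < v a := by
    have h1 := h (a.val + 1) (u a).val
    rw [rankCount_succ_left u _ _ a.isLt, rankCount_succ_left v _ _ a.isLt, hagree] at h1
    simp only [Fin.eta, le_refl, if_true] at h1
    split_ifs at h1 with h2
    · exact lt_of_le_of_ne h2 hav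
    · omega
  have hexb : ∃ k, ∃ hk : k < m, a.val < k ∧ u a < u ⟨k, hk⟩ ∧ u ⟨k, hk⟩ ≤ v a := by
    have hne' : u⁻¹ (v a) ≠ a := by
      intro h1
      apply hav
      have := congrArg u h1
      simpa using this.symm
    have hge : a < u⁻¹ (v a) := by
      rcases lt_trichotomy a (u⁻¹ (v a)) with h1 | h1 | h1
      · exact h1
      · exact absurd h1.symm hne'
      · have h2 := hlt _ h1
        rw [show u (u⁻¹ (v a)) = v a from u.apply_symm_apply _] at h2
        exact absurd (v.injective h2).symm hne'
    exact ⟨(u⁻¹ (v a)).val, (u⁻¹ (v a)).isLt, hge, by simpa using huva, by simp⟩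
  obtain ⟨hb, hab, hub, hubv⟩ := Nat.find_spec hexb
  set b : Fin m := ⟨Nat.find hexb, hb⟩ with hb_def
  have hmid : ∀ x : Fin m, a < x → x < b → ¬ (u a < u x ∧ u x ≤ v a) := by
    intro x h1 h2 h3
    exact Nat.find_min hexb (m := x.val) h2 ⟨x.isLt, h1, h3⟩
  refine ⟨u * swap a b, ⟨a, b, hab, hub, rfl⟩, fun p q => ?_⟩
  rw [rankCount_mul_swap u a b hab hub]
  split_ifs with hreg
  swap
  · exact h p q
  obtain ⟨⟨hp1, hp2⟩, hq1, hq2⟩ := hreg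
  have hqv : q ≤ (v a).val := hq2.trans hubv
  -- Values above `v a` are covered by the hypothesis. Values from `q` to `v a` at positions below
  -- `p ≤ b` occur for `u` only before `a`, where `v` agrees, whereas `v` takes one more at `a`
  -- itself.
  have split : ∀ w : Perm (Fin m), rankCount w p q = rankCount w p ((v a).val + 1) +
      (univ.filter fun x : Fin m => x.val < p ∧ q ≤ (w x).val ∧ (w x).val ≤ (v a).val).card := by
    intro w
    rw [rankCount, rankCount, ← card_union_of_disjoint]
    · congr 1
      ext x
      simp only [mem_union, mem_filter, mem_univ, true_and]
      omega
    · rw [disjoint_left]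
      intro x
      simp only [mem_filter, mem_univ, true_and]
      omega
  rw [split u, split v, add_assoc]
  refine Nat.add_le_add (h _ _) ?_
  have hanot : a ∉ univ.filter fun x : Fin m =>
      x.val < p ∧ q ≤ (u x).val ∧ (u x).val ≤ (v a).val := by
    simp only [mem_filter, mem_univ, true_and]
    omega
  rw [← card_insert_of_notMem hanot]
  apply card_le_card
  intro x
  simp only [mem_insert, mem_filter, mem_univ, true_and]
  rintro (rfl | ⟨h1, h2, h3⟩)
  · exact ⟨hp1, hqv, le_rfl⟩
  · rcases lt_trichotomy x a with hx | hx | hx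
    · rw [← hlt x hx]; exact ⟨h1, h2, h3⟩
    · subst hx
      exact ⟨hp1, hqv, le_rfl⟩
    · have hxb : x < b := Nat.lt_of_lt_of_le h1 hp2
      exact absurd ⟨Nat.lt_of_lt_of_le hq1 h2, h3⟩ (hmid x hx hxb)

/-- The rank criterion for the Bruhat order. -/
theorem bruhatLE_iff_rankCount_le {u v : Perm (Fin m)} :
    BruhatLE u v ↔ ∀ p q, rankCount u p q ≤ rankCount v p q := by
  refine ⟨BruhatLE.rankCount_le, fun h => ?_⟩
  -- `N` bounds how far the total rank of `u` lies below that of `v`; each upward step raises the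
  -- former strictly.
  have hmain : ∀ N : ℕ, ∀ u : Perm (Fin m), (∀ p q, rankCount u p q ≤ rankCount v p q) →
      (∑ p ∈ range (m + 1), ∑ q ∈ range (m + 1), rankCount v p q) ≤
        (∑ p ∈ range (m + 1), ∑ q ∈ range (m + 1), rankCount u p q) + N → BruhatLE u v := by
    intro N
    induction N with
    | zero =>
      intro u h hN
      by_contra hcon
      obtain ⟨u', ⟨a, b, hab, huab, rfl⟩, h2⟩ := exists_bruhatStep h (by
        rintro rfl
        exact hcon Relation.ReflTransGen.refl)
      have hlt : (∑ p ∈ range (m + 1), ∑ q ∈ range (m + 1), rankCount u p q) <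
          ∑ p ∈ range (m + 1), ∑ q ∈ range (m + 1), rankCount v p q := by
        have hle : ∀ p q, rankCount u p q ≤ rankCount v p q := h
        refine sum_lt_sum (fun p _ => sum_le_sum fun q _ => h p q) ⟨b.val, by simp, ?_⟩
        refine sum_lt_sum (fun q _ => h _ q) ⟨(u b).val, by simp, ?_⟩
        have h3 := h2 b.val (u b).val
        rw [rankCount_mul_swap u a b hab huab, if_pos ⟨⟨hab, le_rfl⟩, huab, le_rfl⟩] at h3
        omega
      omega
    | succ N ih =>
      intro u h hN
      by_cases huv : u = v
      · rw [huv]; exact Relation.ReflTransGen.refl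
      obtain ⟨u', hstep, h2⟩ := exists_bruhatStep h huv
      refine Relation.ReflTransGen.head hstep (ih u' h2 ?_)
      obtain ⟨a, b, hab, huab, rfl⟩ := hstep
      have hlt : (∑ p ∈ range (m + 1), ∑ q ∈ range (m + 1), rankCount u p q) <
          ∑ p ∈ range (m + 1), ∑ q ∈ range (m + 1), rankCount (u * swap a b) p q := by
        have hle : ∀ p q, rankCount u p q ≤ rankCount (u * swap a b) p q := fun p q => by
          rw [rankCount_mul_swap u a b hab huab]
          omega
        refine sum_lt_sum (fun p _ => sum_le_sum fun q _ => hle p q) ⟨b.val, by simp, ?_⟩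
        refine sum_lt_sum (fun q _ => hle _ q) ⟨(u b).val, by simp, ?_⟩
        rw [rankCount_mul_swap u a b hab huab, if_pos ⟨⟨hab, le_rfl⟩, huab, le_rfl⟩]
        omega
      omega
  exact hmain _ u h (Nat.le_add_left _ _)

theorem bruhatLE_iff_rankCount_le' {u v : Perm (Fin m)} :
    BruhatLE u v ↔ ∀ p ≤ m, ∀ q ≤ m, rankCount u p q ≤ rankCount v p q := by
  rw [bruhatLE_iff_rankCount_le]
  refine ⟨fun h p _ q _ => h p q, fun h p q => ?_⟩
  by_cases hq : q ≤ m
  · by_cases hp : p ≤ m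
    · exact h p hp q hq
    · rw [rankCount_of_le u p q (by omega), rankCount_of_le v p q (by omega)]
      exact h m le_rfl q hq
  · rw [rankCount_eq_zero_of_le u p q (by omega)]
    omega

theorem bruhatLE_inv {u v : Perm (Fin m)} (h : BruhatLE u v) : BruhatLE u⁻¹ v⁻¹ := by
  rw [bruhatLE_iff_rankCount_le'] at h ⊢
  intro p hp q hq
  have h1 := rankCount_add u q p hq hp
  have h2 := rankCount_add v q p hq hp
  have h3 := h q hq p hp
  omega

theorem bruhatLE_inv_comm {u v : Perm (Fin m)} : BruhatLE u⁻¹ v ↔ BruhatLE u v⁻¹ :=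
  ⟨fun h => by simpa using bruhatLE_inv h, fun h => by simpa using bruhatLE_inv h⟩

/-- To compare two permutations it suffices to compare the ranks at positions where the smaller
one is larger than the identity on one side of the diagonal or the other. -/
theorem bruhatLE_iff_rankCount_le_of_le {u v : Perm (Fin m)} :
    BruhatLE u v ↔ (∀ p q, p ≤ q → q ≤ m → rankCount u p q ≤ rankCount v p q) ∧
      ∀ p q, p ≤ q → q ≤ m → rankCount u⁻¹ p q ≤ rankCount v⁻¹ p q := by
  constructor
  · intro h
    exact ⟨fun p q _ _ => h.rankCount_le p q, fun p q _ _ => (bruhatLE_inv h).rankCount_le p q⟩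
  · rintro ⟨h1, h2⟩
    rw [bruhatLE_iff_rankCount_le']
    intro p hp q hq
    rcases le_total p q with hpq | hpq
    · exact h1 p q hpq hq
    · have h3 := rankCount_add u p q hp hq
      have h4 := rankCount_add v p q hp hq
      have h5 := h2 q p hpq hp
      omega

end RankCount

/-! ### Simple reflections, words and subwords -/

section SimpleReflections

variable {m : ℕ}

theorem simpleRefl_val (k : ℕ) (hk : 1 ≤ k ∧ k < m) (x : Fin m) :
    (simpleRefl m k x).val =
      if x.val + 1 = k then k else if x.val = k then k - 1 else x.val := by
  rw [simpleRefl, dif_pos hk, swap_apply_def]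
  simp only [Fin.ext_iff]
  split_ifs <;> first | omega | rfl

theorem simpleRefl_mul_self (k : ℕ) : simpleRefl m k * simpleRefl m k = 1 := by
  unfold simpleRefl
  split_ifs <;> simp

theorem simpleRefl_inv (k : ℕ) : (simpleRefl m k)⁻¹ = simpleRefl m k :=
  inv_eq_of_mul_eq_one_left (simpleRefl_mul_self k)

theorem wordProd_nil : wordProd m [] = 1 := rfl

theorem wordProd_cons (k : ℕ) (L : List ℕ) :
    wordProd m (k :: L) = simpleRefl m k * wordProd m L := by
  simp [wordProd]

theorem wordProd_append (L L' : List ℕ) :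
    wordProd m (L ++ L') = wordProd m L * wordProd m L' := by
  simp [wordProd]

theorem wordProd_reverse (L : List ℕ) : wordProd m L.reverse = (wordProd m L)⁻¹ := by
  induction L with
  | nil => simp [wordProd]
  | cons k L ih =>
    rw [List.reverse_cons, wordProd_append, ih, wordProd_cons, wordProd_cons, wordProd_nil,
      mul_inv_rev, simpleRefl_inv, mul_one]

theorem rankCount_simpleRefl_mul_of_ne (k : ℕ) (hk : 1 ≤ k ∧ k < m) (u : Perm (Fin m)) (p q : ℕ)
    (hq : q ≠ k) : rankCount (simpleRefl m k * u) p q = rankCount u p q := by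
  unfold rankCount
  congr 1
  ext x
  simp only [mem_filter, mem_univ, true_and, Perm.mul_apply, simpleRefl_val k hk]
  split_ifs <;> omega

/-- Left multiplication exchanges the values `k - 1` and `k`: old and new rank together count each
of these once and every larger value twice. -/
theorem rankCount_simpleRefl_mul (k : ℕ) (hk : 1 ≤ k ∧ k < m) (u : Perm (Fin m)) (p : ℕ) :
    rankCount (simpleRefl m k * u) p k + rankCount u p k =
      rankCount u p (k + 1) + rankCount u p (k - 1) := by
  simp only [rankCount_eq_sum, ← sum_add_distrib]
  refine sum_congr rfl fun x _ => ?_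
  simp only [Perm.mul_apply, simpleRefl_val k hk]
  split_ifs <;> omega

/-- The exchange property. -/
theorem exists_sublist_of_bruhatStep (L : List ℕ) (hL : ∀ k ∈ L, 1 ≤ k ∧ k < m)
    {u : Perm (Fin m)} (h : BruhatStep u (wordProd m L)) :
    ∃ L', L'.Sublist L ∧ u = wordProd m L' := by
  obtain ⟨a, b, hab, huab, heq⟩ := h
  have hu : u = wordProd m L * swap a b := by rw [heq, mul_assoc, swap_mul_self, mul_one]
  have hinv : wordProd m L b < wordProd m L a := by
    rw [heq]; simpa using huab
  clear heq huab
  induction L generalizing u with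
  | nil => simp only [wordProd_nil, Perm.one_apply] at hinv; exact absurd hinv hab.not_gt
  | cons k L ih =>
    have hk := hL k (by simp)
    -- Either the tail already inverts `a` and `b`, and a letter is deleted there, or the first
    -- letter creates the inversion; then it is the transposition of the two values and is itself
    -- deleted.
    by_cases hc : wordProd m L b < wordProd m L a
    · obtain ⟨L', h1, h2⟩ := ih (fun k hk => hL k (by simp [hk])) rfl hc
      refine ⟨k :: L', h1.cons_cons k, ?_⟩
      rw [hu, wordProd_cons, wordProd_cons, mul_assoc, h2]
    · refine ⟨L, List.sublist_cons_self k L, ?_⟩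
      have hne : (wordProd m L a).val ≠ (wordProd m L b).val := fun h =>
        hab.ne ((wordProd m L).injective (Fin.ext h))
      rw [wordProd_cons, Perm.mul_apply, Perm.mul_apply, Fin.lt_def, simpleRefl_val k hk,
        simpleRefl_val k hk] at hinv
      rw [Fin.lt_def] at hc
      have hva : (wordProd m L a).val + 1 = k ∧ (wordProd m L b).val = k := by
        split_ifs at hinv <;> omega
      have hsw : simpleRefl m k = swap (wordProd m L a) (wordProd m L b) := by
        rw [simpleRefl, dif_pos hk]
        congr 1 <;> ext <;> simp <;> omega
      rw [hu, wordProd_cons, hsw, mul_assoc,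
        Equiv.mul_swap_eq_swap_mul (wordProd m L) a b, ← mul_assoc, swap_mul_self, one_mul]

theorem exists_sublist_of_bruhatLE (L : List ℕ) (hL : ∀ k ∈ L, 1 ≤ k ∧ k < m)
    {u : Perm (Fin m)} (h : BruhatLE u (wordProd m L)) :
    ∃ L', L'.Sublist L ∧ u = wordProd m L' := by
  induction h using Relation.ReflTransGen.head_induction_on with
  | refl => exact ⟨L, List.Sublist.refl L, rfl⟩
  | head hstep _ ih =>
    obtain ⟨L', h1, rfl⟩ := ih
    obtain ⟨L'', h2, h3⟩ := exists_sublist_of_bruhatStep L' (fun k hk => hL k (h1.subset hk)) hstep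
    exact ⟨L'', h2.trans h1, h3⟩

end SimpleReflections

/-! ### Ranks of Boolean permutations -/

/-- The list `b, b - 1, …, a`. -/
def descList (a b : ℕ) : List ℕ := (List.range' a (b + 1 - a)).reverse

theorem descList_self (a : ℕ) : descList a a = [a] := by
  simp [descList]

theorem descList_succ (a b : ℕ) (h : a ≤ b + 1) : descList a (b + 1) = (b + 1) :: descList a b := by
  rw [descList, descList, show b + 1 + 1 - a = (b + 1 - a) + 1 by omega, List.range'_1_concat,
    List.reverse_append]
  simp
  omega

theorem descList_append (a b : ℕ) (h : a ≤ b) : descList a b = descList (a + 1) b ++ [a] := by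
  rw [descList, descList, show b + 1 - a = (b - a) + 1 by omega, List.range'_succ,
    List.reverse_cons, show b + 1 - (a + 1) = b - a by omega]

theorem mem_descList {a b x : ℕ} : x ∈ descList a b ↔ a ≤ x ∧ x ≤ b := by
  simp only [descList, List.mem_reverse, List.mem_range'_1]
  omega

theorem List.cons_sublist_cons_of_ne {α : Type*} {a b : α} {l l' : List α} (h : a ≠ b) :
    (a :: l).Sublist (b :: l') ↔ (a :: l).Sublist l' := by
  rw [List.sublist_cons_iff]
  refine ⟨?_, Or.inl⟩
  rintro (h1 | ⟨r, h1, -⟩)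
  · exact h1
  · simp at h1
    exact absurd h1.1 h

section BooleanRank

variable {n : ℕ}

/-- The ranks of a product of distinct simple reflections. -/
theorem rankCount_wordProd (L : List ℕ) (hL : ∀ k ∈ L, 1 ≤ k ∧ k < n) (hd : L.Nodup)
    (a b : ℕ) (hab : a ≤ b) :
    rankCount (wordProd n L) a b = if (descList a b).Sublist L then 1 else 0 := by
  have hne : ∀ a b : ℕ, a ≤ b → ∀ M : List ℕ, b ∉ M → ¬ (descList a b).Sublist M := by
    intro a b h M hM hs
    exact hM (hs.subset (mem_descList.2 ⟨h, le_rfl⟩))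
  induction L generalizing a b with
  | nil =>
    rw [if_neg (hne a b hab [] (by simp)), wordProd_nil, rankCount, card_eq_zero,
      filter_eq_empty_iff]
    intro x _
    simp only [Perm.one_apply]
    omega
  | cons k L ih =>
    have hk := hL k (by simp)
    have ih := ih (fun k hk => hL k (by simp [hk])) (List.nodup_cons.1 hd).2
    have hkL := (List.nodup_cons.1 hd).1
    rw [wordProd_cons]
    by_cases hb : b = k
    -- The tail omits the letter `b`, so its ranks at `(a, b)` and `(a, b + 1)` vanish and the new
    -- rank equals that of the tail at `(a, b - 1)`.
    · subst hb
      have h1 := rankCount_simpleRefl_mul b hk (wordProd n L) a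
      have h2 := ih a b hab
      rw [if_neg (hne a b hab L hkL)] at h2
      have h3 := rankCount_mono (wordProd n L) (le_refl a) (Nat.le_succ b)
      simp only [Nat.succ_eq_add_one] at h3
      obtain ⟨c, rfl⟩ : ∃ c, b = c + 1 := ⟨b - 1, by omega⟩
      simp only [descList_succ a c (by omega), List.cons_sublist_cons]
      rw [Nat.add_sub_cancel] at h1
      by_cases hac : a ≤ c
      · rw [ih a c hac] at h1
        omega
      -- Now `(a, b - 1)` is just below the diagonal, where the rank is squeezed to 1; this matches
      -- the empty remaining subword.
      · obtain rfl : a = c + 1 := by omega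
        have h4 := sub_le_rankCount (wordProd n L) (c + 1) c (by omega)
        have h5 := rankCount_le_succ_right (wordProd n L) (c + 1) c
        have h6 : descList (c + 1) c = [] := by simp [descList]
        rw [h6, if_pos (List.nil_sublist L)]
        omega
    · rw [rankCount_simpleRefl_mul_of_ne k hk _ _ _ hb, ih a b hab]
      obtain rfl | ⟨c, rfl⟩ : b = 0 ∨ ∃ c, b = c + 1 := by
        rcases b with _ | c
        · exact Or.inl rfl
        · exact Or.inr ⟨c, rfl⟩
      · obtain rfl : a = 0 := by omega
        simp only [descList_self, List.cons_sublist_cons_of_ne hb]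
      · simp only [descList_succ a c (by omega), List.cons_sublist_cons_of_ne hb]

theorem rankCount_wordProd_inv (L : List ℕ) (hL : ∀ k ∈ L, 1 ≤ k ∧ k < n) (hd : L.Nodup)
    (a b : ℕ) (hab : a ≤ b) :
    rankCount (wordProd n L)⁻¹ a b = if (List.range' a (b + 1 - a)).Sublist L then 1 else 0 := by
  rw [← wordProd_reverse, rankCount_wordProd L.reverse (by simpa using hL)
    (List.nodup_reverse.2 hd) a b hab]
  simp only [descList, List.reverse_sublist]

/-- Monotone runs that are subwords of `L'` are subwords of `L`, so the ranks given by the 0/1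
formula only grow. -/
theorem bruhatLE_wordProd_of_sublist {L L' : List ℕ} (hL : ∀ k ∈ L, 1 ≤ k ∧ k < n)
    (hd : L.Nodup) (h : L'.Sublist L) : BruhatLE (wordProd n L') (wordProd n L) := by
  have hL' : ∀ k ∈ L', 1 ≤ k ∧ k < n := fun k hk => hL k (h.subset hk)
  have hd' := hd.sublist h
  rw [bruhatLE_iff_rankCount_le_of_le]
  constructor
  · intro p q hpq _
    rw [rankCount_wordProd L hL hd p q hpq, rankCount_wordProd L' hL' hd' p q hpq]
    split_ifs with h1 h2
    · rfl
    · exact absurd (h1.trans h) h2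
    all_goals omega
  · intro p q hpq _
    rw [rankCount_wordProd_inv L hL hd p q hpq, rankCount_wordProd_inv L' hL' hd' p q hpq]
    split_ifs with h1 h2
    · rfl
    · exact absurd (h1.trans h) h2
    all_goals omega

theorem bruhatLE_wordProd_iff {L : List ℕ} (hL : ∀ k ∈ L, 1 ≤ k ∧ k < n)
    (hd : L.Nodup) (u : Perm (Fin n)) :
    BruhatLE u (wordProd n L) ↔ ∃ L', L'.Sublist L ∧ u = wordProd n L' :=
  ⟨exists_sublist_of_bruhatLE L hL, fun ⟨_, h, hu⟩ => hu ▸ bruhatLE_wordProd_of_sublist hL hd h⟩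

end BooleanRank

/-! ### The subgroup K and the first claim -/

section ParityPermutations

variable {n : ℕ}

/-- The letters of `{1, …, 2n}` as odd and even letters. -/
def letterEquiv (n : ℕ) : Fin n ⊕ Fin n ≃ Fin (2 * n) where
  toFun := Sum.elim oddLetter evenLetter
  invFun a := if a.val % 2 = 0 then Sum.inl (pairOf a) else Sum.inr (pairOf a)
  left_inv x := by
    rcases x with i | i
    · simp [oddLetter_mod, pairOf_oddLetter]
    · simp [evenLetter_mod, pairOf_evenLetter]
  right_inv a := by
    beta_reduce
    split_ifs with h
    · exact oddLetter_pairOf a h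
    · exact evenLetter_pairOf a (by omega)

/-- The element of `K` with given even and odd parts. -/
def parityPerm : Perm (Fin n) × Perm (Fin n) →* Perm (Fin (2 * n)) where
  toFun s := (letterEquiv n).permCongr (sumCongr s.2 s.1)
  map_one' := by
    ext x
    simp [Equiv.permCongr_apply]
  map_mul' s t := by
    ext x
    simp only [Equiv.permCongr_apply, Perm.mul_apply, Equiv.symm_apply_apply]
    congr 2
    rcases (letterEquiv n).symm x with i | i <;> rfl

theorem parityPerm_oddLetter (s t : Perm (Fin n)) (i : Fin n) :
    parityPerm (s, t) (oddLetter i) = oddLetter (t i) := by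
  have : (letterEquiv n).symm (oddLetter i) = Sum.inl i := (letterEquiv n).symm_apply_apply (Sum.inl i)
  show (letterEquiv n).permCongr (sumCongr t s) (oddLetter i) = _
  rw [Equiv.permCongr_apply, this]
  rfl

theorem parityPerm_evenLetter (s t : Perm (Fin n)) (i : Fin n) :
    parityPerm (s, t) (evenLetter i) = evenLetter (s i) := by
  have : (letterEquiv n).symm (evenLetter i) = Sum.inr i :=
    (letterEquiv n).symm_apply_apply (Sum.inr i)
  show (letterEquiv n).permCongr (sumCongr t s) (evenLetter i) = _
  rw [Equiv.permCongr_apply, this]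
  rfl

theorem ext_letters {u v : Perm (Fin (2 * n))} (h1 : ∀ i, u (oddLetter i) = v (oddLetter i))
    (h2 : ∀ i, u (evenLetter i) = v (evenLetter i)) : u = v := by
  ext1 x
  rcases Nat.mod_two_eq_zero_or_one x.val with h | h
  · rw [← oddLetter_pairOf x h, h1]
  · rw [← evenLetter_pairOf x h, h2]

theorem tilde_eq_parityPerm (w : Perm (Fin n)) : tilde w = parityPerm (w, w) := by
  refine ext_letters (fun i => ?_) fun i => ?_
  · rw [parityPerm_oddLetter]
    show (if _ then _ else _) = _
    rw [if_pos (oddLetter_mod i), pairOf_oddLetter]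
  · rw [parityPerm_evenLetter]
    show (if _ then _ else _) = _
    rw [if_neg (by rw [evenLetter_mod i]; simp), pairOf_evenLetter]

theorem parityPerm_parts (u : paritySubgroup n) : parityPerm (evenPart u, oddPart u) = u.1 := by
  refine ext_letters (fun i => ?_) fun i => ?_
  · rw [parityPerm_oddLetter, apply_oddLetter]
  · rw [parityPerm_evenLetter, apply_evenLetter]

theorem parityPerm_mem (s t : Perm (Fin n)) : parityPerm (s, t) ∈ paritySubgroup n := by
  intro x
  rcases Nat.mod_two_eq_zero_or_one x.val with h | h
  · rw [← oddLetter_pairOf x h, parityPerm_oddLetter, oddLetter_mod, oddLetter_mod]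
  · rw [← evenLetter_pairOf x h, parityPerm_evenLetter, evenLetter_mod, evenLetter_mod]

theorem parityPerm_injective : Function.Injective (parityPerm (n := n)) := by
  rintro ⟨s, t⟩ ⟨s', t'⟩ h
  ext i
  · have := congrArg (fun u : Perm (Fin (2 * n)) => (u (evenLetter i)).val) h
    beta_reduce at this
    rw [parityPerm_evenLetter, parityPerm_evenLetter] at this
    simp only [evenLetter] at this
    show (s i).val = (s' i).val
    omega
  · have := congrArg (fun u : Perm (Fin (2 * n)) => (u (oddLetter i)).val) h
    beta_reduce at this
    rw [parityPerm_oddLetter, parityPerm_oddLetter] at this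
    simp only [oddLetter] at this
    show (t i).val = (t' i).val
    omega

theorem sign_parityPerm (s t : Perm (Fin n)) :
    Perm.sign (parityPerm (s, t)) = Perm.sign s * Perm.sign t := by
  show Perm.sign ((letterEquiv n).permCongr (sumCongr t s)) = _
  rw [Perm.sign_permCongr]
  exact (Perm.sign_sumCongr t s).trans (mul_comm _ _)

/-- Odd and even letters contribute separately. Letters are numbered from 0, so thresholds round
down on the even part and up on the odd part. -/
theorem rankCount_parityPerm (s t : Perm (Fin n)) (p q : ℕ) :
    rankCount (parityPerm (s, t)) p q =
      rankCount s (p / 2) (q / 2) + rankCount t ((p + 1) / 2) ((q + 1) / 2) := by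
  rw [rankCount_eq_sum, rankCount_eq_sum, rankCount_eq_sum, ← (letterEquiv n).sum_comp,
    Fintype.sum_sum_type, add_comm]
  congr 1
  · refine sum_congr rfl fun i _ => ?_
    show (if (evenLetter i).val < p ∧ q ≤ (parityPerm (s, t) (evenLetter i)).val then 1 else 0) = _
    rw [parityPerm_evenLetter]
    simp only [evenLetter]
    congr 1
    apply propext
    omega
  · refine sum_congr rfl fun i _ => ?_
    show (if (oddLetter i).val < p ∧ q ≤ (parityPerm (s, t) (oddLetter i)).val then 1 else 0) = _
    rw [parityPerm_oddLetter]
    simp only [oddLetter]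
    congr 1
    apply propext
    omega

theorem rankCount_parityPerm_even (s t : Perm (Fin n)) (a b : ℕ) :
    rankCount (parityPerm (s, t)) (2 * a) (2 * b) = rankCount s a b + rankCount t a b := by
  rw [rankCount_parityPerm]
  congr 2 <;> omega

/-- If a Boolean permutation `w` satisfies `r_s + r_t ≤ 2 r_w`, then `s ≤ w`. -/
theorem bruhatLE_of_rankCount_add_le {L : List ℕ} (hL : ∀ k ∈ L, 1 ≤ k ∧ k < n) (hd : L.Nodup)
    (s t : Perm (Fin n))
    (h : ∀ a b, a ≤ n → b ≤ n →
      rankCount s a b + rankCount t a b ≤ 2 * rankCount (wordProd n L) a b) :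
    BruhatLE s (wordProd n L) := by
  have hinv : ∀ a b, a ≤ n → b ≤ n →
      rankCount s⁻¹ a b + rankCount t⁻¹ a b ≤ 2 * rankCount (wordProd n L)⁻¹ a b := by
    intro a b ha hb
    have h1 := rankCount_add s b a hb ha
    have h2 := rankCount_add t b a hb ha
    have h3 := rankCount_add (wordProd n L) b a hb ha
    have h4 := h b a hb ha
    omega
  -- As `r_s ≤ 2 r_w`, a rank of `s` that is at most 1 is at most `r_w`; by monotonicity the
  -- diagonal controls everything with `a ≤ b`. A diagonal rank of at least 2 leaves rank at least 1
  -- one step off the diagonal, for both `s` and `s⁻¹`.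
  have hdiag : ∀ a ≤ n, rankCount s a a ≤ 1 := by
    intro a ha
    by_contra hcon
    rcases a with _ | a
    · rw [rankCount_zero_left] at hcon
      omega
    have h1 := rankCount_le_succ_left s a (a + 1)
    have h2 := rankCount_add s (a + 1) (a + 1) ha ha
    have h3 := rankCount_le_succ_left s⁻¹ a (a + 1)
    have h4 := h a (a + 1) (by omega) ha
    have h5 := hinv a (a + 1) (by omega) ha
    rw [rankCount_wordProd L hL hd _ _ (by omega)] at h4
    rw [rankCount_wordProd_inv L hL hd _ _ (by omega)] at h5
    have h6 : (descList a (a + 1)).Sublist L := by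
      by_contra h6
      rw [if_neg h6] at h4
      omega
    have h7 : (List.range' a (a + 1 + 1 - a)).Sublist L := by
      by_contra h7
      rw [if_neg h7] at h5
      omega
    have h8 : List.Sublist [a, a + 1] L := by
      rwa [show a + 1 + 1 - a = 2 by omega] at h7
    have h9 : List.Sublist [a + 1, a] L := by
      rwa [descList_succ a a (by omega), descList_self] at h6
    -- A word without repetition cannot contain both `a, a + 1` and `a + 1, a` as subwords.
    obtain ⟨is, hsub⟩ := List.sublist_iff_exists_orderEmbedding_getElem?_eq.1 h8
    obtain ⟨is', hsub'⟩ := List.sublist_iff_exists_orderEmbedding_getElem?_eq.1 h9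
    have e0 := hsub 0
    have e1 := hsub 1
    have f0 := hsub' 0
    have f1 := hsub' 1
    simp only [List.getElem?_cons_zero, List.getElem?_cons_succ] at e0 e1 f0 f1
    have hpos : ∀ {x y : ℕ} {v : ℕ}, some v = L[x]? → some v = L[y]? → x = y := by
      intro x y v hx hy
      obtain ⟨hx1, hx2⟩ := List.getElem?_eq_some_iff.1 hx.symm
      obtain ⟨hy1, hy2⟩ := List.getElem?_eq_some_iff.1 hy.symm
      exact (List.Nodup.getElem_inj_iff hd).1 (hx2.trans hy2.symm)
    have g0 := hpos e0 f1
    have g1 := hpos e1 f0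
    have l0 : is 0 < is 1 := is.strictMono (by norm_num)
    have l1 : is' 0 < is' 1 := is'.strictMono (by norm_num)
    omega
  rw [bruhatLE_iff_rankCount_le_of_le]
  constructor
  · intro a b hab hb
    have h1 := h a b (by omega) hb
    have h2 := hdiag b hb
    have h3 := rankCount_mono s hab (le_refl b)
    omega
  · intro a b hab hb
    have h1 := hinv a b (by omega) hb
    have h2 := hdiag b hb
    have h3 := rankCount_mono s⁻¹ hab (le_refl b)
    have h4 := rankCount_add s b b hb hb
    omega

/-- Asking for the even ranks only lets this apply to an element of `K` known just through its
double coset. -/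
theorem rankCount_parityPerm_le_iff {L : List ℕ} (hL : ∀ k ∈ L, 1 ≤ k ∧ k < n) (hd : L.Nodup)
    (s t : Perm (Fin n))
    (h : ∀ a b, a ≤ n → b ≤ n → rankCount (parityPerm (s, t)) (2 * a) (2 * b) ≤
      rankCount (tilde (wordProd n L)) (2 * a) (2 * b)) :
    BruhatLE s (wordProd n L) ∧ BruhatLE t (wordProd n L) := by
  simp only [tilde_eq_parityPerm, rankCount_parityPerm_even] at h
  refine ⟨bruhatLE_of_rankCount_add_le hL hd s t fun a b ha hb => ?_,
    bruhatLE_of_rankCount_add_le hL hd t s fun a b ha hb => ?_⟩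
  · have := h a b ha hb
    omega
  · have := h a b ha hb
    omega

theorem bruhatLE_parityPerm_tilde_iff {L : List ℕ} (hL : ∀ k ∈ L, 1 ≤ k ∧ k < n) (hd : L.Nodup)
    (s t : Perm (Fin n)) :
    BruhatLE (parityPerm (s, t)) (tilde (wordProd n L)) ↔
      BruhatLE s (wordProd n L) ∧ BruhatLE t (wordProd n L) := by
  refine ⟨fun h => rankCount_parityPerm_le_iff hL hd s t fun a b _ _ => h.rankCount_le _ _, ?_⟩
  rintro ⟨h1, h2⟩
  rw [bruhatLE_iff_rankCount_le] at h1 h2 ⊢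
  intro p q
  rw [tilde_eq_parityPerm, rankCount_parityPerm, rankCount_parityPerm]
  exact Nat.add_le_add (h1 _ _) (h2 _ _)

end ParityPermutations

/-! ### Even ranks and double cosets of H -/

section EvenRanks

variable {n : ℕ}

theorem rankCount_one {m : ℕ} (p q : ℕ) (hp : p ≤ m) :
    rankCount (1 : Perm (Fin m)) p q = p - q := by
  have key : ∀ p q : ℕ, p ≤ q → rankCount (1 : Perm (Fin m)) p q = 0 := by
    intro p q h
    rw [rankCount, card_eq_zero, filter_eq_empty_iff]
    intro x _
    simp only [Perm.one_apply]
    omega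
  rcases le_total p q with h | h
  · rw [key p q h]
    omega
  · have h1 := rankCount_add (1 : Perm (Fin m)) p q hp (h.trans hp)
    rw [inv_one, key q p h] at h1
    omega

theorem rankCount_simpleRefl {m k : ℕ} (hk : 1 ≤ k ∧ k < m) (p q : ℕ) (hp : p ≤ m) :
    rankCount (simpleRefl m k) p q = p - q + if p = k ∧ q = k then 1 else 0 := by
  by_cases hq : q = k
  · subst hq
    have h1 := rankCount_simpleRefl_mul q hk 1 p
    rw [mul_one, rankCount_one _ _ hp, rankCount_one _ _ hp, rankCount_one _ _ hp] at h1
    split_ifs <;> omega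
  · have h1 := rankCount_simpleRefl_mul_of_ne k hk 1 p q hq
    rw [mul_one, rankCount_one _ _ hp] at h1
    rw [h1, if_neg (by omega), add_zero]

/-- The ranks of the identity are a lower bound for all ranks, and those of `s_k` exceed them at
`(k, k)` only. -/
theorem bruhatLE_simpleRefl_iff {m k : ℕ} (hk : 1 ≤ k ∧ k < m) (u : Perm (Fin m)) :
    BruhatLE (simpleRefl m k) u ↔ 1 ≤ rankCount u k k := by
  rw [bruhatLE_iff_rankCount_le']
  constructor
  · intro h
    have := h k hk.2.le k hk.2.le
    rw [rankCount_simpleRefl hk k k hk.2.le] at this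
    simpa using this
  · intro h p hp q _
    rw [rankCount_simpleRefl hk p q hp]
    have := sub_le_rankCount u p q hp
    split_ifs with h1
    · obtain ⟨rfl, rfl⟩ := h1
      omega
    · omega

/-- Permutations with the same ranks at the even positions; see
`mem_doubleCoset_of_evenRankEq`. -/
def EvenRankEq (u v : Perm (Fin (2 * n))) : Prop :=
  ∀ a b, rankCount u (2 * a) (2 * b) = rankCount v (2 * a) (2 * b)

theorem EvenRankEq.symm {u v : Perm (Fin (2 * n))} (h : EvenRankEq u v) : EvenRankEq v u :=
  fun a b => (h a b).symm

theorem EvenRankEq.trans {u v w : Perm (Fin (2 * n))} (h : EvenRankEq u v)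
    (h' : EvenRankEq v w) : EvenRankEq u w :=
  fun a b => (h a b).trans (h' a b)

theorem EvenRankEq.inv {u v : Perm (Fin (2 * n))} (h : EvenRankEq u v) : EvenRankEq u⁻¹ v⁻¹ := by
  intro a b
  have key : ∀ a ≤ n, ∀ b, rankCount u⁻¹ (2 * a) (2 * b) = rankCount v⁻¹ (2 * a) (2 * b) := by
    intro a ha b
    by_cases hb : b ≤ n
    · have h1 := rankCount_add u (2 * b) (2 * a) (by omega) (by omega)
      have h2 := rankCount_add v (2 * b) (2 * a) (by omega) (by omega)
      have h3 := h b a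
      omega
    · rw [rankCount_eq_zero_of_le _ _ _ (by omega), rankCount_eq_zero_of_le _ _ _ (by omega)]
  by_cases ha : a ≤ n
  · exact key a ha b
  · rw [rankCount_of_le u⁻¹ _ _ (by omega), rankCount_of_le v⁻¹ _ _ (by omega), key n le_rfl]

theorem evenRankEq_of_le_half {u v : Perm (Fin (2 * n))}
    (h1 : ∀ a b, a ≤ b → rankCount u (2 * a) (2 * b) = rankCount v (2 * a) (2 * b))
    (h2 : ∀ a b, a ≤ b → rankCount u⁻¹ (2 * a) (2 * b) = rankCount v⁻¹ (2 * a) (2 * b)) :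
    EvenRankEq u v := by
  have key : ∀ a ≤ n, ∀ b, rankCount u (2 * a) (2 * b) = rankCount v (2 * a) (2 * b) := by
    intro a ha b
    rcases le_total a b with hab | hab
    · exact h1 a b hab
    · have h3 := rankCount_add u (2 * a) (2 * b) (by omega) (by omega)
      have h4 := rankCount_add v (2 * a) (2 * b) (by omega) (by omega)
      have h5 := h2 b a hab
      omega
  intro a b
  by_cases ha : a ≤ n
  · exact key a ha b
  · rw [rankCount_of_le u _ _ (by omega), rankCount_of_le v _ _ (by omega), key n le_rfl]

theorem pairSubgroup_val_div {h : Perm (Fin (2 * n))} (hh : h ∈ pairSubgroup n)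
    (x : Fin (2 * n)) : (h x).val / 2 = x.val / 2 :=
  congrArg Fin.val (hh x)

theorem evenRankEq_mul_left {h : Perm (Fin (2 * n))} (hh : h ∈ pairSubgroup n)
    (u : Perm (Fin (2 * n))) : EvenRankEq (h * u) u := by
  intro a b
  unfold rankCount
  congr 1
  ext x
  have := pairSubgroup_val_div hh (u x)
  have h2 : ∀ y : ℕ, 2 * b ≤ y ↔ b ≤ y / 2 := by
    intro y
    omega
  simp only [mem_filter, mem_univ, true_and, Perm.mul_apply, h2, this]

theorem evenRankEq_mul_right {h : Perm (Fin (2 * n))} (hh : h ∈ pairSubgroup n)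
    (u : Perm (Fin (2 * n))) : EvenRankEq (u * h) u := by
  have := (evenRankEq_mul_left ((pairSubgroup n).inv_mem hh) u⁻¹).inv
  simpa using this

theorem evenRankEq_of_mem_doubleCoset {u v : Perm (Fin (2 * n))}
    (h : v ∈ DoubleCoset.doubleCoset u (pairSubgroup n) (pairSubgroup n)) : EvenRankEq v u := by
  obtain ⟨x, hx, y, hy, rfl⟩ := DoubleCoset.mem_doubleCoset.1 h
  exact (evenRankEq_mul_right hy _).trans (evenRankEq_mul_left hx _)

/-- Inclusion–exclusion over four corners: the even ranks determine how many letters of each pair go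
into each pair. -/
theorem card_pair_fiber (u : Perm (Fin (2 * n))) (a b : Fin n) :
    Fintype.card {x : Fin (2 * n) // (pairOf x, pairOf (u x)) = (a, b)} +
      (rankCount u (2 * a) (2 * b) + rankCount u (2 * (a + 1)) (2 * (b + 1))) =
      rankCount u (2 * (a + 1)) (2 * b) + rankCount u (2 * a) (2 * (b + 1)) := by
  rw [Fintype.card_subtype, card_filter]
  simp only [rankCount_eq_sum, ← sum_add_distrib]
  refine sum_congr rfl fun x _ => ?_
  simp only [Prod.mk.injEq, pairOf, Fin.ext_iff]
  split_ifs <;> omega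

/-- The pair-to-pair counts are a complete invariant: when they agree, letters can be matched inside
the pairs of the source, and what is left over acts inside the pairs of the target. -/
theorem mem_doubleCoset_of_evenRankEq {u v : Perm (Fin (2 * n))} (h : EvenRankEq v u) :
    v ∈ DoubleCoset.doubleCoset u (pairSubgroup n) (pairSubgroup n) := by
  have hcard : ∀ c : Fin n × Fin n,
      Nonempty ({x : Fin (2 * n) // (pairOf x, pairOf (v x)) = c} ≃
        {x : Fin (2 * n) // (pairOf x, pairOf (u x)) = c}) := by
    rintro ⟨a, b⟩
    rw [← Fintype.card_eq]
    have h1 := card_pair_fiber u a b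
    have h2 := card_pair_fiber v a b
    simp only [h _ _] at h2
    omega
  -- `φ` preserves pairs, and `u (φ x)` lies in the pair of `v x`; so `φ` and `v (u φ)⁻¹` both
  -- belong to `H`.
  let φ : Perm (Fin (2 * n)) := Equiv.ofFiberEquiv fun c => (hcard c).some
  have hφ : ∀ x, (pairOf (φ x), pairOf (u (φ x))) = (pairOf x, pairOf (v x)) :=
    Equiv.ofFiberEquiv_map fun c => (hcard c).some
  have hφ1 : φ ∈ pairSubgroup n := fun x => congrArg Prod.fst (hφ x)
  have hφ2 : v * (u * φ)⁻¹ ∈ pairSubgroup n := by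
    intro x
    have := congrArg Prod.snd (hφ (φ⁻¹ (u⁻¹ x)))
    simp only [Perm.mul_apply, mul_inv_rev] at this ⊢
    rw [← this]
    congr 1
    show u (φ (φ.symm (u.symm x))) = x
    simp
  rw [DoubleCoset.mem_doubleCoset]
  exact ⟨_, hφ2, φ, hφ1, by group⟩

/-- If `v` is minimal in its double coset, comparing with it only requires the even ranks. -/
theorem bruhatLE_of_even_rankCount_le {u v : Perm (Fin (2 * n))}
    (hv : ∀ i, v (oddLetter i) < v (evenLetter i))
    (hv' : ∀ i, v⁻¹ (oddLetter i) < v⁻¹ (evenLetter i))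
    (h : ∀ a b, a ≤ n → b ≤ n → rankCount v (2 * a) (2 * b) ≤ rankCount u (2 * a) (2 * b)) :
    BruhatLE v u := by
  have key : ∀ (u v : Perm (Fin (2 * n))) (q : ℕ), (∀ i, v (oddLetter i) < v (evenLetter i)) →
      (∀ a ≤ n, rankCount v (2 * a) q ≤ rankCount u (2 * a) q) →
      ∀ p ≤ 2 * n, rankCount v p q ≤ rankCount u p q := by
    intro u v q hv h p hp
    rcases Nat.even_or_odd' p with ⟨a, rfl | rfl⟩
    · exact h a (by omega)
    -- Odd `p`: if `v` reaches `q` at position `2 * a`, it also does so at `2 * a + 1`, and the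
    -- bound descends from `p + 1`; otherwise the rank of `v` has not grown since `p - 1`.
    · have h1 := h a (by omega)
      have h2 := h (a + 1) (by omega)
      have h3 := rankCount_succ_left v (2 * a) q (by omega)
      have h4 := rankCount_succ_left v (2 * a + 1) q (by omega)
      have h5 := rankCount_le_succ_left u (2 * a + 1) q
      have h6 := rankCount_mono u (Nat.le_succ (2 * a)) (le_refl q)
      have h7 : (v ⟨2 * a, by omega⟩).val < (v ⟨2 * a + 1, by omega⟩).val :=
        hv ⟨a, by omega⟩
      rw [show 2 * (a + 1) = 2 * a + 1 + 1 by ring] at h2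
      simp only [Nat.succ_eq_add_one] at h6
      split_ifs at h3 h4 <;> omega
  have h1 : ∀ p ≤ 2 * n, ∀ b ≤ n, rankCount v p (2 * b) ≤ rankCount u p (2 * b) :=
    fun p hp b hb => key u v (2 * b) hv (fun a ha => h a b ha hb) p hp
  have h2 : ∀ p ≤ 2 * n, ∀ q ≤ 2 * n, rankCount v⁻¹ q p ≤ rankCount u⁻¹ q p := by
    intro p hp q hq
    refine key u⁻¹ v⁻¹ p hv' (fun b hb => ?_) q hq
    have h3 := rankCount_add u p (2 * b) hp (by omega)
    have h4 := rankCount_add v p (2 * b) hp (by omega)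
    have h5 := h1 p hp b hb
    omega
  rw [bruhatLE_iff_rankCount_le']
  intro p hp q hq
  have h3 := rankCount_add u p q hp hq
  have h4 := rankCount_add v p q hp hq
  have h5 := h2 p hp q hq
  omega

end EvenRanks

/-! ### The elements whose comparison defines 𝐩 -/

section Connectors

variable {n : ℕ}

theorem parityPerm_val (s t : Perm (Fin n)) (x : Fin (2 * n)) :
    (parityPerm (s, t) x).val =
      if x.val % 2 = 0 then 2 * (t (pairOf x)).val else 2 * (s (pairOf x)).val + 1 := by
  split_ifs with h
  · conv_lhs => rw [← oddLetter_pairOf x h, parityPerm_oddLetter]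
    rfl
  · conv_lhs => rw [← evenLetter_pairOf x (by omega), parityPerm_evenLetter]
    rfl

theorem simpleRefl_spec {m k : ℕ} (hk : 1 ≤ k ∧ k < m) (x : Fin m) :
    (x.val + 1 = k ∧ (simpleRefl m k x).val = k) ∨ (x.val = k ∧ (simpleRefl m k x).val = k - 1) ∨
      (x.val + 1 ≠ k ∧ x.val ≠ k ∧ (simpleRefl m k x).val = x.val) := by
  rw [simpleRefl_val k hk]
  split_ifs <;> omega

theorem parityPerm_even_simpleRefl (k : ℕ) (hk : 1 ≤ k ∧ k < n) :
    parityPerm (simpleRefl n k, 1) =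
      simpleRefl (2 * n) (2 * k + 1) * simpleRefl (2 * n) (2 * k) * simpleRefl (2 * n) (2 * k + 1) := by
  ext x
  simp only [Perm.mul_apply]
  have h0 := parityPerm_val (simpleRefl n k) 1 x
  have h1 := simpleRefl_spec hk (pairOf x)
  have h2 := simpleRefl_spec (m := 2 * n) (k := 2 * k + 1) (by omega) x
  set y := simpleRefl (2 * n) (2 * k + 1) x
  have h3 := simpleRefl_spec (m := 2 * n) (k := 2 * k) (by omega) y
  set z := simpleRefl (2 * n) (2 * k) y
  have h4 := simpleRefl_spec (m := 2 * n) (k := 2 * k + 1) (by omega) z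
  simp only [Perm.one_apply, pairOf] at h0 h1
  rcases h1 with h1 | h1 | h1 <;> rcases h2 with h2 | h2 | h2 <;> rcases h3 with h3 | h3 | h3 <;>
    split_ifs at h0 <;> omega

theorem parityPerm_odd_simpleRefl (k : ℕ) (hk : 1 ≤ k ∧ k < n) :
    parityPerm (1, simpleRefl n k) =
      simpleRefl (2 * n) (2 * k - 1) * simpleRefl (2 * n) (2 * k) * simpleRefl (2 * n) (2 * k - 1) := by
  ext x
  simp only [Perm.mul_apply]
  have h0 := parityPerm_val 1 (simpleRefl n k) x
  have h1 := simpleRefl_spec hk (pairOf x)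
  have h2 := simpleRefl_spec (m := 2 * n) (k := 2 * k - 1) (by omega) x
  set y := simpleRefl (2 * n) (2 * k - 1) x
  have h3 := simpleRefl_spec (m := 2 * n) (k := 2 * k) (by omega) y
  set z := simpleRefl (2 * n) (2 * k) y
  have h4 := simpleRefl_spec (m := 2 * n) (k := 2 * k - 1) (by omega) z
  simp only [Perm.one_apply, pairOf] at h0 h1
  rcases h1 with h1 | h1 | h1 <;> rcases h2 with h2 | h2 | h2 <;> rcases h3 with h3 | h3 | h3 <;>
    split_ifs at h0 <;> omega

theorem simpleRefl_conj_succ {m : ℕ} (k : ℕ) (hk : 1 ≤ k ∧ k + 1 < m) :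
    simpleRefl m (k + 1) * simpleRefl m k * simpleRefl m (k + 1) =
      simpleRefl m k * simpleRefl m (k + 1) * simpleRefl m k := by
  ext x
  simp only [Perm.mul_apply]
  have h1 := simpleRefl_spec (m := m) (k := k + 1) (by omega) x
  set y := simpleRefl m (k + 1) x
  have h2 := simpleRefl_spec (m := m) (k := k) (by omega) y
  set z := simpleRefl m k y
  have h3 := simpleRefl_spec (m := m) (k := k + 1) (by omega) z
  have h4 := simpleRefl_spec (m := m) (k := k) (by omega) x
  set y' := simpleRefl m k x
  have h5 := simpleRefl_spec (m := m) (k := k + 1) (by omega) y'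
  set z' := simpleRefl m (k + 1) y'
  have h6 := simpleRefl_spec (m := m) (k := k) (by omega) z'
  rcases h1 with h1 | h1 | h1 <;> rcases h4 with h4 | h4 | h4 <;> omega

theorem parityPerm_even_simpleRefl' (k : ℕ) (hk : 1 ≤ k ∧ k < n) :
    parityPerm (simpleRefl n k, 1) =
      simpleRefl (2 * n) (2 * k) * simpleRefl (2 * n) (2 * k + 1) * simpleRefl (2 * n) (2 * k) := by
  rw [parityPerm_even_simpleRefl k hk, simpleRefl_conj_succ _ (by omega)]

theorem parityPerm_odd_simpleRefl' (k : ℕ) (hk : 1 ≤ k ∧ k < n) :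
    parityPerm (1, simpleRefl n k) =
      simpleRefl (2 * n) (2 * k) * simpleRefl (2 * n) (2 * k - 1) * simpleRefl (2 * n) (2 * k) := by
  have := simpleRefl_conj_succ (m := 2 * n) (2 * k - 1) (by omega)
  rw [show 2 * k - 1 + 1 = 2 * k by omega] at this
  rw [parityPerm_odd_simpleRefl k hk, this]

theorem parityPerm_simpleRefl (k : ℕ) (hk : 1 ≤ k ∧ k < n) :
    parityPerm (simpleRefl n k, simpleRefl n k) = wordProd (2 * n) (block k) := by
  have h : ((simpleRefl n k, simpleRefl n k) : Perm (Fin n) × Perm (Fin n)) =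
      (1, simpleRefl n k) * (simpleRefl n k, 1) := by simp
  have h2 := simpleRefl_mul_self (m := 2 * n) (2 * k)
  rw [h, map_mul, parityPerm_even_simpleRefl' k hk, parityPerm_odd_simpleRefl' k hk]
  simp only [block, wordProd_cons, wordProd_nil, mul_one]
  rw [show ∀ a b c : Perm (Fin (2 * n)), a * b * a * (a * c * a) = a * b * (a * a) * c * a by
    intros; simp only [mul_assoc], h2]
  simp only [mul_assoc, mul_one]

theorem wordProd_flatMap_block (L : List ℕ) (hL : ∀ k ∈ L, 1 ≤ k ∧ k < n) :
    wordProd (2 * n) (L.flatMap block) = parityPerm (wordProd n L, wordProd n L) := by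
  induction L with
  | nil => exact (map_one _).symm
  | cons k L ih =>
    rw [List.flatMap_cons, wordProd_append, ih fun k hk => hL k (by simp [hk]),
      ← parityPerm_simpleRefl k (hL k (by simp)), ← map_mul, wordProd_cons]
    rfl

theorem wordProd_range' (s t : ℕ) (hs : 1 ≤ s) (ht : s + t ≤ n) (x : Fin n) :
    (wordProd n (List.range' s t) x).val =
      if s ≤ x.val + 1 ∧ x.val + 1 < s + t then x.val + 1
      else if x.val + 1 = s + t then s - 1 else x.val := by
  induction t generalizing s with
  | zero =>
    simp only [List.range'_zero, wordProd_nil, Perm.one_apply]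
    split_ifs <;> omega
  | succ t ih =>
    rw [List.range'_succ, wordProd_cons, Perm.mul_apply, simpleRefl_val s (by omega),
      ih (s + 1) (by omega) (by omega)]
    split_ifs <;> omega

theorem wordProd_range'_inv (s t : ℕ) (hs : 1 ≤ s) (ht : s + t ≤ n) (x : Fin n) :
    ((wordProd n (List.range' s t))⁻¹ x).val =
      if s ≤ x.val ∧ x.val < s + t then x.val - 1
      else if x.val + 1 = s then s + t - 1 else x.val := by
  have h := wordProd_range' s t hs ht ((wordProd n (List.range' s t))⁻¹ x)
  rw [show (wordProd n (List.range' s t)) ((wordProd n (List.range' s t))⁻¹ x) = x from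
    (wordProd n (List.range' s t)).apply_symm_apply x] at h
  split_ifs at h ⊢ <;> omega

theorem wordProd_rightConnector (a b : ℕ) (ha : 1 ≤ a) (hab : a < b) (hb : b < n) :
    wordProd (2 * n) (rightConnector a b) = simpleRefl (2 * n) (2 * a) *
      (simpleRefl (2 * n) (2 * a + 1) * (parityPerm (wordProd n (List.range' (a + 1) (b - a - 1)),
        wordProd n (List.range' (a + 1) (b - a - 1))) * simpleRefl (2 * n) (2 * b))) := by
  rw [rightConnector, wordProd_append, wordProd_append, wordProd_flatMap_block]
  · simp only [wordProd_cons, wordProd_nil, mul_one, mul_assoc]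
  · intro k hk
    rw [List.mem_range'_1] at hk
    omega

theorem wordProd_leftConnector (a b : ℕ) (ha : 1 ≤ a) (hab : a < b) (hb : b < n) :
    wordProd (2 * n) (leftConnector a b) = (wordProd (2 * n) (rightConnector a b))⁻¹ := by
  rw [wordProd_rightConnector a b ha hab hb, leftConnector, wordProd_append, wordProd_append,
    wordProd_flatMap_block, wordProd_reverse]
  · simp only [wordProd_cons, wordProd_nil, mul_one, mul_assoc, mul_inv_rev, simpleRefl_inv,
      ← map_inv]
    rfl
  · intro k hk
    rw [List.mem_reverse, List.mem_range'_1] at hk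
    omega

/-- With its companion for the inverse, this is the minimality in the double coset that
`bruhatLE_of_even_rankCount_le` requires. -/
theorem rightConnector_lt (a b : ℕ) (ha : 1 ≤ a) (hab : a < b) (hb : b < n) (i : Fin n) :
    wordProd (2 * n) (rightConnector a b) (oddLetter i) <
      wordProd (2 * n) (rightConnector a b) (evenLetter i) := by
  -- The explicit permutation, with letters numbered from 0, found by tracing a letter through the
  -- four factors.
  have key : ∀ x : Fin (2 * n), (wordProd (2 * n) (rightConnector a b) x).val =
      if x.val = 2 * b then 2 * a - 1 else if x.val + 1 = 2 * b then 2 * b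
      else if 2 * a ≤ x.val ∧ x.val + 2 < 2 * b then x.val + 2
      else if x.val + 2 = 2 * b then 2 * a + 1 else if x.val + 1 = 2 * a then 2 * a
      else x.val := by
    intro x
    rw [wordProd_rightConnector a b ha hab hb]
    simp only [Perm.mul_apply]
    have h1 := simpleRefl_val (m := 2 * n) (2 * b) (by omega) x
    set y := simpleRefl (2 * n) (2 * b) x
    have h2 := parityPerm_val (wordProd n (List.range' (a + 1) (b - a - 1)))
      (wordProd n (List.range' (a + 1) (b - a - 1))) y
    have h3 := wordProd_range' (n := n) (a + 1) (b - a - 1) (by omega) (by omega) (pairOf y)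
    set z := parityPerm (wordProd n (List.range' (a + 1) (b - a - 1)),
      wordProd n (List.range' (a + 1) (b - a - 1))) y
    have h4 : z.val = if y.val = 2 * b - 1 then 2 * a + 1 else if y.val = 2 * b - 2 then 2 * a
        else if 2 * a ≤ y.val ∧ y.val + 2 < 2 * b then y.val + 2 else y.val := by
      rw [h2, h3]
      have h8 : (pairOf y).val = y.val / 2 := rfl
      clear h1 h2 h3
      split_ifs <;> omega
    have h5 := simpleRefl_val (m := 2 * n) (2 * a + 1) (by omega) z
    set z' := simpleRefl (2 * n) (2 * a + 1) z
    have h6 := simpleRefl_val (m := 2 * n) (2 * a) (by omega) z'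
    clear h2 h3
    have h7 : (simpleRefl (2 * n) (2 * a) z').val = if z.val = 2 * a + 1 then 2 * a - 1
        else if z.val = 2 * a then 2 * a + 1 else if z.val + 1 = 2 * a then 2 * a else z.val := by
      clear h4 h1
      rw [h6]
      split_ifs at h5 ⊢ <;> omega
    rw [h7]
    clear h5 h6 h7
    split_ifs at h1 <;> split_ifs at h4 <;> split_ifs <;> omega
  rw [Fin.lt_def, key, key]
  have h1 : (oddLetter i).val = 2 * i.val := rfl
  have h2 : (evenLetter i).val = 2 * i.val + 1 := rfl
  split_ifs <;> omega

theorem rightConnector_inv_lt (a b : ℕ) (ha : 1 ≤ a) (hab : a < b) (hb : b < n) (i : Fin n) :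
    (wordProd (2 * n) (rightConnector a b))⁻¹ (oddLetter i) <
      (wordProd (2 * n) (rightConnector a b))⁻¹ (evenLetter i) := by
  have key : ∀ x : Fin (2 * n), ((wordProd (2 * n) (rightConnector a b))⁻¹ x).val =
      if x.val + 1 = 2 * a then 2 * b else if x.val = 2 * a then 2 * a - 1
      else if x.val = 2 * a + 1 then 2 * b - 2
      else if 2 * a + 1 < x.val ∧ x.val < 2 * b then x.val - 2
      else if x.val = 2 * b then 2 * b - 1 else x.val := by
    intro x
    rw [wordProd_rightConnector a b ha hab hb]
    simp only [mul_inv_rev, simpleRefl_inv, ← map_inv, Prod.inv_mk, Perm.mul_apply]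
    have h1 := simpleRefl_val (m := 2 * n) (2 * a) (by omega) x
    set y := simpleRefl (2 * n) (2 * a) x
    have h2 := simpleRefl_val (m := 2 * n) (2 * a + 1) (by omega) y
    set z := simpleRefl (2 * n) (2 * a + 1) y
    have h3 : z.val = if x.val + 1 = 2 * a then 2 * a + 1 else if x.val = 2 * a then 2 * a - 1
        else if x.val = 2 * a + 1 then 2 * a else x.val := by
      rw [h2]
      split_ifs at h1 ⊢ <;> omega
    clear h1 h2
    have h4 := parityPerm_val (wordProd n (List.range' (a + 1) (b - a - 1)))⁻¹
      (wordProd n (List.range' (a + 1) (b - a - 1)))⁻¹ z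
    have h5 := wordProd_range'_inv (n := n) (a + 1) (b - a - 1) (by omega) (by omega) (pairOf z)
    set z' := parityPerm ((wordProd n (List.range' (a + 1) (b - a - 1)))⁻¹,
      (wordProd n (List.range' (a + 1) (b - a - 1)))⁻¹) z
    have h6 : z'.val = if z.val = 2 * a + 1 then 2 * b - 1 else if z.val = 2 * a then 2 * b - 2
        else if 2 * a + 1 < z.val ∧ z.val < 2 * b then z.val - 2 else z.val := by
      rw [h4, h5]
      have h8 : (pairOf z).val = z.val / 2 := rfl
      clear h3 h4 h5
      split_ifs <;> omega
    have h7 := simpleRefl_val (m := 2 * n) (2 * b) (by omega) z'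
    rw [h7]
    clear h4 h5 h7
    split_ifs at h3 <;> split_ifs at h6 <;> split_ifs <;> omega
  rw [Fin.lt_def, key, key]
  have h1 : (oddLetter i).val = 2 * i.val := rfl
  have h2 : (evenLetter i).val = 2 * i.val + 1 := rfl
  split_ifs <;> omega

theorem simpleRefl_mem_pairSubgroup (k : ℕ) : simpleRefl (2 * n) (2 * k + 1) ∈ pairSubgroup n := by
  by_cases hk : 2 * k + 1 < 2 * n
  · intro x
    ext
    simp only [pairOf, simpleRefl_val (m := 2 * n) (2 * k + 1) ⟨by omega, hk⟩]
    split_ifs <;> omega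
  · rw [simpleRefl, dif_neg (by omega)]
    exact (pairSubgroup n).one_mem

theorem commute_simpleRefl {m : ℕ} (a b : ℕ) (ha : 1 ≤ a ∧ a < m) (hb : 1 ≤ b ∧ b < m)
    (hab : a + 2 ≤ b) : Commute (simpleRefl m a) (simpleRefl m b) := by
  rw [commute_iff_eq]
  ext x
  simp only [Perm.mul_apply, simpleRefl_val a ha, simpleRefl_val b hb]
  split_ifs <;> omega

/-- Modulo `H`, the prefix `s_{2a} s_{2a+1}` equals `s_{2a+1} (s_a, 1)` with its first factor
dropped, and `s_{2b}` is `(s_b, 1)` conjugated by `s_{2b+1}`. The left copy of `s_{2b+1}` commutes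
past everything in between, where only letters up to `2b` move. So the connector becomes an element
of `K`. -/
theorem evenRankEq_rightConnector (a b : ℕ) (ha : 1 ≤ a) (hab : a < b) (hb : b < n) :
    EvenRankEq (wordProd (2 * n) (rightConnector a b))
      (parityPerm (wordProd n (List.range' a (b + 1 - a)),
        wordProd n (List.range' (a + 1) (b - a - 1)))) := by
  set c := wordProd n (List.range' (a + 1) (b - a - 1)) with hc
  have h1 : wordProd n (List.range' a (b + 1 - a)) = simpleRefl n a * (c * simpleRefl n b) := by
    rw [show b + 1 - a = (b - a - 1) + 1 + 1 by omega, List.range'_succ, wordProd_cons,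
      List.range'_1_concat, wordProd_append, ← hc, wordProd_cons, wordProd_nil, mul_one,
      show a + 1 + (b - a - 1) = b by omega]
  have h2 : ((simpleRefl n a * (c * simpleRefl n b), c) : Perm (Fin n) × Perm (Fin n)) =
      (simpleRefl n a, 1) * ((c, c) * (simpleRefl n b, 1)) := by simp
  have hconn : wordProd (2 * n) (rightConnector a b) = simpleRefl (2 * n) (2 * a + 1) *
      (parityPerm (simpleRefl n a, 1) * (parityPerm (c, c) * simpleRefl (2 * n) (2 * b))) := by
    rw [wordProd_rightConnector a b ha hab hb, parityPerm_even_simpleRefl a (by omega), ← hc]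
    simp only [← mul_assoc, simpleRefl_mul_self, one_mul]
  have hs : simpleRefl (2 * n) (2 * b) = simpleRefl (2 * n) (2 * b + 1) *
      (parityPerm (simpleRefl n b, 1) * simpleRefl (2 * n) (2 * b + 1)) := by
    rw [parityPerm_even_simpleRefl b (by omega)]
    simp only [mul_assoc, simpleRefl_mul_self, mul_one]
    simp only [← mul_assoc, simpleRefl_mul_self, one_mul]
  have hcomm : Commute (parityPerm (simpleRefl n a, 1) * parityPerm (c, c))
      (simpleRefl (2 * n) (2 * b + 1)) := by
    refine Commute.mul_left ?_ ?_
    · rw [parityPerm_even_simpleRefl a (by omega)]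
      refine Commute.mul_left (Commute.mul_left ?_ ?_) ?_ <;>
        exact commute_simpleRefl _ _ (by omega) (by omega) (by omega)
    · rw [hc, ← wordProd_flatMap_block]
      · rw [wordProd]
        refine Commute.list_prod_left _ _ fun x hx => ?_
        simp only [List.mem_map, List.mem_flatMap, List.mem_range'_1, block] at hx
        obtain ⟨k, ⟨r, hr, hk⟩, rfl⟩ := hx
        simp only [List.mem_cons, List.not_mem_nil, or_false] at hk
        exact commute_simpleRefl _ _ (by omega) (by omega) (by omega)
      · intro k hk
        rw [List.mem_range'_1] at hk
        omega
  have hfin : wordProd (2 * n) (rightConnector a b) =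
      simpleRefl (2 * n) (2 * a + 1) * (simpleRefl (2 * n) (2 * b + 1) *
        (parityPerm (simpleRefl n a * (c * simpleRefl n b), c) *
          simpleRefl (2 * n) (2 * b + 1))) := by
    rw [hconn, hs, h2, map_mul, map_mul]
    congr 1
    rw [← mul_assoc, ← mul_assoc, hcomm.eq]
    simp only [mul_assoc]
  rw [hfin, h1]
  exact ((evenRankEq_mul_left (simpleRefl_mem_pairSubgroup a) _).trans
    (evenRankEq_mul_left (simpleRefl_mem_pairSubgroup b) _)).trans
    (evenRankEq_mul_right (simpleRefl_mem_pairSubgroup b) _)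

theorem bruhatLE_rightConnector_iff (a b : ℕ) (ha : 1 ≤ a) (hab : a < b) (hb : b < n)
    (u : Perm (Fin (2 * n))) :
    BruhatLE (wordProd (2 * n) (rightConnector a b)) u ↔ ∀ p q, p ≤ n → q ≤ n →
      rankCount (parityPerm (wordProd n (List.range' a (b + 1 - a)),
        wordProd n (List.range' (a + 1) (b - a - 1)))) (2 * p) (2 * q) ≤
      rankCount u (2 * p) (2 * q) := by
  have h := evenRankEq_rightConnector a b ha hab hb
  constructor
  · intro h1 p q _ _
    rw [← h]
    exact h1.rankCount_le _ _
  · intro h1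
    refine bruhatLE_of_even_rankCount_le (rightConnector_lt a b ha hab hb)
      (rightConnector_inv_lt a b ha hab hb) fun p q hp hq => ?_
    rw [h]
    exact h1 p q hp hq

theorem bruhatLE_rightConnector_congr (a b : ℕ) (ha : 1 ≤ a) (hab : a < b) (hb : b < n)
    {u v : Perm (Fin (2 * n))} (h : EvenRankEq u v) :
    BruhatLE (wordProd (2 * n) (rightConnector a b)) u ↔
      BruhatLE (wordProd (2 * n) (rightConnector a b)) v := by
  rw [bruhatLE_rightConnector_iff a b ha hab hb, bruhatLE_rightConnector_iff a b ha hab hb]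
  simp only [h _ _]

theorem bruhatLE_leftConnector_iff (a b : ℕ) (ha : 1 ≤ a) (hab : a < b) (hb : b < n)
    (u : Perm (Fin (2 * n))) :
    BruhatLE (wordProd (2 * n) (leftConnector a b)) u ↔
      BruhatLE (wordProd (2 * n) (rightConnector a b)) u⁻¹ := by
  rw [wordProd_leftConnector a b ha hab hb, bruhatLE_inv_comm]

/-- `s̃_k` and its inverse increase on every pair, so even ranks decide, and these exceed the
minimal ones only at `(2k, 2k)`, where the value is 2. -/
theorem bruhatLE_tilde_simpleRefl_iff (k : ℕ) (hk : 1 ≤ k ∧ k < n) (u : Perm (Fin (2 * n))) :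
    BruhatLE (tilde (simpleRefl n k)) u ↔ 2 ≤ rankCount u (2 * k) (2 * k) := by
  rw [tilde_eq_parityPerm]
  constructor
  · intro h
    have := h.rankCount_le (2 * k) (2 * k)
    rw [rankCount_parityPerm_even, rankCount_simpleRefl hk _ _ hk.2.le] at this
    simpa using this
  · intro h
    have hlt : ∀ s : Perm (Fin n), ∀ i,
        parityPerm (s, s) (oddLetter i) < parityPerm (s, s) (evenLetter i) := by
      intro s i
      rw [parityPerm_oddLetter, parityPerm_evenLetter, Fin.lt_def]
      simp only [oddLetter, evenLetter]
      omega
    refine bruhatLE_of_even_rankCount_le (hlt _) ?_ fun a b ha hb => ?_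
    · rw [← map_inv, Prod.inv_mk]
      exact hlt _
    · rw [rankCount_parityPerm_even, rankCount_simpleRefl hk _ _ ha]
      have := sub_le_rankCount u (2 * a) (2 * b) (by omega)
      split_ifs with h1
      · obtain ⟨rfl, rfl⟩ := h1
        omega
      · omega

end Connectors

/-! ### The triplet as an invariant of the double coset -/

section TripletCongr

variable {n l : ℕ} {j : Fin l → ℕ}

theorem IsRightNeighbor.lt {A B : Finset (Fin l)} {i i' : Fin l}
    (h : IsRightNeighbor j A B i i') : j i < j i' := by
  obtain ⟨-, -, t, c, ht, -, hc, -, -, hj⟩ := h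
  have := hj t le_rfl
  rw [hc] at this
  omega

theorem IsLeftNeighbor.lt {A B : Finset (Fin l)} {i i' : Fin l}
    (h : IsLeftNeighbor j A B i i') : j i < j i' := by
  obtain ⟨-, -, t, c, ht, -, hc, -, -, hj⟩ := h
  have := hj t le_rfl
  rw [hc] at this
  omega

theorem mem_setIe (hj : ∀ i, 1 ≤ j i ∧ j i < n) (u : Perm (Fin (2 * n))) (i : Fin l) :
    i ∈ setIe n j u ↔ 1 ≤ rankCount u (2 * j i) (2 * j i) := by
  have := hj i
  rw [setIe, mem_filter, bruhatLE_simpleRefl_iff (by omega)]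
  simp

theorem mem_setIf (hj : ∀ i, 1 ≤ j i ∧ j i < n) (u : Perm (Fin (2 * n))) (i : Fin l) :
    i ∈ setIf n j u ↔ 2 ≤ rankCount u (2 * j i) (2 * j i) := by
  have := hj i
  rw [setIf, mem_filter, bruhatLE_tilde_simpleRefl_iff _ (by omega)]
  simp

/-- The triplet of a permutation depends only on its ranks at the even positions. -/
theorem tripletOf_congr (hj : ∀ i, 1 ≤ j i ∧ j i < n) {u v : Perm (Fin (2 * n))}
    (h : EvenRankEq u v) : tripletOf n j u = tripletOf n j v := by
  have h1 : setIe n j u = setIe n j v := by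
    ext i
    rw [mem_setIe hj, mem_setIe hj, h]
  have h2 : setIf n j u = setIf n j v := by
    ext i
    rw [mem_setIf hj, mem_setIf hj, h]
  ext i
  · simp only [tripletOf, h1]
  · simp only [tripletOf, h2, mem_filter, mem_univ, true_and]
    refine or_congr (exists_congr fun i' => and_congr_right fun hn => ?_)
      (exists_congr fun i' => and_congr_right fun hn => ?_)
    · exact bruhatLE_rightConnector_congr _ _ (hj i).1 hn.lt (hj i').2 h
    · rw [bruhatLE_leftConnector_iff _ _ (hj i).1 hn.lt (hj i').2,
        bruhatLE_leftConnector_iff _ _ (hj i).1 hn.lt (hj i').2]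
      exact bruhatLE_rightConnector_congr _ _ (hj i).1 hn.lt (hj i').2 h.inv
  · simp only [tripletOf, h2]

end TripletCongr

/-! ### Flipping all pairs beyond a cut -/

section FlipTail

variable {n : ℕ}

/-- The involution exchanging the two letters of each pair `{2i - 1, 2i}` with `i > r`. -/
def flipTail (n r : ℕ) : Perm (Fin (2 * n)) :=
  Function.Involutive.toPerm (fun x : Fin (2 * n) =>
    (⟨if 2 * r ≤ x.val then (if x.val % 2 = 0 then x.val + 1 else x.val - 1) else x.val, by
      have := x.isLt
      split_ifs <;> omega⟩ : Fin (2 * n))) (by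
    intro x
    ext
    simp only
    split_ifs <;> omega)

theorem flipTail_val (r : ℕ) (x : Fin (2 * n)) : (flipTail n r x).val =
    if 2 * r ≤ x.val then (if x.val % 2 = 0 then x.val + 1 else x.val - 1) else x.val := rfl

theorem flipTail_mem (r : ℕ) : flipTail n r ∈ pairSubgroup n := by
  intro x
  ext
  show (flipTail n r x).val / 2 = x.val / 2
  rw [flipTail_val]
  split_ifs <;> omega

theorem flipTail_eq_mul (r : ℕ) (hr : r < n) :
    flipTail n r = simpleRefl (2 * n) (2 * r + 1) * flipTail n (r + 1) := by
  ext x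
  rw [Perm.mul_apply]
  have h1 := simpleRefl_spec (m := 2 * n) (k := 2 * r + 1) (by omega) (flipTail n (r + 1) x)
  rw [flipTail_val] at h1 ⊢
  split_ifs at h1 ⊢ <;> omega

/-- Two consecutive flips lie in `H`, commute with long stretches of a product, and yet combine to a
single reflection in the middle; the cancellation of block terms rests on this. -/
theorem flipTail_mul_flipTail_succ (r : ℕ) (hr : r < n) :
    flipTail n r * flipTail n (r + 1) = simpleRefl (2 * n) (2 * r + 1) := by
  have : flipTail n (r + 1) * flipTail n (r + 1) = 1 := by
    ext x
    rw [Perm.mul_apply, flipTail_val, flipTail_val, Perm.one_apply]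
    split_ifs <;> omega
  rw [flipTail_eq_mul r hr, mul_assoc, this, mul_one]

theorem commute_flipTail_simpleRefl (r k : ℕ) (hk : 1 ≤ k ∧ k < 2 * n) (hr : k < 2 * r) :
    Commute (flipTail n r) (simpleRefl (2 * n) k) := by
  rw [commute_iff_eq]
  ext x
  rw [Perm.mul_apply, Perm.mul_apply]
  have h1 := simpleRefl_spec hk x
  have h2 := simpleRefl_spec hk (flipTail n r x)
  have h3 := flipTail_val r x
  have h4 := flipTail_val r (simpleRefl (2 * n) k x)
  split_ifs at h3 h4 <;> omega

/-- Both pairs moved by `s_k` are flipped, so conjugation carries the even copy of `s_k` to the odd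
one. -/
theorem flipTail_mul_parityPerm (r k : ℕ) (hk : 1 ≤ k ∧ k < n) (hr : r < k) :
    flipTail n r * parityPerm (simpleRefl n k, 1) =
      parityPerm (1, simpleRefl n k) * flipTail n r := by
  ext x
  rw [Perm.mul_apply, Perm.mul_apply]
  have h1 := simpleRefl_spec hk (pairOf x)
  have h2 := simpleRefl_spec hk (pairOf (flipTail n r x))
  have h3 := flipTail_val r x
  have h4 := parityPerm_val (simpleRefl n k) 1 x
  have h5 := parityPerm_val 1 (simpleRefl n k) (flipTail n r x)
  have h6 := flipTail_val r (parityPerm (simpleRefl n k, 1) x)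
  have h7 : (pairOf x).val = x.val / 2 := rfl
  have h8 : (pairOf (flipTail n r x)).val = (flipTail n r x).val / 2 := rfl
  rw [Perm.one_apply] at h4 h5
  split_ifs at h3 h4 h5 h6 <;> omega

theorem flipTail_mul_parityPerm' (r k : ℕ) (hk : 1 ≤ k ∧ k < n) (hr : r < k) :
    flipTail n r * parityPerm (1, simpleRefl n k) =
      parityPerm (simpleRefl n k, 1) * flipTail n r := by
  have h1 : flipTail n r * flipTail n r = 1 := by
    ext x
    rw [Perm.mul_apply, flipTail_val, flipTail_val, Perm.one_apply]
    split_ifs <;> omega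
  have h2 := flipTail_mul_parityPerm r k hk hr
  calc flipTail n r * parityPerm (1, simpleRefl n k)
      = flipTail n r * (parityPerm (1, simpleRefl n k) * flipTail n r) * flipTail n r := by
        simp only [mul_assoc, h1, mul_one]
    _ = _ := by
        rw [← h2, ← mul_assoc, h1, one_mul]

end FlipTail

/-! ### Replacing blocks by elements of K modulo H -/

section BlockElements

variable {n : ℕ} {A : Type*} [Ring A] (ρ : Perm (Fin (2 * n)) →* A)

/-- The signed sum of the masks of `block k`. -/
def blockElt (k : ℕ) : A :=
  (1 - ρ (simpleRefl (2 * n) (2 * k))) * (1 - ρ (simpleRefl (2 * n) (2 * k - 1))) *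
    (1 - ρ (simpleRefl (2 * n) (2 * k + 1))) * (1 - ρ (simpleRefl (2 * n) (2 * k)))

/-- The signed sum of the elements of `K` below `s̃_k`. -/
def parityElt (k : ℕ) : A :=
  (1 - ρ (parityPerm (1, simpleRefl n k))) * (1 - ρ (parityPerm (simpleRefl n k, 1)))

/-- The two copies of `s_k` are the conjugates of `s_{2k-1}` and `s_{2k+1}` by `s_{2k}`. This
exhibits the element as the last term of the expansion of a block. -/
theorem parityElt_eq (k : ℕ) (hk : 1 ≤ k ∧ k < n) : parityElt ρ k =
    ρ (simpleRefl (2 * n) (2 * k)) * ((1 - ρ (simpleRefl (2 * n) (2 * k - 1))) *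
      (1 - ρ (simpleRefl (2 * n) (2 * k + 1)))) * ρ (simpleRefl (2 * n) (2 * k)) := by
  have h : ρ (simpleRefl (2 * n) (2 * k)) * ρ (simpleRefl (2 * n) (2 * k)) = 1 := by
    rw [← map_mul, simpleRefl_mul_self, map_one]
  have key : ∀ a b c : A, a * a = 1 →
      (1 - a * b * a) * (1 - a * c * a) = a * ((1 - b) * (1 - c)) * a := by
    intro a b c h
    have h1 : a * b * a * (a * c * a) = a * b * c * a := by
      rw [show a * b * a * (a * c * a) = a * b * (a * a) * c * a by simp only [mul_assoc], h,
        mul_one]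
    have h2 : a * ((1 - b) * (1 - c)) * a = a * a - a * b * a - a * c * a + a * b * c * a := by
      noncomm_ring
    rw [h2, h, ← h1]
    noncomm_ring
  rw [parityElt, parityPerm_even_simpleRefl' k hk, parityPerm_odd_simpleRefl' k hk]
  simp only [map_mul]
  exact key _ _ _ h

theorem commute_blockElt {a : A} (k : ℕ) (h0 : Commute a (ρ (simpleRefl (2 * n) (2 * k))))
    (h1 : Commute a (ρ (simpleRefl (2 * n) (2 * k - 1))))
    (h2 : Commute a (ρ (simpleRefl (2 * n) (2 * k + 1)))) : Commute a (blockElt ρ k) := by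
  have := Commute.one_right a
  exact (((this.sub_right h0).mul_right (this.sub_right h1)).mul_right (this.sub_right h2)).mul_right
    (this.sub_right h0)

theorem commute_parityElt {a : A} (k : ℕ) (hk : 1 ≤ k ∧ k < n)
    (h0 : Commute a (ρ (simpleRefl (2 * n) (2 * k))))
    (h1 : Commute a (ρ (simpleRefl (2 * n) (2 * k - 1))))
    (h2 : Commute a (ρ (simpleRefl (2 * n) (2 * k + 1)))) : Commute a (parityElt ρ k) := by
  rw [parityElt_eq ρ k hk]
  have := Commute.one_right a
  exact (h0.mul_right ((this.sub_right h1).mul_right (this.sub_right h2))).mul_right h0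

theorem commute_flipTail_parityElt (r k : ℕ) (hk : 1 ≤ k ∧ k < n) (hr : r < k) :
    Commute (ρ (flipTail n r)) (parityElt ρ k) := by
  have h1 := congrArg ρ (flipTail_mul_parityPerm r k hk hr)
  have h2 := congrArg ρ (flipTail_mul_parityPerm' r k hk hr)
  have h3 : Commute (ρ (parityPerm (1, simpleRefl n k))) (ρ (parityPerm (simpleRefl n k, 1))) := by
    rw [commute_iff_eq, ← map_mul, ← map_mul, ← map_mul, ← map_mul]
    simp
  simp only [map_mul] at h1 h2
  have h4 : ∀ f a b : A, f * a = b * f → f * b = a * f → a * b = b * a →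
      f * ((1 - b) * (1 - a)) = (1 - b) * (1 - a) * f := by
    intro f a b h1 h2 h3
    have e : f * ((1 - b) * (1 - a)) = f - f * b - f * a + f * b * a := by noncomm_ring
    rw [e, h2, h1, mul_assoc a f a, h1, ← mul_assoc, h3]
    noncomm_ring
  exact h4 _ _ _ h1 h2 h3.eq.symm

/-- The product over a word in which the blocks `k > r` have been replaced by elements of `K`. -/
def mixedElt (r k : ℕ) : A := if r < k then parityElt ρ k else blockElt ρ k

/-- A block with `k < r` touches unflipped pairs only; in a factor from `K` with `k > s`, the flip
merely exchanges two commuting factors. -/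
theorem commute_flipTail_mixedElt (r s k : ℕ) (hk : 1 ≤ k ∧ k < n) (hrs : r ≤ s)
    (h : k < r ∨ s < k) : Commute (ρ (flipTail n s)) (mixedElt ρ r k) := by
  unfold mixedElt
  split_ifs with hlt
  · exact commute_flipTail_parityElt ρ s k hk (by omega)
  · exact commute_blockElt ρ k
      ((commute_flipTail_simpleRefl s _ (by omega) (by omega)).map ρ)
      ((commute_flipTail_simpleRefl s _ (by omega) (by omega)).map ρ)
      ((commute_flipTail_simpleRefl s _ (by omega) (by omega)).map ρ)

theorem commute_simpleRefl_mixedElt (r k : ℕ) (hr : r < n) (hk : 1 ≤ k ∧ k < n)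
    (h1 : k ≠ r) (h2 : k ≠ r + 1) :
    Commute (ρ (simpleRefl (2 * n) (2 * r + 1))) (mixedElt ρ r k) := by
  unfold mixedElt
  split_ifs with hlt
  · exact commute_parityElt ρ k hk
      ((commute_simpleRefl _ _ (by omega) (by omega) (by omega)).map ρ)
      ((commute_simpleRefl _ _ (by omega) (by omega) (by omega)).map ρ)
      ((commute_simpleRefl _ _ (by omega) (by omega) (by omega)).map ρ)
  · exact commute_blockElt ρ k
      ((commute_simpleRefl _ _ (by omega) (by omega) (by omega)).symm.map ρ)
      ((commute_simpleRefl _ _ (by omega) (by omega) (by omega)).symm.map ρ)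
      ((commute_simpleRefl _ _ (by omega) (by omega) (by omega)).symm.map ρ)

/-- Writing the block as X - SX - XS + SXS, the functional kills the first three terms between `x`
and `y`: X and SX because X ends in 1 - N with N absorbed on the right, XS by a sign reversal from
the two flips. -/
theorem apply_mul_blockElt_mul_of_commute_right (φ : A →+ ℤ)
    (hl : ∀ h ∈ pairSubgroup n, ∀ z, φ (ρ h * z) = φ z)
    (hr : ∀ h ∈ pairSubgroup n, ∀ z, φ (z * ρ h) = φ z)
    (k : ℕ) (hk : 1 ≤ k ∧ k < n) (x y : A)
    (hx : Commute (ρ (flipTail n k)) x)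
    (hy : Commute (ρ (flipTail n (k + 1))) y)
    (hy' : Commute (ρ (simpleRefl (2 * n) (2 * k + 1))) y) :
    φ (x * blockElt ρ k * y) = φ (x * parityElt ρ k * y) := by
  rw [parityElt_eq ρ k hk, blockElt]
  set S := ρ (simpleRefl (2 * n) (2 * k)) with hS
  set P := ρ (simpleRefl (2 * n) (2 * k - 1)) with hP
  set N := ρ (simpleRefl (2 * n) (2 * k + 1)) with hN
  set T := ρ (flipTail n k)
  set T' := ρ (flipTail n (k + 1))
  have hTT : T * T' = N := by
    rw [← map_mul, flipTail_mul_flipTail_succ k hk.2]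
  have cS : Commute T' S := (commute_flipTail_simpleRefl _ _ (by omega) (by omega)).map ρ
  have cP : Commute T' P := (commute_flipTail_simpleRefl _ _ (by omega) (by omega)).map ρ
  have cN : Commute T' N := (commute_flipTail_simpleRefl _ _ (by omega) (by omega)).map ρ
  have cPN : Commute P N := (commute_simpleRefl _ _ (by omega) (by omega) (by omega)).map ρ
  have hNN : N * N = 1 := by rw [hN, ← map_mul, simpleRefl_mul_self, map_one]
  have hNmem := simpleRefl_mem_pairSubgroup (n := n) k
  set X := (1 - P) * (1 - N) with hX
  have hXN : N * X = -X := by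
    have e1 : N * X = (N - N * P) * (1 - N) := by rw [hX]; noncomm_ring
    have e2 : N * X = N - N * N - P * N + P * (N * N) := by
      rw [e1, ← cPN.eq]; noncomm_ring
    rw [e2, hNN, hX]
    noncomm_ring
  have h1 : ∀ z, φ (z * X * y) = 0 := by
    intro z
    have e : z * X * y = z * (1 - P) * y - z * (1 - P) * y * N := by
      have e3 : z * X * y = z * (1 - P) * y - z * (1 - P) * (N * y) := by
        rw [hX]; noncomm_ring
      rw [e3, hy'.eq]
      noncomm_ring
    rw [e, map_sub, hr _ hNmem, sub_self]
  -- Insert `T'` on the right and move it left until it stands before `X`; insert `T` on the left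
  -- and move it past `x`. They meet as `T * T' = N`, and `N * X = -X`.
  have h2 : φ (x * X * S * y) = 0 := by
    have cX : Commute T' X := ((Commute.one_right T').sub_right cP).mul_right
      ((Commute.one_right T').sub_right cN)
    have e : x * X * S * y * T' = x * T' * X * S * y := by
      rw [mul_assoc, ← hy.eq, ← mul_assoc, mul_assoc (x * X) S T', ← cS.eq, ← mul_assoc,
        mul_assoc x X T', ← cX.eq, ← mul_assoc]
    have e2 : φ (x * X * S * y) = φ (x * T' * X * S * y) := by
      rw [← e, hr _ (flipTail_mem _)]
    have e3 : T * (x * T' * X * S * y) = -(x * X * S * y) := by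
      have : T * (x * T' * X * S * y) = x * (T * T') * X * S * y := by
        rw [show T * (x * T' * X * S * y) = (T * x) * T' * X * S * y by simp only [mul_assoc],
          hx.eq]
        simp only [mul_assoc]
      rw [this, hTT, mul_assoc x N X, hXN]
      noncomm_ring
    have e4 : φ (x * T' * X * S * y) = -φ (x * X * S * y) := by
      rw [← map_neg, ← e3, hl _ (flipTail_mem _)]
    omega
  have h3 := h1 x
  have h4 := h1 (x * S)
  have e : x * ((1 - S) * (1 - P) * (1 - N) * (1 - S)) * y =
      x * X * y - x * S * X * y - x * X * S * y + x * (S * X * S) * y := by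
    rw [hX]; noncomm_ring
  rw [e, map_add, map_sub, map_sub, h2, h3, h4]
  ring

/-- The mirror image, for when the obstructing letter `k + 1` is on the right of `k`: here the terms
beginning with X vanish by absorption on the left, and SX by sign reversal. -/
theorem apply_mul_blockElt_mul_of_commute_left (φ : A →+ ℤ)
    (hl : ∀ h ∈ pairSubgroup n, ∀ z, φ (ρ h * z) = φ z)
    (hr : ∀ h ∈ pairSubgroup n, ∀ z, φ (z * ρ h) = φ z)
    (k : ℕ) (hk : 1 ≤ k ∧ k < n) (x y : A)
    (hy : Commute (ρ (flipTail n k)) y)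
    (hx : Commute (ρ (flipTail n (k + 1))) x)
    (hx' : Commute (ρ (simpleRefl (2 * n) (2 * k + 1))) x) :
    φ (x * blockElt ρ k * y) = φ (x * parityElt ρ k * y) := by
  rw [parityElt_eq ρ k hk, blockElt]
  set S := ρ (simpleRefl (2 * n) (2 * k)) with hS
  set P := ρ (simpleRefl (2 * n) (2 * k - 1)) with hP
  set N := ρ (simpleRefl (2 * n) (2 * k + 1)) with hN
  set T := ρ (flipTail n k)
  set T' := ρ (flipTail n (k + 1))
  have cS : Commute T' S := (commute_flipTail_simpleRefl _ _ (by omega) (by omega)).map ρ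
  have cP : Commute T' P := (commute_flipTail_simpleRefl _ _ (by omega) (by omega)).map ρ
  have cN : Commute T' N := (commute_flipTail_simpleRefl _ _ (by omega) (by omega)).map ρ
  have hTT : T' * T = N := by
    have e : N * T' = T := by rw [← map_mul, ← flipTail_eq_mul k hk.2]
    have e2 : T * T' = N := by rw [← map_mul, flipTail_mul_flipTail_succ k hk.2]
    rw [← e, ← mul_assoc, cN.eq, e, e2]
  have cPN : Commute P N := (commute_simpleRefl _ _ (by omega) (by omega) (by omega)).map ρ
  have hNN : N * N = 1 := by rw [hN, ← map_mul, simpleRefl_mul_self, map_one]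
  have hNmem := simpleRefl_mem_pairSubgroup (n := n) k
  set X := (1 - P) * (1 - N) with hX
  have hXN : X * N = -X := by
    have e2 : X * N = N - N * N - P * N + P * (N * N) := by
      rw [hX]; noncomm_ring
    rw [e2, hNN, hX]
    noncomm_ring
  have h1 : ∀ z, φ (x * X * z) = 0 := by
    intro z
    have e : x * X * z = x * (1 - P) * z - N * (x * (1 - P) * z) := by
      have e3 : N * (x * (1 - P) * z) = x * (1 - P) * N * z := by
        rw [← mul_assoc, ← mul_assoc, hx'.eq, mul_assoc x N,
          ((Commute.one_right N).sub_right cPN.symm).eq, ← mul_assoc]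
      rw [e3, hX]
      noncomm_ring
    rw [e, map_sub, hl _ hNmem, sub_self]
  have h2 : φ (x * S * X * y) = 0 := by
    have cX : Commute T' X := ((Commute.one_right T').sub_right cP).mul_right
      ((Commute.one_right T').sub_right cN)
    have e : T' * (x * S * X * y) = x * S * X * T' * y := by
      rw [← mul_assoc, ((hx.mul_right cS).mul_right cX).eq]
    have e2 : φ (x * S * X * y) = φ (x * S * X * T' * y) := by
      rw [← e, hl _ (flipTail_mem _)]
    have e3 : x * S * X * T' * y * T = -(x * S * X * y) := by
      rw [mul_assoc _ y T, ← hy.eq, ← mul_assoc, mul_assoc _ T' T, hTT, mul_assoc _ X N, hXN]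
      noncomm_ring
    have e4 : φ (x * S * X * T' * y) = -φ (x * S * X * y) := by
      rw [← map_neg, ← e3, hr _ (flipTail_mem _)]
    omega
  have h3 := h1 y
  have h4 := h1 (S * y)
  have e : x * ((1 - S) * (1 - P) * (1 - N) * (1 - S)) * y =
      x * X * y - x * S * X * y - x * X * (S * y) + x * (S * X * S) * y := by
    rw [hX]; noncomm_ring
  rw [e, map_add, map_sub, map_sub, h2, h3, h4]
  ring

/-- In the double coset module, each block may be replaced by its part in `K`. -/
theorem apply_prod_blockElt (φ : A →+ ℤ)
    (hl : ∀ h ∈ pairSubgroup n, ∀ z, φ (ρ h * z) = φ z)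
    (hr : ∀ h ∈ pairSubgroup n, ∀ z, φ (z * ρ h) = φ z)
    (L : List ℕ) (hL : ∀ k ∈ L, 1 ≤ k ∧ k < n) (hd : L.Nodup) :
    φ (L.map (blockElt ρ)).prod = φ (L.map (parityElt ρ)).prod := by
  -- Letters are treated in decreasing order: when `r + 1` is replaced, every larger letter already
  -- contributes an element of `K`, which the flip at `r + 1` respects.
  have hstep : ∀ r < n, φ (L.map (mixedElt ρ (r + 1))).prod = φ (L.map (mixedElt ρ r)).prod := by
    intro r hrn
    by_cases hmem : r + 1 ∈ L
    · obtain ⟨L₁, L₂, rfl⟩ := List.append_of_mem hmem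
      have hk := hL (r + 1) (by simp)
      rw [List.nodup_append, List.nodup_cons] at hd
      obtain ⟨hd1, ⟨hd2, hd2'⟩, hd3⟩ := hd
      have hne : ∀ k, k ∈ L₁ ∨ k ∈ L₂ → k ≠ r + 1 := by
        rintro k (h | h) rfl
        · exact hd3 _ h _ (by simp) rfl
        · exact hd2 h
      have hsame : ∀ k, k ∈ L₁ ∨ k ∈ L₂ → mixedElt ρ r k = mixedElt ρ (r + 1) k := by
        intro k h
        have := hne k h
        unfold mixedElt
        rcases Nat.lt_trichotomy k (r + 1) with h1 | h1 | h1
        · rw [if_neg (by omega), if_neg (by omega)]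
        · exact absurd h1 this
        · rw [if_pos (by omega), if_pos (by omega)]
      have e1 : L₁.map (mixedElt ρ r) = L₁.map (mixedElt ρ (r + 1)) :=
        List.map_congr_left fun k h => hsame k (Or.inl h)
      have e2 : L₂.map (mixedElt ρ r) = L₂.map (mixedElt ρ (r + 1)) :=
        List.map_congr_left fun k h => hsame k (Or.inr h)
      have e3 : mixedElt ρ r (r + 1) = parityElt ρ (r + 1) := if_pos (Nat.lt_succ_self r)
      have e4 : mixedElt ρ (r + 1) (r + 1) = blockElt ρ (r + 1) := if_neg (lt_irrefl _)
      simp only [List.map_append, List.map_cons, List.prod_append, List.prod_cons, e1, e2, e3, e4]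
      rw [← mul_assoc, ← mul_assoc]
      have hb : ∀ k, k ∈ L₁ ∨ k ∈ L₂ → 1 ≤ k ∧ k < n := by
        rintro k (h | h)
        · exact hL k (by simp [h])
        · exact hL k (by simp [h])
      have c1 : ∀ M : List ℕ, (∀ k ∈ M, k ∈ L₁ ∨ k ∈ L₂) →
          Commute (ρ (flipTail n (r + 1))) (M.map (mixedElt ρ (r + 1))).prod := by
        intro M hM
        refine Commute.list_prod_right _ _ fun z hz => ?_
        obtain ⟨k, hkM, rfl⟩ := List.mem_map.1 hz
        have := hne k (hM k hkM)
        exact commute_flipTail_mixedElt ρ (r + 1) (r + 1) k (hb k (hM k hkM)) le_rfl (by omega)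
      have c2 : ∀ M : List ℕ, (∀ k ∈ M, k ∈ L₁ ∨ k ∈ L₂) → r + 1 + 1 ∉ M →
          Commute (ρ (flipTail n (r + 1 + 1))) (M.map (mixedElt ρ (r + 1))).prod := by
        intro M hM hM2
        refine Commute.list_prod_right _ _ fun z hz => ?_
        obtain ⟨k, hkM, rfl⟩ := List.mem_map.1 hz
        have := hne k (hM k hkM)
        have h2 : k ≠ r + 1 + 1 := fun h => hM2 (h ▸ hkM)
        exact commute_flipTail_mixedElt ρ (r + 1) (r + 1 + 1) k (hb k (hM k hkM)) (by omega)
          (by omega)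
      have c3 : ∀ M : List ℕ, (∀ k ∈ M, k ∈ L₁ ∨ k ∈ L₂) → r + 1 + 1 ∉ M →
          Commute (ρ (simpleRefl (2 * n) (2 * (r + 1) + 1))) (M.map (mixedElt ρ (r + 1))).prod := by
        intro M hM hM2
        refine Commute.list_prod_right _ _ fun z hz => ?_
        obtain ⟨k, hkM, rfl⟩ := List.mem_map.1 hz
        exact commute_simpleRefl_mixedElt ρ (r + 1) k hk.2 (hb k (hM k hkM)) (hne k (hM k hkM))
          fun h => hM2 (h ▸ hkM)
      -- Only the factor of `r + 2` may fail to commute with the next flip and with `s_{2r+3}`. As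
      -- letters are distinct, one side of the block is free of it.
      by_cases h2 : r + 1 + 1 ∈ L₂
      · have h1 : r + 1 + 1 ∉ L₁ := fun h1 => hd3 _ h1 _ (by simp [h2]) rfl
        exact apply_mul_blockElt_mul_of_commute_left ρ φ hl hr (r + 1) hk _ _
          (c1 L₂ fun k h => Or.inr h) (c2 L₁ (fun k h => Or.inl h) h1)
          (c3 L₁ (fun k h => Or.inl h) h1)
      · exact apply_mul_blockElt_mul_of_commute_right ρ φ hl hr (r + 1) hk _ _
          (c1 L₁ fun k h => Or.inl h) (c2 L₂ (fun k h => Or.inr h) h2)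
          (c3 L₂ (fun k h => Or.inr h) h2)
    · congr 2
      refine List.map_congr_left fun k hk => ?_
      have : k ≠ r + 1 := fun h => hmem (h ▸ hk)
      unfold mixedElt
      rcases Nat.lt_trichotomy k (r + 1) with h1 | h1 | h1
      · rw [if_neg (by omega), if_neg (by omega)]
      · exact absurd h1 this
      · rw [if_pos (by omega), if_pos (by omega)]
  have hall : ∀ r ≤ n, φ (L.map (mixedElt ρ r)).prod = φ (L.map (mixedElt ρ 0)).prod := by
    intro r
    induction r with
    | zero => intro _; rfl
    | succ r ih => intro h; rw [hstep r (by omega), ih (by omega)]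
  have h1 : L.map (mixedElt ρ n) = L.map (blockElt ρ) := List.map_congr_left fun k hk =>
    if_neg (by have := hL k hk; omega)
  have h2 : L.map (mixedElt ρ 0) = L.map (parityElt ρ) := List.map_congr_left fun k hk =>
    if_pos (by have := hL k hk; omega)
  rw [← h1, ← h2, hall n le_rfl]

end BlockElements

/-! ### Expanding the products over masks and over pairs of subsets -/

section Expansion

theorem List.prod_ofFn_sum {A κ : Type*} [Ring A] [Fintype κ] {l : ℕ} (F : Fin l → κ → A) :
    (List.ofFn fun i => ∑ e, F i e).prod = ∑ x : Fin l → κ, (List.ofFn fun i => F i (x i)).prod := by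
  induction l with
  | zero => simp
  | succ l ih =>
    rw [List.ofFn_succ, List.prod_cons, ih, ← (Fin.consEquiv fun _ : Fin (l + 1) => κ).sum_comp,
      Fintype.sum_prod_type, Finset.sum_mul_sum]
    refine sum_congr rfl fun e _ => sum_congr rfl fun x _ => ?_
    rw [List.ofFn_succ, List.prod_cons]
    simp [Fin.consEquiv]

theorem List.prod_ofFn_smul {A G : Type*} [Ring A] [Monoid G] (ρ : G →* A) {l : ℕ}
    (c : Fin l → ℤ) (g : Fin l → G) :
    (List.ofFn fun i => c i • ρ (g i)).prod = (∏ i, c i) • ρ (List.ofFn g).prod := by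
  induction l with
  | zero => simp
  | succ l ih =>
    rw [List.ofFn_succ, List.prod_cons, ih, List.ofFn_succ, List.prod_cons, Fin.prod_univ_succ,
      map_mul, smul_mul_smul_comm]

variable {n l : ℕ}

theorem wordProd_flatten (m : ℕ) (L : List (List ℕ)) :
    wordProd m L.flatten = (L.map (wordProd m)).prod := by
  induction L with
  | nil => rfl
  | cons a L ih => rw [List.flatten_cons, wordProd_append, ih, List.map_cons, List.prod_cons]

theorem wordProd_maskedBlock (m k : ℕ) (e : Fin 4 → Fin 2) :
    wordProd m (maskedBlock k e) = (List.ofFn fun i : Fin 4 =>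
      if e i = 1 then simpleRefl m (![2 * k, 2 * k - 1, 2 * k + 1, 2 * k] i) else 1).prod := by
  have h : ∀ (c : Prop) [Decidable c] (a : ℕ),
      wordProd m (if c then [a] else []) = if c then simpleRefl m a else 1 := by
    intro c _ a
    split_ifs <;> simp [wordProd]
  simp only [maskedBlock, wordProd_append, h, List.ofFn_succ, List.ofFn_zero, List.prod_cons,
    List.prod_nil, mul_one, mul_assoc]
  rfl

theorem blockElt_eq_sum {A : Type*} [Ring A] (ρ : Perm (Fin (2 * n)) →* A) (k : ℕ) :
    blockElt ρ k = ∑ e : Fin 4 → Fin 2,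
      (∏ i, (-1 : ℤ) ^ (e i).val) • ρ (wordProd (2 * n) (maskedBlock k e)) := by
  have h : blockElt ρ k = (List.ofFn fun i : Fin 4 => ∑ e : Fin 2, (-1 : ℤ) ^ e.val •
      ρ (if e = 1 then simpleRefl (2 * n) (![2 * k, 2 * k - 1, 2 * k + 1, 2 * k] i) else 1)).prod := by
    simp [blockElt, List.ofFn_succ, Fin.sum_univ_two, mul_assoc, sub_eq_add_neg]
  rw [h, List.prod_ofFn_sum]
  refine sum_congr rfl fun e _ => ?_
  rw [List.prod_ofFn_smul ρ (fun i => (-1 : ℤ) ^ (e i).val), wordProd_maskedBlock]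

theorem prod_blockElt_eq_sum {A : Type*} [Ring A] (ρ : Perm (Fin (2 * n)) →* A) (j : Fin l → ℕ) :
    (List.ofFn fun i => blockElt ρ (j i)).prod = ∑ x : Fin l → Fin 4 → Fin 2,
      maskSign x • ρ (wordProd (2 * n) (maskedWord j x)) := by
  simp only [blockElt_eq_sum]
  rw [List.prod_ofFn_sum]
  refine sum_congr rfl fun x _ => ?_
  rw [List.prod_ofFn_smul ρ (fun i => ∏ k, (-1 : ℤ) ^ (x i k).val)
    (fun i => wordProd (2 * n) (maskedBlock (j i) (x i))), maskedWord, wordProd_flatten,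
    List.map_ofFn]
  rfl

/-- The product of the letters of the word `j` with index in `E`. -/
def subwordElt (n : ℕ) (j : Fin l → ℕ) (E : Finset (Fin l)) : Perm (Fin n) :=
  (List.ofFn fun i => if i ∈ E then simpleRefl n (j i) else 1).prod

theorem parityElt_eq_sum {A : Type*} [Ring A] (ρ : Perm (Fin (2 * n)) →* A) (k : ℕ) :
    parityElt ρ k = ∑ e : Bool × Bool, ((if e.1 then -1 else 1) * (if e.2 then -1 else 1) : ℤ) •
      ρ (parityPerm (if e.1 then simpleRefl n k else 1, if e.2 then simpleRefl n k else 1)) := by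
  have h : parityPerm (simpleRefl n k, simpleRefl n k) =
      parityPerm (1, simpleRefl n k) * parityPerm (simpleRefl n k, 1) := by
    rw [← map_mul]
    simp
  have h1 : parityPerm ((1, 1) : Perm (Fin n) × Perm (Fin n)) = 1 := map_one _
  simp only [Fintype.sum_prod_type, Fintype.sum_bool, parityElt, h, h1, map_mul, map_one, if_true,
    Bool.false_eq_true, if_false]
  simp only [mul_neg, mul_one, neg_neg, one_smul, neg_smul]
  noncomm_ring

theorem prod_parityElt_eq_sum {A : Type*} [Ring A] (ρ : Perm (Fin (2 * n)) →* A)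
    (j : Fin l → ℕ) :
    (List.ofFn fun i => parityElt ρ (j i)).prod = ∑ p : Finset (Fin l) × Finset (Fin l),
      (-1 : ℤ) ^ (p.1.card + p.2.card) •
        ρ (parityPerm (subwordElt n j p.1, subwordElt n j p.2)) := by
  simp only [parityElt_eq_sum]
  rw [List.prod_ofFn_sum]
  refine Finset.sum_nbij' (fun x => (univ.filter fun i => (x i).1, univ.filter fun i => (x i).2))
    (fun p i => (decide (i ∈ p.1), decide (i ∈ p.2))) ?_ ?_ ?_ ?_ ?_
  · simp
  · simp
  · intro x _
    simp
  · intro p _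
    simp
  · intro x _
    rw [List.prod_ofFn_smul ρ
      (fun i => ((if (x i).1 then -1 else 1) * (if (x i).2 then -1 else 1) : ℤ))
      (fun i => parityPerm (if (x i).1 then simpleRefl n (j i) else 1,
        if (x i).2 then simpleRefl n (j i) else 1))]
    congr 1
    · have key : ∀ f : Fin l → Bool, ∏ i, (if f i then -1 else 1 : ℤ) =
          (-1) ^ (univ.filter fun i => f i).card := by
        intro f
        rw [Finset.prod_ite]
        simp
      rw [Finset.prod_mul_distrib, key, key, pow_add]
    · congr 1
      have e : (List.ofFn fun i => parityPerm (if (x i).1 then simpleRefl n (j i) else 1,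
          if (x i).2 then simpleRefl n (j i) else 1)) =
          (List.ofFn fun i => ((if (x i).1 then simpleRefl n (j i) else 1,
          if (x i).2 then simpleRefl n (j i) else 1) : Perm (Fin n) × Perm (Fin n))).map
            parityPerm := by
        rw [List.map_ofFn]
        rfl
      rw [e, ← map_list_prod]
      congr 1
      have fst : ∀ L : List (Perm (Fin n) × Perm (Fin n)), L.prod =
          ((L.map Prod.fst).prod, (L.map Prod.snd).prod) := by
        intro L
        induction L with
        | nil => rfl
        | cons a L ih => rw [List.prod_cons, ih]; rfl
      rw [fst, List.map_ofFn, List.map_ofFn, subwordElt, subwordElt]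
      simp [Function.comp_def]

/-- A signed sum over masks of a function on double cosets reduces to a sum over `K`. -/
theorem sum_maskSign_mul (j : Fin l → ℕ) (hj : ∀ i, 1 ≤ j i ∧ j i < n)
    (hinj : Function.Injective j) (f : Perm (Fin (2 * n)) → ℤ)
    (hl : ∀ h ∈ pairSubgroup n, ∀ u, f (h * u) = f u)
    (hr : ∀ h ∈ pairSubgroup n, ∀ u, f (u * h) = f u) :
    ∑ x : Fin l → Fin 4 → Fin 2, maskSign x * f (wordProd (2 * n) (maskedWord j x)) =
      ∑ p : Finset (Fin l) × Finset (Fin l), (-1 : ℤ) ^ (p.1.card + p.2.card) *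
        f (parityPerm (subwordElt n j p.1, subwordElt n j p.2)) := by
  -- Extended linearly to the group ring, the function `f` becomes a functional invariant under `H`
  -- on both sides.
  let ρ : Perm (Fin (2 * n)) →* MonoidAlgebra ℤ (Perm (Fin (2 * n))) := MonoidAlgebra.of ℤ _
  let φ : MonoidAlgebra ℤ (Perm (Fin (2 * n))) →+ ℤ :=
    MonoidAlgebra.liftNC (AddMonoidHom.id ℤ) f
  have hφ : ∀ g, φ (ρ g) = f g := by
    intro g
    simp [φ, ρ, MonoidAlgebra.of_apply, MonoidAlgebra.liftNC_single]
  have hφl : ∀ h ∈ pairSubgroup n, ∀ z, φ (ρ h * z) = φ z := by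
    intro h hh z
    induction z using MonoidAlgebra.induction_on with
    | of g => rw [show MonoidAlgebra.of ℤ _ g = ρ g from rfl, ← map_mul, hφ, hφ, hl h hh]
    | add a b ha hb => rw [mul_add, map_add, map_add, ha, hb]
    | smul r a ha => rw [mul_smul_comm, map_zsmul, map_zsmul, ha]
  have hφr : ∀ h ∈ pairSubgroup n, ∀ z, φ (z * ρ h) = φ z := by
    intro h hh z
    induction z using MonoidAlgebra.induction_on with
    | of g => rw [show MonoidAlgebra.of ℤ _ g = ρ g from rfl, ← map_mul, hφ, hφ, hr h hh]
    | add a b ha hb => rw [add_mul, map_add, map_add, ha, hb]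
    | smul r a ha => rw [smul_mul_assoc, map_zsmul, map_zsmul, ha]
  have h := apply_prod_blockElt ρ φ hφl hφr (List.ofFn j)
    (by simpa [List.forall_mem_ofFn_iff] using hj) (List.nodup_ofFn.2 hinj)
  rw [List.map_ofFn, List.map_ofFn] at h
  simp only [Function.comp_def] at h
  rw [prod_blockElt_eq_sum, prod_parityElt_eq_sum, map_sum, map_sum] at h
  simpa only [map_zsmul, hφ, smul_eq_mul] using h

end Expansion

/-! ### Subwords indexed by subsets -/

theorem List.filter_mem_eq_of_sublist {α : Type*} [DecidableEq α] {L' L : List α} (h : L'.Sublist L)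
    (hd : L.Nodup) : L.filter (· ∈ L') = L' := by
  induction h with
  | slnil => rfl
  | cons a h ih =>
    rw [List.nodup_cons] at hd
    rw [List.filter_cons_of_neg, ih hd.2]
    simpa using fun h' => hd.1 (h.subset h')
  | cons_cons a h ih =>
    rw [List.nodup_cons] at hd
    rw [List.filter_cons_of_pos (by simp)]
    congr 1
    refine Eq.trans (List.filter_congr fun x hx => ?_) (ih hd.2)
    have : x ≠ a := fun h' => hd.1 (h' ▸ hx)
    simp [this]

section Subwords

variable {n l : ℕ} {j : Fin l → ℕ}

/-- The letters of the word `j` with index in `E`. -/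
def subword (j : Fin l → ℕ) (E : Finset (Fin l)) : List ℕ :=
  ((List.finRange l).filter (· ∈ E)).map j

theorem subwordElt_eq (E : Finset (Fin l)) : subwordElt n j E = wordProd n (subword j E) := by
  rw [subwordElt, subword, wordProd, List.ofFn_eq_map]
  induction List.finRange l with
  | nil => rfl
  | cons a L ih =>
    rw [List.map_cons, List.prod_cons, ih]
    by_cases h : a ∈ E
    · rw [List.filter_cons_of_pos (by simpa using h), if_pos h]
      simp
    · rw [List.filter_cons_of_neg (by simpa using h), if_neg h, one_mul]

theorem mem_subword {E : Finset (Fin l)} {k : ℕ} : k ∈ subword j E ↔ ∃ i ∈ E, j i = k := by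
  simp [subword]

theorem subword_bounds (hj : ∀ i, 1 ≤ j i ∧ j i < n) (E : Finset (Fin l)) :
    ∀ k ∈ subword j E, 1 ≤ k ∧ k < n := by
  intro k hk
  obtain ⟨i, -, rfl⟩ := mem_subword.1 hk
  exact hj i

theorem subword_nodup (hinj : Function.Injective j) (E : Finset (Fin l)) :
    (subword j E).Nodup :=
  ((List.nodup_finRange l).filter _).map hinj

theorem rankCount_subwordElt (hj : ∀ i, 1 ≤ j i ∧ j i < n) (hinj : Function.Injective j)
    (E : Finset (Fin l)) (a b : ℕ) (hab : a ≤ b) :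
    rankCount (subwordElt n j E) a b = if (descList a b).Sublist (subword j E) then 1 else 0 := by
  rw [subwordElt_eq, rankCount_wordProd _ (subword_bounds hj E) (subword_nodup hinj E) a b hab]

theorem rankCount_subwordElt_inv (hj : ∀ i, 1 ≤ j i ∧ j i < n) (hinj : Function.Injective j)
    (E : Finset (Fin l)) (a b : ℕ) (hab : a ≤ b) :
    rankCount (subwordElt n j E)⁻¹ a b =
      if (List.range' a (b + 1 - a)).Sublist (subword j E) then 1 else 0 := by
  rw [subwordElt_eq, rankCount_wordProd_inv _ (subword_bounds hj E) (subword_nodup hinj E) a b hab]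

theorem rankCount_subwordElt_self (hj : ∀ i, 1 ≤ j i ∧ j i < n) (hinj : Function.Injective j)
    (E : Finset (Fin l)) (i : Fin l) :
    rankCount (subwordElt n j E) (j i) (j i) = if i ∈ E then 1 else 0 := by
  rw [rankCount_subwordElt hj hinj E _ _ le_rfl]
  refine if_congr ?_ rfl rfl
  rw [descList_self, List.singleton_sublist, mem_subword]
  exact ⟨fun ⟨i', h, h'⟩ => hinj h' ▸ h, fun h => ⟨i, h, rfl⟩⟩

theorem subwordElt_injective (hj : ∀ i, 1 ≤ j i ∧ j i < n) (hinj : Function.Injective j) :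
    Function.Injective (subwordElt n j) := by
  intro E E' h
  ext i
  have h1 := rankCount_subwordElt_self hj hinj E i
  have h2 := rankCount_subwordElt_self hj hinj E' i
  rw [h] at h1
  by_cases h3 : i ∈ E <;> by_cases h4 : i ∈ E' <;> simp_all

theorem bruhatLE_word_iff (hj : ∀ i, 1 ≤ j i ∧ j i < n) (hinj : Function.Injective j)
    (u : Perm (Fin n)) :
    BruhatLE u (wordProd n (List.ofFn j)) ↔ ∃ E, u = subwordElt n j E := by
  rw [bruhatLE_wordProd_iff (by simpa [List.forall_mem_ofFn_iff] using hj)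
    (List.nodup_ofFn.2 hinj), List.ofFn_eq_map]
  constructor
  · rintro ⟨L', h, rfl⟩
    obtain ⟨L₀, h0, rfl⟩ := List.sublist_map_iff.1 h
    refine ⟨L₀.toFinset, ?_⟩
    rw [subwordElt_eq, subword]
    congr 2
    refine Eq.trans (List.filter_mem_eq_of_sublist h0 (List.nodup_finRange l)).symm ?_
    simp
  · rintro ⟨E, rfl⟩
    exact ⟨subword j E, List.filter_sublist.map j, subwordElt_eq E⟩

theorem sign_simpleRefl {k : ℕ} (hk : 1 ≤ k ∧ k < n) : Perm.sign (simpleRefl n k) = -1 := by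
  rw [simpleRefl, dif_pos hk, Perm.sign_swap]
  simp only [ne_eq, Fin.mk.injEq]
  omega

theorem sign_subwordElt (hj : ∀ i, 1 ≤ j i ∧ j i < n) (E : Finset (Fin l)) :
    (Perm.sign (subwordElt n j E) : ℤ) = (-1) ^ E.card := by
  have h : Perm.sign (subwordElt n j E) = ∏ i, if i ∈ E then -1 else 1 := by
    rw [subwordElt, map_list_prod, List.map_ofFn, List.prod_ofFn]
    refine prod_congr rfl fun i _ => ?_
    simp only [Function.comp_apply]
    split_ifs
    · exact sign_simpleRefl (hj i)
    · exact map_one _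
  rw [h, Finset.prod_ite]
  simp

theorem sublist_filter_finRange (M : List (Fin l)) (hM : M.Pairwise (· < ·)) (E : Finset (Fin l))
    (hE : ∀ x ∈ M, x ∈ E) : M.Sublist ((List.finRange l).filter (· ∈ E)) := by
  refine List.sublist_of_subperm_of_pairwise (r := (· < ·)) ?_ hM ?_
  · refine List.subperm_of_subset ?_ fun x hx => ?_
    · exact hM.imp fun h => ne_of_lt h
    · simpa using hE x hx
  · exact (List.pairwise_lt_finRange l).filter _

/-- The chain from `i` to its neighbor spells this run in word order, and its interior lies in `A ⊆
E`, so only the two ends are in question. -/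
theorem range'_sublist_subword_iff (hinj : Function.Injective j) {A B E : Finset (Fin l)}
    {i i' : Fin l} (h : IsRightNeighbor j A B i i') (hA : A ⊆ E) :
    (List.range' (j i) (j i' + 1 - j i)).Sublist (subword j E) ↔ i ∈ E ∧ i' ∈ E := by
  have hlt := h.lt
  constructor
  · intro hs
    have h1 : j i ∈ subword j E := hs.subset (by rw [List.mem_range'_1]; omega)
    have h2 : j i' ∈ subword j E := hs.subset (by rw [List.mem_range'_1]; omega)
    obtain ⟨x, hx, hx'⟩ := mem_subword.1 h1
    obtain ⟨y, hy, hy'⟩ := mem_subword.1 h2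
    exact ⟨hinj hx' ▸ hx, hinj hy' ▸ hy⟩
  · rintro ⟨hi, hi'⟩
    obtain ⟨-, -, t, c, ht, hc0, hct, hlt, hmem, hjc⟩ := h
    have e : List.range' (j i) (j i' + 1 - j i) = ((List.range (t + 1)).map c).map j := by
      have := hjc t le_rfl
      rw [hct] at this
      rw [List.map_map, List.range'_eq_map_range, show j i' + 1 - j i = t + 1 by omega]
      refine List.map_congr_left fun k hk => ?_
      rw [List.mem_range] at hk
      exact (hjc k (by omega)).symm
    rw [e, subword]
    refine (sublist_filter_finRange _ ?_ E ?_).map j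
    · have hmono : ∀ k' ≤ t, ∀ k < k', c k < c k' := by
        intro k'
        induction k' with
        | zero => intro _ k hk; omega
        | succ m ih =>
          intro hm k hk
          rcases Nat.lt_succ_iff_lt_or_eq.1 hk with h1 | rfl
          · exact (ih (by omega) k h1).trans (hlt m (by omega))
          · exact hlt k (by omega)
      rw [List.pairwise_map]
      refine List.pairwise_lt_range.imp_of_mem fun _ hb hab => ?_
      rw [List.mem_range] at hb
      exact hmono _ (by omega) _ hab
    · intro x hx
      obtain ⟨k, hk, rfl⟩ := List.mem_map.1 hx
      rw [List.mem_range] at hk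
      by_cases h1 : k = 0
      · rw [h1, hc0]; exact hi
      by_cases h2 : k = t
      · rw [h2, hct]; exact hi'
      exact hA (hmem k (by omega) (by omega))

theorem descList_sublist_subword_iff (hinj : Function.Injective j) {A B E : Finset (Fin l)}
    {i i' : Fin l} (h : IsLeftNeighbor j A B i i') (hA : A ⊆ E) :
    (descList (j i) (j i')).Sublist (subword j E) ↔ i ∈ E ∧ i' ∈ E := by
  have hlt := h.lt
  constructor
  · intro hs
    have h1 : j i ∈ subword j E := hs.subset (by rw [mem_descList]; omega)
    have h2 : j i' ∈ subword j E := hs.subset (by rw [mem_descList]; omega)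
    obtain ⟨x, hx, hx'⟩ := mem_subword.1 h1
    obtain ⟨y, hy, hy'⟩ := mem_subword.1 h2
    exact ⟨hinj hx' ▸ hx, hinj hy' ▸ hy⟩
  · rintro ⟨hi, hi'⟩
    obtain ⟨-, -, t, c, ht, hc0, hct, hlt, hmem, hjc⟩ := h
    have e : descList (j i) (j i') = ((List.range (t + 1)).map c).reverse.map j := by
      have := hjc t le_rfl
      rw [hct] at this
      rw [List.map_reverse, List.map_map, descList, List.range'_eq_map_range,
        show j i' + 1 - j i = t + 1 by omega]
      congr 1
      refine List.map_congr_left fun k hk => ?_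
      rw [List.mem_range] at hk
      exact (hjc k (by omega)).symm
    rw [e, subword]
    refine (sublist_filter_finRange _ ?_ E ?_).map j
    · have hmono : ∀ k' ≤ t, ∀ k < k', c k' < c k := by
        intro k'
        induction k' with
        | zero => intro _ k hk; omega
        | succ m ih =>
          intro hm k hk
          rcases Nat.lt_succ_iff_lt_or_eq.1 hk with h1 | rfl
          · exact (hlt m (by omega)).trans (ih (by omega) k h1)
          · exact hlt k (by omega)
      rw [List.pairwise_reverse, List.pairwise_map]
      refine List.pairwise_lt_range.imp_of_mem fun _ hb hab => ?_
      rw [List.mem_range] at hb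
      exact hmono _ (by omega) _ hab
    · intro x hx
      rw [List.mem_reverse] at hx
      obtain ⟨k, hk, rfl⟩ := List.mem_map.1 hx
      rw [List.mem_range] at hk
      by_cases h1 : k = 0
      · rw [h1, hc0]; exact hi
      by_cases h2 : k = t
      · rw [h2, hct]; exact hi'
      exact hA (hmem k (by omega) (by omega))

end Subwords

/-! ### The triplet of an element of K below w̃ -/

section Triplets

variable {n l : ℕ} {j : Fin l → ℕ}

/-- `i'` is the (right or left) neighbor `ν_A^B(i)` of `i`. -/
def IsNeighbor (j : Fin l → ℕ) (A B : Finset (Fin l)) (i i' : Fin l) : Prop :=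
  IsRightNeighbor j A B i i' ∨ IsLeftNeighbor j A B i i'

theorem IsNeighbor.lt {A B : Finset (Fin l)} {i i' : Fin l} (h : IsNeighbor j A B i i') :
    j i < j i' :=
  h.elim IsRightNeighbor.lt IsLeftNeighbor.lt

theorem IsNeighbor.left_mem {A B : Finset (Fin l)} {i i' : Fin l} (h : IsNeighbor j A B i i') :
    i ∈ B \ A :=
  h.elim (fun h => h.1) fun h => h.1

theorem IsNeighbor.right_mem {A B : Finset (Fin l)} {i i' : Fin l} (h : IsNeighbor j A B i i') :
    i' ∈ B \ A :=
  h.elim (fun h => h.2.1) fun h => h.2.1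

theorem IsNeighbor.of_subset {A B B' : Finset (Fin l)} {i i' : Fin l} (h : IsNeighbor j A B i i')
    (hi : i ∈ B') (hi' : i' ∈ B') : IsNeighbor j A B' i i' := by
  have h1 := h.left_mem
  have h2 := h.right_mem
  rw [mem_sdiff] at h1 h2
  exact h.imp (fun h => ⟨mem_sdiff.2 ⟨hi, h1.2⟩, mem_sdiff.2 ⟨hi', h2.2⟩, h.2.2⟩)
    fun h => ⟨mem_sdiff.2 ⟨hi, h1.2⟩, mem_sdiff.2 ⟨hi', h2.2⟩, h.2.2⟩

theorem mem_nbrs {A B : Finset (Fin l)} {i : Fin l} :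
    i ∈ nbrs j A B ↔ ∃ i', IsNeighbor j A B i i' := by
  simp only [nbrs, rightNbrs, leftNbrs, mem_union, mem_filter, mem_univ, true_and, IsNeighbor,
    exists_or]

/-- Two chains from `i` agree as long as both run, since their letters do; were one shorter, its end
would be interior to the other and so lie in `A`. -/
theorem IsNeighbor.unique (hinj : Function.Injective j) {A B B' : Finset (Fin l)}
    {i i' i'' : Fin l} (h : IsNeighbor j A B i i') (h' : IsNeighbor j A B' i i'') : i' = i'' := by
  have key : ∀ {B : Finset (Fin l)} {i' : Fin l}, IsNeighbor j A B i i' →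
      i' ∉ A ∧ ∃ (t : ℕ) (c : ℕ → Fin l), 0 < t ∧ c t = i' ∧
        (∀ k, 0 < k → k < t → c k ∈ A) ∧ ∀ k ≤ t, j (c k) = j i + k := by
    rintro B i' (⟨-, h2, t, c, h3, -, h4, -, h5, h6⟩ | ⟨-, h2, t, c, h3, -, h4, -, h5, h6⟩) <;>
      exact ⟨(mem_sdiff.1 h2).2, t, c, h3, h4, h5, h6⟩
  obtain ⟨a1, t, c, a2, rfl, a4, a5⟩ := key h
  obtain ⟨b1, s, d, b2, rfl, b4, b5⟩ := key h'
  have hcd : ∀ k, k ≤ t → k ≤ s → c k = d k := fun k h1 h2 =>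
    hinj ((a5 k h1).trans (b5 k h2).symm)
  rcases lt_trichotomy t s with h1 | rfl | h1
  · rw [hcd t le_rfl h1.le] at a1
    exact absurd (b4 t a2 h1) a1
  · exact hcd t le_rfl le_rfl
  · rw [← hcd s h1.le le_rfl] at b1
    exact absurd (a4 s b2 h1) b1

/-- Both chains start by stepping to the unique index of the letter `j i + 1`, which cannot lie on
both sides of `i`. -/
theorem not_isLeftNeighbor_of_isRightNeighbor (hinj : Function.Injective j)
    {A A' B B' : Finset (Fin l)} {i i' i'' : Fin l} (h : IsRightNeighbor j A B i i') :
    ¬ IsLeftNeighbor j A' B' i i'' := by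
  rintro ⟨-, -, s, d, b1, b2, -, b3, -, b4⟩
  obtain ⟨-, -, t, c, a1, a2, -, a3, -, a4⟩ := h
  have h1 : c 1 = d 1 := hinj ((a4 1 a1).trans (b4 1 b1).symm)
  have h2 := a3 0 a1
  have h3 := b3 0 b1
  rw [zero_add] at h2 h3
  rw [a2, h1] at h2
  rw [b2] at h3
  exact absurd h2 h3.not_gt

/-- The triplet attached to the element of `K` with parts given by subwords `E` and `O`. -/
def pairTriplet (j : Fin l → ℕ) (E O : Finset (Fin l)) : Triplet l where
  Ie := E ∪ O
  I := univ.filter fun i => ∃ i', IsNeighbor j (E ∩ O) univ i i' ∧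
    (i ∈ E ∧ i' ∈ E ∨ i ∈ O ∧ i' ∈ O)
  If := E ∩ O

/-- The connector has the even ranks of the pair (run from `a` to `b`, its interior). One part of
the given element must dominate the full run; the other dominates the interior by assumption. -/
theorem rightConnector_iff_of_range'_sublist (hj : ∀ i, 1 ≤ j i ∧ j i < n)
    (hinj : Function.Injective j)
    (E O : Finset (Fin l)) (a b : ℕ) (ha : 1 ≤ a) (hab : a < b) (hb : b < n)
    (hE : (List.range' (a + 1) (b - a - 1)).Sublist (subword j E))
    (hO : (List.range' (a + 1) (b - a - 1)).Sublist (subword j O)) :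
    BruhatLE (wordProd (2 * n) (rightConnector a b))
        (parityPerm (subwordElt n j E, subwordElt n j O)) ↔
      (List.range' a (b + 1 - a)).Sublist (subword j E) ∨
        (List.range' a (b + 1 - a)).Sublist (subword j O) := by
  rw [bruhatLE_rightConnector_iff a b ha hab hb]
  have le_of_sublist : ∀ (L : List ℕ) (E : Finset (Fin l)), L.Sublist (subword j E) →
      ∀ p q, rankCount (wordProd n L) p q ≤ rankCount (subwordElt n j E) p q := by
    intro L E h p q
    rw [subwordElt_eq]
    exact (bruhatLE_wordProd_of_sublist (subword_bounds hj E) (subword_nodup hinj E) h).rankCount_le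
      p q
  constructor
  · intro h
    -- Below the diagonal every rank at `(b, a)` is at least `b - a`. The full run exceeds this by
    -- one, so one of the two parts must exceed it as well.
    have h1 := h b a (by omega) (by omega)
    have hnd : (List.range' a (b + 1 - a)).Nodup := List.nodup_range'
    have hbd : ∀ k ∈ List.range' a (b + 1 - a), 1 ≤ k ∧ k < n := by
      intro k hk
      rw [List.mem_range'_1] at hk
      omega
    have h2 := rankCount_wordProd_inv (n := n) _ hbd hnd a b hab.le
    rw [if_pos (List.Sublist.refl _)] at h2
    rw [rankCount_parityPerm_even, rankCount_parityPerm_even] at h1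
    have h3 := rankCount_subwordElt_inv hj hinj E a b hab.le
    have h4 := rankCount_subwordElt_inv hj hinj O a b hab.le
    have e1 := rankCount_add (wordProd n (List.range' a (b + 1 - a))) b a hb.le (by omega)
    have e2 := rankCount_add (subwordElt n j E) b a hb.le (by omega)
    have e3 := rankCount_add (subwordElt n j O) b a hb.le (by omega)
    have e4 := sub_le_rankCount (wordProd n (List.range' (a + 1) (b - a - 1))) b a hb.le
    by_contra hcon
    rw [not_or] at hcon
    rw [if_neg hcon.1] at h3
    rw [if_neg hcon.2] at h4
    omega
  · rintro (h | h) p q _ _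
    · rw [rankCount_parityPerm_even, rankCount_parityPerm_even]
      exact Nat.add_le_add (le_of_sublist _ _ h p q) (le_of_sublist _ _ hO p q)
    · rw [rankCount_parityPerm_even, rankCount_parityPerm_even, add_comm (rankCount (subwordElt n j E) p q)]
      exact Nat.add_le_add (le_of_sublist _ _ h p q) (le_of_sublist _ _ hE p q)

theorem subword_rev (E : Finset (Fin l)) :
    subword (j ∘ Fin.rev) (E.map Fin.revPerm.toEmbedding) = (subword j E).reverse := by
  rw [subword, subword, ← List.map_reverse, ← List.filter_reverse, ← List.map_map]
  congr 1
  rw [show (List.finRange l).reverse = (List.finRange l).map Fin.rev from List.finRange_reverse,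
    List.filter_map]
  congr 1
  refine List.filter_congr fun x _ => ?_
  simp

/-- Reversing the word inverts the permutation; left connectors are thereby reduced to right ones.
-/
theorem subwordElt_rev (E : Finset (Fin l)) :
    subwordElt n (j ∘ Fin.rev) (E.map Fin.revPerm.toEmbedding) = (subwordElt n j E)⁻¹ := by
  rw [subwordElt_eq, subword_rev, wordProd_reverse, subwordElt_eq]

end Triplets

section TripletOfPair

variable {n l : ℕ} {j : Fin l → ℕ}

theorem leftConnector_iff_of_range'_sublist (hj : ∀ i, 1 ≤ j i ∧ j i < n)
    (hinj : Function.Injective j)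
    (E O : Finset (Fin l)) (a b : ℕ) (ha : 1 ≤ a) (hab : a < b) (hb : b < n)
    (hE : (List.range' (a + 1) (b - a - 1)).reverse.Sublist (subword j E))
    (hO : (List.range' (a + 1) (b - a - 1)).reverse.Sublist (subword j O)) :
    BruhatLE (wordProd (2 * n) (leftConnector a b))
        (parityPerm (subwordElt n j E, subwordElt n j O)) ↔
      (descList a b).Sublist (subword j E) ∨ (descList a b).Sublist (subword j O) := by
  have key : ∀ (L : List ℕ) (E : Finset (Fin l)),
      L.Sublist (subword (j ∘ Fin.rev) (E.map Fin.revPerm.toEmbedding)) ↔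
        L.reverse.Sublist (subword j E) := by
    intro L E
    rw [subword_rev, ← List.reverse_sublist, List.reverse_reverse]
  have h := rightConnector_iff_of_range'_sublist (n := n) (j := j ∘ Fin.rev) (fun i => hj _)
    (hinj.comp Fin.rev_injective) (E.map Fin.revPerm.toEmbedding)
    (O.map Fin.revPerm.toEmbedding) a b ha hab hb ((key _ _).2 hE) ((key _ _).2 hO)
  rw [key, key] at h
  rw [bruhatLE_leftConnector_iff a b ha hab hb, ← map_inv, Prod.inv_mk, ← subwordElt_rev,
    ← subwordElt_rev]
  exact h

/-- When letters are distinct, the order is settled in the full word and only membership of the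
letters remains to be checked. -/
theorem sublist_subword_of_subset (hinj : Function.Injective j) {L : List ℕ}
    {E : Finset (Fin l)} (h : L.Sublist (subword j univ)) (hE : ∀ k ∈ L, k ∈ subword j E) :
    L.Sublist (subword j E) := by
  have h1 := h.filter (fun k => decide (k ∈ subword j E))
  rw [List.filter_eq_self.2 (by simpa using hE)] at h1
  have h2 : (subword j univ).filter (fun k => decide (k ∈ subword j E)) = subword j E := by
    simp only [subword, List.filter_map, List.filter_filter]
    congr 1
    refine List.filter_congr fun x _ => ?_
    simp [hinj.eq_iff]
  rwa [h2] at h1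

theorem IsRightNeighbor.interior_sublist (hinj : Function.Injective j) {A B E : Finset (Fin l)}
    {i i' : Fin l} (h : IsRightNeighbor j A B i i') (hA : A ⊆ E) :
    (List.range' (j i + 1) (j i' - j i - 1)).Sublist (subword j E) := by
  refine sublist_subword_of_subset hinj ?_ ?_
  · have h1 := (range'_sublist_subword_iff hinj h (subset_univ A)).2 ⟨mem_univ _, mem_univ _⟩
    refine List.Sublist.trans ?_ h1
    have hlt := h.lt
    rw [show j i' + 1 - j i = (j i' - j i - 1) + 1 + 1 by omega, List.range'_1_concat,
      List.range'_succ]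
    exact List.sublist_append_of_sublist_left (List.sublist_cons_self _ _)
  · obtain ⟨-, -, t, c, -, -, hct, -, hA', hc⟩ := h
    intro k hk
    rw [List.mem_range'_1] at hk
    have ht := hc t le_rfl
    rw [hct] at ht
    refine mem_subword.2 ⟨c (k - j i), hA (hA' _ (by omega) (by omega)), ?_⟩
    rw [hc _ (by omega)]
    omega

theorem IsLeftNeighbor.interior_sublist (hinj : Function.Injective j) {A B E : Finset (Fin l)}
    {i i' : Fin l} (h : IsLeftNeighbor j A B i i') (hA : A ⊆ E) :
    (List.range' (j i + 1) (j i' - j i - 1)).reverse.Sublist (subword j E) := by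
  refine sublist_subword_of_subset hinj ?_ ?_
  · have h1 := (descList_sublist_subword_iff hinj h (subset_univ A)).2 ⟨mem_univ _, mem_univ _⟩
    refine List.Sublist.trans ?_ h1
    have hlt := h.lt
    rw [descList, List.reverse_sublist,
      show j i' + 1 - j i = (j i' - j i - 1) + 1 + 1 by omega, List.range'_1_concat,
      List.range'_succ]
    exact List.sublist_append_of_sublist_left (List.sublist_cons_self _ _)
  · obtain ⟨-, -, t, c, -, -, hct, -, hA', hc⟩ := h
    intro k hk
    rw [List.mem_reverse, List.mem_range'_1] at hk
    have ht := hc t le_rfl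
    rw [hct] at ht
    refine mem_subword.2 ⟨c (k - j i), hA (hA' _ (by omega) (by omega)), ?_⟩
    rw [hc _ (by omega)]
    omega

/-- The diagonal even rank at `j i` counts in how many of `E` and `O` the index `i` lies. The
interior of a neighbor chain is in both, so a connector lies below the element exactly when its two
ends share a side. -/
theorem tripletOf_parityPerm (hj : ∀ i, 1 ≤ j i ∧ j i < n) (hinj : Function.Injective j)
    (E O : Finset (Fin l)) :
    tripletOf n j (parityPerm (subwordElt n j E, subwordElt n j O)) = pairTriplet j E O := by
  have hIe : setIe n j (parityPerm (subwordElt n j E, subwordElt n j O)) = E ∪ O := by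
    ext i
    rw [mem_setIe hj, rankCount_parityPerm_even, rankCount_subwordElt_self hj hinj,
      rankCount_subwordElt_self hj hinj, mem_union]
    by_cases h1 : i ∈ E <;> by_cases h2 : i ∈ O <;> simp [h1, h2]
  have hIf : setIf n j (parityPerm (subwordElt n j E, subwordElt n j O)) = E ∩ O := by
    ext i
    rw [mem_setIf hj, rankCount_parityPerm_even, rankCount_subwordElt_self hj hinj,
      rankCount_subwordElt_self hj hinj, mem_inter]
    by_cases h1 : i ∈ E <;> by_cases h2 : i ∈ O <;> simp [h1, h2]
  ext i
  · simp only [tripletOf, pairTriplet, hIe]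
  · simp only [tripletOf, pairTriplet, hIf, mem_filter, mem_univ, true_and]
    rw [← exists_or]
    refine exists_congr fun i' => ?_
    rw [IsNeighbor, or_and_right]
    refine or_congr (and_congr_right fun h => ?_) (and_congr_right fun h => ?_)
    · rw [rightConnector_iff_of_range'_sublist hj hinj E O _ _ (hj i).1 h.lt (hj i').2
        (h.interior_sublist hinj inter_subset_left) (h.interior_sublist hinj inter_subset_right),
        range'_sublist_subword_iff hinj h inter_subset_left,
        range'_sublist_subword_iff hinj h inter_subset_right]
    · rw [leftConnector_iff_of_range'_sublist hj hinj E O _ _ (hj i).1 h.lt (hj i').2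
        (h.interior_sublist hinj inter_subset_left) (h.interior_sublist hinj inter_subset_right),
        descList_sublist_subword_iff hinj h inter_subset_left,
        descList_sublist_subword_iff hinj h inter_subset_right]
  · simp only [tripletOf, pairTriplet, hIf]

end TripletOfPair

/-! ### Counting the pairs with a given triplet -/

section Counting

/-- Subsets of `V` with prescribed parities along the edges `i — ν i` of a forest. -/
theorem card_filter_edge_parity {α : Type*} (V N : Finset α) (ν : α → α)
    (h : α → ℕ) (c : α → Prop) (hN : N ⊆ V) (hν : ∀ i ∈ N, h i < h (ν i)) :
    (V.powerset.filter fun S => ∀ i ∈ N, (c i ↔ (i ∈ S ↔ ν i ∈ S))).card * 2 ^ N.card =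
      2 ^ V.card := by
  induction N using Finset.induction_on_min_value h with
  | empty => simp
  | insert a s ha hmin ih =>
    have haV : a ∈ V := hN (mem_insert_self a s)
    have hs := ih (fun x hx => hN (mem_insert_of_mem hx)) fun i hi => hν i (mem_insert_of_mem hi)
    have hνa : ν a ≠ a := fun h' => by
      have := hν a (mem_insert_self a s)
      rw [h'] at this
      exact lt_irrefl _ this
    have hνx : ∀ x ∈ s, ν x ≠ a := fun x hx h' => by
      have h1 := hν x (mem_insert_of_mem hx)
      have h2 := hmin x hx
      rw [h'] at h1
      omega
    have hsplit := card_filter_add_card_filter_not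
      (s := V.powerset.filter fun S => ∀ i ∈ s, (c i ↔ (i ∈ S ↔ ν i ∈ S)))
      (fun S => c a ↔ (a ∈ S ↔ ν a ∈ S))
    -- `a` has least height and heights increase along `ν`, so `a` is no `ν x`. Toggling its
    -- membership keeps all other constraints and reverses the one at `a`.
    have hbij : ((V.powerset.filter fun S => ∀ i ∈ s, (c i ↔ (i ∈ S ↔ ν i ∈ S))).filter
        fun S => c a ↔ (a ∈ S ↔ ν a ∈ S)).card =
        ((V.powerset.filter fun S => ∀ i ∈ s, (c i ↔ (i ∈ S ↔ ν i ∈ S))).filter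
        fun S => ¬ (c a ↔ (a ∈ S ↔ ν a ∈ S))).card := by
      have hmem : ∀ (S : Finset α) (x : α), x ≠ a → (x ∈ symmDiff S {a} ↔ x ∈ S) := by
        intro S x hx
        simp [mem_symmDiff, hx]
      have hmema : ∀ S : Finset α, (a ∈ symmDiff S {a} ↔ a ∉ S) := by
        intro S
        simp [mem_symmDiff]
      have hsub : ∀ S : Finset α, S ⊆ V → symmDiff S {a} ⊆ V := by
        intro S hS x hx
        by_cases h1 : x = a
        · exact h1 ▸ haV
        · exact hS ((hmem S x h1).1 hx)
      have hcond : ∀ S : Finset α, (∀ i ∈ s, (c i ↔ (i ∈ S ↔ ν i ∈ S))) →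
          ∀ i ∈ s, (c i ↔ (i ∈ symmDiff S {a} ↔ ν i ∈ symmDiff S {a})) := by
        intro S h1 i hi
        rw [hmem S i fun h' => ha (h' ▸ hi), hmem S _ (hνx i hi)]
        exact h1 i hi
      refine card_bij' (fun S _ => symmDiff S {a}) (fun S _ => symmDiff S {a}) ?_ ?_ ?_ ?_
      · intro S hS
        simp only [mem_filter, mem_powerset] at hS ⊢
        refine ⟨⟨hsub S hS.1.1, hcond S hS.1.2⟩, ?_⟩
        rw [hmema, hmem S _ hνa]
        tauto
      · intro S hS
        simp only [mem_filter, mem_powerset] at hS ⊢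
        refine ⟨⟨hsub S hS.1.1, hcond S hS.1.2⟩, ?_⟩
        rw [hmema, hmem S _ hνa]
        tauto
      · intro S _
        exact symmDiff_symmDiff_cancel_right _ _
      · intro S _
        exact symmDiff_symmDiff_cancel_right _ _
    have hins : (V.powerset.filter fun S => ∀ i ∈ insert a s, (c i ↔ (i ∈ S ↔ ν i ∈ S))) =
        (V.powerset.filter fun S => ∀ i ∈ s, (c i ↔ (i ∈ S ↔ ν i ∈ S))).filter
        fun S => c a ↔ (a ∈ S ↔ ν a ∈ S) := by
      ext S
      simp only [mem_filter, forall_mem_insert]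
      tauto
    rw [hins, card_insert_of_notMem ha, pow_succ, ← hs, ← hsplit, ← hbij]
    ring

variable {n l : ℕ} {j : Fin l → ℕ}

/-- Both sets `I` consist of neighbors inside `I_e`: on one side by admissibility, on the other
because ends sharing a side belong to `E ∪ O`. So it suffices to test them there. -/
theorem pairTriplet_eq_iff {Q : Triplet l} (hQ : Q.IsAdmissible j) (E O : Finset (Fin l)) :
    pairTriplet j E O = Q ↔ E ∪ O = Q.Ie ∧ E ∩ O = Q.If ∧
      ∀ i i', IsNeighbor j Q.If Q.Ie i i' → (i ∈ Q.I ↔ ∃ i'', IsNeighbor j Q.If univ i i'' ∧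
        (i ∈ E ∧ i'' ∈ E ∨ i ∈ O ∧ i'' ∈ O)) := by
  constructor
  · rintro rfl
    refine ⟨rfl, rfl, fun i i' _ => ?_⟩
    simp [pairTriplet]
  · rintro ⟨h1, h2, h3⟩
    ext i
    · simp only [pairTriplet, h1]
    · simp only [pairTriplet, h2, mem_filter, mem_univ, true_and]
      constructor
      · rintro ⟨i', hn, h⟩
        have hi : i ∈ Q.Ie ∧ i' ∈ Q.Ie := by
          rw [← h1]
          simp only [mem_union]
          tauto
        exact (h3 i i' (hn.of_subset hi.1 hi.2)).2 ⟨i', hn, h⟩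
      · intro h
        obtain ⟨i', hi'⟩ := mem_nbrs.1 (hQ.2 h)
        exact (h3 i i' hi').1 h
    · simp only [pairTriplet, h2]

/-- An index of `I_e \ I_f` is in exactly one of `E` and `O`, so a pair amounts to the set `S = E \
I_f`. Membership of `i` in `I` says whether `S` separates `i` from its neighbor, and `j` increases
along these edges. -/
theorem card_pairTriplet_eq (hinj : Function.Injective j) {Q : Triplet l}
    (hQ : Q.IsAdmissible j) :
    (univ.filter fun p : Finset (Fin l) × Finset (Fin l) => pairTriplet j p.1 p.2 = Q).card =
      2 ^ (Q.Ie \ (Q.If ∪ nbrs j Q.If Q.Ie)).card := by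
  set N := nbrs j Q.If Q.Ie with hNdef
  set V := Q.Ie \ Q.If with hVdef
  have hex : ∀ i : Fin l, ∃ i', i ∈ N → IsNeighbor j Q.If Q.Ie i i' := by
    intro i
    by_cases h : i ∈ N
    · obtain ⟨i', hi'⟩ := mem_nbrs.1 h
      exact ⟨i', fun _ => hi'⟩
    · exact ⟨i, fun h' => absurd h' h⟩
  choose ν hν using hex
  have hNV : N ⊆ V := fun i hi => (hν i hi).left_mem
  have hcount := card_filter_edge_parity V N ν j (fun i => i ∈ Q.I) hNV fun i hi => (hν i hi).lt
  have hcard : V.card = (Q.Ie \ (Q.If ∪ N)).card + N.card := by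
    have : Q.Ie \ (Q.If ∪ N) = V \ N := by
      rw [hVdef, sdiff_sdiff_left]
      rfl
    rw [this, card_sdiff_add_card_eq_card hNV]
  rw [hcard, pow_add] at hcount
  rw [← Nat.eq_of_mul_eq_mul_right (by positivity) hcount]
  have hiff : ∀ E O : Finset (Fin l), pairTriplet j E O = Q ↔ E ∪ O = Q.Ie ∧ E ∩ O = Q.If ∧
      ∀ i ∈ N, (i ∈ Q.I ↔ (i ∈ E ↔ ν i ∈ E)) := by
    intro E O
    rw [pairTriplet_eq_iff hQ]
    refine and_congr_right fun h1 => and_congr_right fun h2 => ?_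
    have hsides : ∀ i ∈ V, (i ∈ O ↔ i ∉ E) := by
      intro i hi
      rw [hVdef, mem_sdiff, ← h1, ← h2, mem_union, mem_inter] at hi
      tauto
    have hcond : ∀ i ∈ N, ((∃ i'', IsNeighbor j Q.If univ i i'' ∧
        (i ∈ E ∧ i'' ∈ E ∨ i ∈ O ∧ i'' ∈ O)) ↔ (i ∈ E ↔ ν i ∈ E)) := by
      intro i hi
      have hn := hν i hi
      have hn' : IsNeighbor j Q.If univ i (ν i) := hn.of_subset (mem_univ _) (mem_univ _)
      have e1 := hsides i (hNV hi)
      have e2 := hsides (ν i) hn.right_mem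
      constructor
      · rintro ⟨i'', h3, h4⟩
        rw [← hn'.unique hinj h3] at h4
        tauto
      · intro h3
        exact ⟨ν i, hn', by tauto⟩
    constructor
    · intro h i hi
      rw [h i _ (hν i hi), hcond i hi]
    · intro h i i' hi'
      have hi : i ∈ N := mem_nbrs.2 ⟨i', hi'⟩
      rw [h i hi, hcond i hi]
  refine card_bij' (fun p _ => p.1 \ Q.If) (fun S _ => (Q.If ∪ S, Q.Ie \ S)) ?_ ?_ ?_ ?_
  · rintro ⟨E, O⟩ hp
    simp only [mem_filter, mem_univ, true_and, hiff, mem_powerset] at hp ⊢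
    obtain ⟨h1, h2, h3⟩ := hp
    refine ⟨?_, fun i hi => ?_⟩
    · rw [hVdef, ← h1]
      exact sdiff_subset_sdiff subset_union_left subset_rfl
    · have e1 := (mem_sdiff.1 (hν i hi).left_mem).2
      have e2 := (mem_sdiff.1 (hν i hi).right_mem).2
      rw [h3 i hi, mem_sdiff, mem_sdiff]
      tauto
  · intro S hS
    simp only [mem_filter, mem_univ, true_and, hiff, mem_powerset] at hS ⊢
    obtain ⟨h1, h3⟩ := hS
    have hS1 : ∀ x ∈ S, x ∈ Q.Ie ∧ x ∉ Q.If := fun x hx => mem_sdiff.1 (h1 hx)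
    have hQ1 : ∀ x ∈ Q.If, x ∈ Q.Ie := fun x hx => hQ.1 hx
    refine ⟨?_, ?_, fun i hi => ?_⟩
    · ext x
      have := hS1 x
      have := hQ1 x
      simp only [mem_union, mem_sdiff]
      tauto
    · ext x
      have := hS1 x
      have := hQ1 x
      simp only [mem_union, mem_sdiff, mem_inter]
      tauto
    · have e1 := (mem_sdiff.1 (hν i hi).left_mem).2
      have e2 := (mem_sdiff.1 (hν i hi).right_mem).2
      rw [h3 i hi, mem_union, mem_union]
      tauto
  · rintro ⟨E, O⟩ hp
    simp only [mem_filter, mem_univ, true_and, hiff] at hp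
    obtain ⟨h1, h2, -⟩ := hp
    simp only [Prod.mk.injEq]
    rw [← h1, ← h2]
    constructor <;> ext x <;> simp only [mem_union, mem_sdiff, mem_inter] <;> tauto
  · intro S hS
    simp only [mem_filter, mem_powerset] at hS
    ext x
    have := fun hx : x ∈ S => mem_sdiff.1 (hS.1 hx)
    simp only [mem_union, mem_sdiff]
    tauto

theorem sum_pairTriplet_eq (hinj : Function.Injective j) {Q : Triplet l}
    (hQ : Q.IsAdmissible j) :
    ∑ p : Finset (Fin l) × Finset (Fin l) with pairTriplet j p.1 p.2 = Q,
        (-1 : ℤ) ^ (p.1.card + p.2.card) =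
      2 ^ (Q.Ie \ (Q.If ∪ nbrs j Q.If Q.Ie)).card * (-1) ^ (Q.Ie \ Q.If).card := by
  have h : ∀ p ∈ univ.filter fun p : Finset (Fin l) × Finset (Fin l) => pairTriplet j p.1 p.2 = Q,
      (-1 : ℤ) ^ (p.1.card + p.2.card) = (-1) ^ (Q.Ie \ Q.If).card := by
    rintro ⟨E, O⟩ hp
    rw [mem_filter] at hp
    have h1 : E ∪ O = Q.Ie := congrArg Triplet.Ie hp.2
    have h2 : E ∩ O = Q.If := congrArg Triplet.If hp.2
    have h3 := card_union_add_card_inter E O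
    have h4 := card_sdiff_add_card_eq_card hQ.1
    rw [h1, h2] at h3
    rw [show E.card + O.card = (Q.Ie \ Q.If).card + 2 * Q.If.card by omega, pow_add, pow_mul]
    simp
  rw [sum_congr rfl h, sum_const, card_pairTriplet_eq hinj hQ]
  simp

end Counting

/-! ### Even ranks of products of blocks -/

theorem descList_eq_cons {a b : ℕ} (h : a ≤ b) : ∃ T, descList a b = b :: T := by
  rcases b with _ | b
  · obtain rfl : a = 0 := by omega
    exact ⟨[], descList_self 0⟩
  · exact ⟨_, descList_succ a b h⟩

section BlockProducts

variable {n : ℕ}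

/-- `z` permutes the letters `2k - 1, …, 2k + 2`. It is `1`, moves both letters of the lower pair
to the upper pair, or moves just the larger one, to the larger letter of the upper pair if `r`
holds and to the smaller one if not, depending on how many of `e` and `o` hold. -/
structure IsBlock (k : ℕ) (e o r : Prop) (z : Perm (Fin (2 * n))) : Prop where
  fix : ∀ x, x.val + 2 < 2 * k ∨ 2 * k + 2 ≤ x.val → z x = x
  none : ¬ e → ¬ o → z = 1
  double : e → o → ∀ x, 2 * k ≤ x.val + 2 → x.val < 2 * k → (z x).val = x.val + 2
  single_fix : ¬ (e ↔ o) → ∀ x, x.val + 2 = 2 * k → z x = x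
  single_move : ¬ (e ↔ o) → ∀ x, x.val + 1 = 2 * k → (z x).val = if r then 2 * k + 1 else 2 * k

variable {k : ℕ} {e o r : Prop} {z : Perm (Fin (2 * n))}

theorem IsBlock.val_mem (h : IsBlock k e o r z) (x : Fin (2 * n)) (h1 : 2 * k ≤ x.val + 2)
    (h2 : x.val < 2 * k + 2) : 2 * k ≤ (z x).val + 2 ∧ (z x).val < 2 * k + 2 := by
  by_contra hcon
  have h3 : z (z x) = z x := h.fix _ (by omega)
  have h4 := z.injective h3
  rw [h4] at hcon
  omega

theorem IsBlock.le_val_iff (h : IsBlock k e o r z) (q : ℕ) (hq : q + 2 ≤ 2 * k ∨ 2 * k + 2 ≤ q)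
    (x : Fin (2 * n)) : q ≤ (z x).val ↔ q ≤ x.val := by
  by_cases h1 : x.val + 2 < 2 * k ∨ 2 * k + 2 ≤ x.val
  · rw [h.fix x h1]
  · have := h.val_mem x (by omega) (by omega)
    omega

theorem IsBlock.rankCount_mul (h : IsBlock k e o r z) (σ : Perm (Fin (2 * n))) (p q : ℕ)
    (hq : q + 2 ≤ 2 * k ∨ 2 * k + 2 ≤ q) : rankCount (z * σ) p q = rankCount σ p q := by
  unfold rankCount
  congr 1
  ext x
  rw [mem_filter, mem_filter, Perm.mul_apply, h.le_val_iff q hq]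

theorem lt_of_rankCount_eq_zero {m : ℕ} {σ : Perm (Fin m)} {p q : ℕ} (h : rankCount σ p q = 0)
    {x : Fin m} (hx : x.val < p) : (σ x).val < q := by
  rw [rankCount, card_eq_zero, filter_eq_empty_iff] at h
  have := h (mem_univ x)
  omega

/-- By `hσ` only values below `2k` occur at the positions counted. There `z` just lifts the lower
pair by two, so the thresholds pull back by two. -/
theorem IsBlock.rankCount_mul_double (h : IsBlock k e o r z) (he : e) (ho : o)
    (σ : Perm (Fin (2 * n))) (hσ : rankCount σ (2 * k) (2 * k) = 0) (p : ℕ) (hp : p ≤ 2 * k) :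
    rankCount (z * σ) p (2 * k) = rankCount σ p (2 * (k - 1)) ∧
      (1 ≤ k → rankCount (z * σ) p (2 * k + 1) = rankCount σ p (2 * k - 1)) := by
  have key : ∀ x : Fin (2 * n), x.val < p → (σ x).val < 2 * k ∧
      ((σ x).val + 2 < 2 * k ∧ (z (σ x)).val = (σ x).val ∨
        2 * k ≤ (σ x).val + 2 ∧ (z (σ x)).val = (σ x).val + 2) := by
    intro x hx
    have h1 := lt_of_rankCount_eq_zero hσ (x := x) (by omega)
    refine ⟨h1, ?_⟩
    by_cases h2 : (σ x).val + 2 < 2 * k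
    · exact Or.inl ⟨h2, by rw [h.fix _ (Or.inl h2)]⟩
    · exact Or.inr ⟨by omega, h.double he ho _ (by omega) h1⟩
  constructor
  · unfold rankCount
    congr 1
    ext x
    rw [mem_filter, mem_filter, Perm.mul_apply, and_iff_right (mem_univ x),
      and_iff_right (mem_univ x)]
    refine and_congr_right fun hx => ?_
    have := key x hx
    omega
  · intro hk
    unfold rankCount
    congr 1
    ext x
    rw [mem_filter, mem_filter, Perm.mul_apply, and_iff_right (mem_univ x),
      and_iff_right (mem_univ x)]
    refine and_congr_right fun hx => ?_
    have := key x hx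
    omega

/-- Of the values below `2k`, only `2k - 1` is moved; whether it counts at the odd threshold `2k +
1` is decided by `r`. -/
theorem IsBlock.rankCount_mul_single (h : IsBlock k e o r z) (he : ¬ (e ↔ o)) (hk : 1 ≤ k)
    (σ : Perm (Fin (2 * n))) (hσ : rankCount σ (2 * k) (2 * k) = 0) (p : ℕ) (hp : p ≤ 2 * k) :
    rankCount (z * σ) p (2 * k) = rankCount σ p (2 * k - 1) ∧
      (r → rankCount (z * σ) p (2 * k + 1) = rankCount σ p (2 * k - 1)) ∧
      (¬ r → rankCount (z * σ) p (2 * k + 1) = 0) := by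
  have key : ∀ x : Fin (2 * n), x.val < p → (σ x).val < 2 * k ∧
      ((σ x).val + 2 ≤ 2 * k ∧ (z (σ x)).val = (σ x).val ∨
        (σ x).val + 1 = 2 * k ∧ (z (σ x)).val = if r then 2 * k + 1 else 2 * k) := by
    intro x hx
    have h1 := lt_of_rankCount_eq_zero hσ (x := x) (by omega)
    refine ⟨h1, ?_⟩
    rcases lt_trichotomy ((σ x).val + 2) (2 * k) with h2 | h2 | h2
    · exact Or.inl ⟨h2.le, by rw [h.fix _ (Or.inl h2)]⟩
    · exact Or.inl ⟨h2.le, by rw [h.single_fix he _ h2]⟩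
    · exact Or.inr ⟨by omega, h.single_move he _ (by omega)⟩
  refine ⟨?_, fun hr => ?_, fun hr => ?_⟩
  · unfold rankCount
    congr 1
    ext x
    rw [mem_filter, mem_filter, Perm.mul_apply, and_iff_right (mem_univ x),
      and_iff_right (mem_univ x)]
    refine and_congr_right fun hx => ?_
    have := key x hx
    split_ifs at this <;> omega
  · unfold rankCount
    congr 1
    ext x
    rw [mem_filter, mem_filter, Perm.mul_apply, and_iff_right (mem_univ x),
      and_iff_right (mem_univ x)]
    refine and_congr_right fun hx => ?_
    have := key x hx
    rw [if_pos hr] at this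
    omega
  · rw [rankCount, card_eq_zero, filter_eq_empty_iff]
    intro x _
    rw [Perm.mul_apply]
    rintro ⟨hx, hx2⟩
    have := key x hx
    rw [if_neg hr] at this
    omega

variable {ι : Type*} (j : ι → ℕ) (z : ι → Perm (Fin (2 * n))) (E O R : ι → Prop)

theorem rankCount_prod_self_eq_zero (M : List ι) (hz : ∀ i ∈ M, IsBlock (j i) (E i) (O i) (R i) (z i))
    (m : ℕ) (hm : m ∉ M.map j) : rankCount (M.map z).prod (2 * m) (2 * m) = 0 := by
  induction M with
  | nil =>
    rw [List.map_nil, List.prod_nil, rankCount, card_eq_zero, filter_eq_empty_iff]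
    intro x _
    rw [Perm.one_apply]
    omega
  | cons i M ih =>
    simp only [List.map_cons, List.mem_cons, not_or] at hm
    rw [List.map_cons, List.prod_cons, (hz i (by simp)).rankCount_mul _ _ _ (by omega)]
    exact ih (fun i hi => hz i (by simp [hi])) hm.2

/-- The letter of `b` reached from below moves on through blocks moving both letters until it
reaches the block `i'`, which moves just one. -/
def LeadsTo (M : List ι) (b : ℕ) (i' : ι) : Prop :=
  i' ∈ M ∧ b ≤ j i' ∧ (descList b (j i')).Sublist (M.map j) ∧
    (∀ x ∈ M, b ≤ j x → j x < j i' → E x ∧ O x) ∧ ¬ (E i' ↔ O i')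

set_option maxHeartbeats 2000000 in
/-- The even ranks of a product of blocks, in terms of subwords. -/
theorem rankCount_prod_blocks (M : List ι) (hj : ∀ i ∈ M, 1 ≤ j i ∧ j i < n)
    (hd : (M.map j).Nodup) (hz : ∀ i ∈ M, IsBlock (j i) (E i) (O i) (R i) (z i))
    (hR : ∀ M₁ i M₂, M = M₁ ++ i :: M₂ → ¬ (E i ↔ O i) → ∀ i', LeadsTo j E O M₁ (j i + 1) i' →
      (R i ↔ (E i ↔ E i'))) (a b : ℕ) (hab : a ≤ b) :
    rankCount (M.map z).prod (2 * a) (2 * b) =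
      (if (descList a b).Sublist ((M.filter (fun x => E x)).map j) then 1 else 0) +
      (if (descList a b).Sublist ((M.filter (fun x => O x)).map j) then 1 else 0) := by
  have not_sub : ∀ a b : ℕ, a ≤ b → ∀ (M : List ι) (θ : ι → Prop), b ∉ M.map j →
      ¬ (descList a b).Sublist ((M.filter (fun x => θ x)).map j) := by
    intro a b h M θ hM hs
    refine hM ?_
    exact (List.filter_sublist.map j).subset (hs.subset (mem_descList.2 ⟨h, le_rfl⟩))
  have sub_of_ne : ∀ a b : ℕ, a ≤ b → ∀ (i : ι) (M : List ι) (θ : ι → Prop), b ≠ j i →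
      ((descList a b).Sublist (((i :: M).filter (fun x => θ x)).map j) ↔
        (descList a b).Sublist ((M.filter (fun x => θ x)).map j)) := by
    intro a b h i M θ hb
    obtain ⟨T, hT⟩ := descList_eq_cons h
    by_cases hi : θ i
    · rw [List.filter_cons_of_pos (by simpa using hi), List.map_cons, hT,
        List.cons_sublist_cons_of_ne hb]
    · rw [List.filter_cons_of_neg (by simpa using hi)]
  have sub_self : ∀ a : ℕ, ∀ (i : ι) (M : List ι) (θ : ι → Prop), a ≤ j i → 1 ≤ j i →
      j i ∉ M.map j → ((descList a (j i)).Sublist (((i :: M).filter (fun x => θ x)).map j) ↔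
        θ i ∧ (descList a (j i - 1)).Sublist ((M.filter (fun x => θ x)).map j)) := by
    intro a i M θ ha hi hM
    by_cases hθ : θ i
    · have h1 := descList_succ a (j i - 1) (by omega)
      rw [show j i - 1 + 1 = j i by omega] at h1
      rw [List.filter_cons_of_pos (by simpa using hθ), List.map_cons, h1, List.cons_sublist_cons]
      simp [hθ]
    · rw [List.filter_cons_of_neg (by simpa using hθ)]
      simp [hθ, not_sub a (j i) ha M θ hM]
  have hdesc : ∀ a : ℕ, 1 ≤ a → descList a (a - 1) = [] := by
    intro a ha
    simp [descList, show a - 1 + 1 - a = 0 by omega]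
  -- Induction on the suffix `M₂`; the factors in `M₁` act after it. A single block turns an even
  -- threshold into an odd one, so both kinds are carried along. The threshold `2b - 1` asks for the
  -- larger letter of the pair `b` or beyond; that letter is the one that `M₁` passes on to `i'`,
  -- and it belongs to the side `θ` of `i'`.
  have main : ∀ M₂ M₁ : List ι, M = M₁ ++ M₂ →
      (∀ a b : ℕ, a ≤ b → rankCount (M₂.map z).prod (2 * a) (2 * b) =
        (if (descList a b).Sublist ((M₂.filter (fun x => E x)).map j) then 1 else 0) +
        (if (descList a b).Sublist ((M₂.filter (fun x => O x)).map j) then 1 else 0)) ∧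
      ∀ a b : ℕ, a < b → b ∉ M₂.map j → ∀ i', LeadsTo j E O M₁ b i' →
        ∀ θ : ι → Prop, θ = E ∨ θ = O → θ i' →
        rankCount (M₂.map z).prod (2 * a) (2 * b - 1) =
          if (descList a (b - 1)).Sublist ((M₂.filter (fun x => θ x)).map j) then 1 else 0 := by
    intro M₂
    induction M₂ with
    | nil =>
      intro M₁ _
      have hone : ∀ p q : ℕ, p ≤ q → rankCount (1 : Perm (Fin (2 * n))) p q = 0 := by
        intro p q h
        rw [rankCount, card_eq_zero, filter_eq_empty_iff]
        intro x _
        rw [Perm.one_apply]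
        omega
      refine ⟨fun a b h => ?_, fun a b h _ i' _ θ _ _ => ?_⟩
      · rw [if_neg (not_sub a b h [] E (by simp)), if_neg (not_sub a b h [] O (by simp))]
        exact hone _ _ (by omega)
      · rw [if_neg (not_sub a (b - 1) (by omega) [] θ (by simp))]
        exact hone _ _ (by omega)
    | cons i M₂ ih =>
      intro M₁ hM
      have hM' : M = (M₁ ++ [i]) ++ M₂ := by rw [hM]; simp
      obtain ⟨ihA, ihB⟩ := ih (M₁ ++ [i]) hM'
      have hi : i ∈ M := by rw [hM]; simp
      have hzi := hz i hi
      have hji := hj i hi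
      have hd' := hd
      rw [hM, List.map_append, List.map_cons, List.nodup_append, List.nodup_cons] at hd'
      obtain ⟨-, ⟨him, -⟩, hdisj⟩ := hd'
      have hi1 : j i ∉ M₁.map j := fun h => hdisj _ h _ (by simp) rfl
      set σ := (M₂.map z).prod with hσ
      -- `j i` does not occur in `M₂`, so `σ` preserves the letters below `2 * j i`. The values 1
      -- and 2 that follow settle the case `a = j i`, where the remaining run is empty.
      have hσ0 : rankCount σ (2 * j i) (2 * j i) = 0 :=
        rankCount_prod_self_eq_zero j z E O R M₂
          (fun x hx => hz x (by rw [hM]; simp [hx])) _ him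
      have hσ1 : rankCount σ (2 * j i) (2 * j i - 1) = 1 := by
        have h1 := rankCount_le_succ_right σ (2 * j i) (2 * j i - 1)
        have h2 := sub_le_rankCount σ (2 * j i) (2 * j i - 1) (by omega)
        rw [show 2 * j i - 1 + 1 = 2 * j i by omega] at h1
        omega
      have hσ2 : rankCount σ (2 * j i) (2 * (j i - 1)) = 2 := by
        have h1 := rankCount_le_succ_right σ (2 * j i) (2 * (j i - 1))
        have h2 := sub_le_rankCount σ (2 * j i) (2 * (j i - 1)) (by omega)
        rw [show 2 * (j i - 1) + 1 = 2 * j i - 1 by omega] at h1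
        omega
      have hself : ¬ (E i ↔ O i) → LeadsTo j E O (M₁ ++ [i]) (j i) i := by
        intro h
        refine ⟨by simp, le_rfl, ?_, fun x _ h1 h2 => absurd h1 h2.not_ge, h⟩
        rw [descList_self]
        simp
      rw [List.map_cons, List.prod_cons, ← hσ]
      refine ⟨fun a b h => ?_, fun a b h hb i' hlead θ hθ hθi' => ?_⟩
      · by_cases hb : b = j i
        · subst hb
          rw [if_congr (sub_self a i M₂ E h hji.1 him) rfl rfl,
            if_congr (sub_self a i M₂ O h hji.1 him) rfl rfl]
          -- A double block lowers the threshold by a whole pair, leading to the first claim at `j i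
          -- - 1`; a single one lowers it by one letter, leading to the second claim with `i' = i`.
          by_cases he : E i <;> by_cases ho : O i
          · rw [(hzi.rankCount_mul_double he ho σ hσ0 _ (by omega)).1]
            simp only [he, ho, true_and]
            rcases h.lt_or_eq with h1 | rfl
            · exact ihA a (j i - 1) (by omega)
            · rw [hσ2, hdesc _ hji.1]
              simp
          · have hs : ¬ (E i ↔ O i) := by tauto
            rw [(hzi.rankCount_mul_single hs hji.1 σ hσ0 _ (by omega)).1]
            simp only [he, ho, true_and, false_and, if_false, add_zero]
            rcases h.lt_or_eq with h1 | rfl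
            · exact ihB a (j i) h1 him i (hself hs) E (Or.inl rfl) he
            · rw [hσ1, hdesc _ hji.1]
              simp
          · have hs : ¬ (E i ↔ O i) := by tauto
            rw [(hzi.rankCount_mul_single hs hji.1 σ hσ0 _ (by omega)).1]
            simp only [he, ho, true_and, false_and, if_false, zero_add]
            rcases h.lt_or_eq with h1 | rfl
            · exact ihB a (j i) h1 him i (hself hs) O (Or.inr rfl) ho
            · rw [hσ1, hdesc _ hji.1]
              simp
          · rw [hzi.none he ho, one_mul, ihA a _ h, if_neg (not_sub _ _ h _ _ him),
              if_neg (not_sub _ _ h _ _ him)]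
            simp [he, ho]
        · rw [if_congr (sub_of_ne a b h i M₂ E hb) rfl rfl,
            if_congr (sub_of_ne a b h i M₂ O hb) rfl rfl,
            hzi.rankCount_mul σ _ _ (by omega)]
          exact ihA a b h
      · simp only [List.map_cons, List.mem_cons, not_or] at hb
        obtain ⟨l1, l2, l3, l4, l5⟩ := hlead
        by_cases hbm : b = j i + 1
        · subst hbm
          rw [show 2 * (j i + 1) - 1 = 2 * j i + 1 by omega, Nat.add_sub_cancel,
            if_congr (sub_self a i M₂ θ (by omega) hji.1 him) rfl rfl]
          by_cases hs : E i ↔ O i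
          · by_cases he : E i
            · have ho := hs.1 he
              have hθi : θ i := by rcases hθ with rfl | rfl <;> assumption
              rw [(hzi.rankCount_mul_double he ho σ hσ0 _ (by omega)).2 hji.1]
              simp only [hθi, true_and]
              rcases (show a ≤ j i by omega).lt_or_eq with h1 | rfl
              -- A double block hands the letter on, so `i` is added to the chain leading to `i'`.
              · refine ihB a (j i) h1 him i' ⟨by simp [l1], by omega, ?_, ?_, l5⟩ θ hθ hθi'
                · rw [descList_append _ _ (by omega), List.map_append]
                  exact l3.append (List.Sublist.refl _)
                · intro x hx h2 h3
                  rw [List.mem_append, List.mem_singleton] at hx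
                  rcases hx with hx | rfl
                  · refine l4 x hx ?_ h3
                    have : j x ≠ j i := fun h' => hi1 (h' ▸ List.mem_map_of_mem hx)
                    omega
                  · exact ⟨he, ho⟩
              · rw [hσ1, hdesc _ hji.1]
                simp
            · have ho : ¬ O i := fun ho => he (hs.2 ho)
              have hθi : ¬ θ i := by rcases hθ with rfl | rfl <;> assumption
              rw [hzi.none he ho, one_mul]
              simp only [hθi, false_and, if_false]
              have := rankCount_mono σ (show 2 * a ≤ 2 * j i by omega)
                (show 2 * j i ≤ 2 * j i + 1 by omega)
              omega
          · have hRi := hR M₁ i M₂ hM hs i' ⟨l1, l2, l3, l4, l5⟩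
            have hθi : θ i ↔ R i := by
              rw [hRi]
              rcases hθ with rfl | rfl <;> tauto
            have h3 := hzi.rankCount_mul_single hs hji.1 σ hσ0 (2 * a) (by omega)
            by_cases hr : R i
            · rw [h3.2.1 hr]
              simp only [hθi.2 hr, true_and]
              rcases (show a ≤ j i by omega).lt_or_eq with h1 | rfl
              · exact ihB a (j i) h1 him i (hself hs) θ hθ (hθi.2 hr)
              · rw [hσ1, hdesc _ hji.1]
                simp
            · rw [h3.2.2 hr, if_neg fun h' => hr (hθi.1 h'.1)]
        · rw [if_congr (sub_of_ne a (b - 1) (by omega) i M₂ θ (by omega)) rfl rfl,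
            hzi.rankCount_mul σ _ _ (by omega)]
          refine ihB a b h hb.2 i' ⟨by simp [l1], l2, ?_, ?_, l5⟩ θ hθ hθi'
          · rw [List.map_append]
            exact List.sublist_append_of_sublist_left l3
          · intro x hx h2 h3
            rw [List.mem_append, List.mem_singleton] at hx
            rcases hx with hx | rfl
            · exact l4 x hx h2 h3
            · exact absurd (l3.subset (mem_descList.2 ⟨h2, h3.le⟩)) hi1
  exact (main M [] rfl).1 a b hab

end BlockProducts

/-! ### The even ranks of 𝐪(Q) -/

section Representative

theorem exists_chain_of_range'_sublist {ι : Type*} {j : ι → ℕ} {r : ι → ι → Prop} {N : List ι}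
    (hN : N.Pairwise r) {m t : ℕ} (h : (List.range' m (t + 1)).Sublist (N.map j)) :
    ∃ c : ℕ → ι, (∀ k < t, r (c k) (c (k + 1))) ∧ ∀ k ≤ t, c k ∈ N ∧ j (c k) = m + k := by
  obtain ⟨N', hN', hmap⟩ := List.sublist_map_iff.1 h
  have hlen : N'.length = t + 1 := by
    have := congrArg List.length hmap
    simpa using this.symm
  have h0 : 0 < N'.length := by omega
  have hc : ∀ k (hk : k < N'.length), N'.getD k N'[0] = N'[k] := fun k hk => by
    rw [List.getD_eq_getElem _ _ hk]
  refine ⟨fun k => N'.getD k N'[0], fun k hk => ?_, fun k hk => ?_⟩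
  · beta_reduce
    rw [hc k (by omega), hc (k + 1) (by omega)]
    exact List.pairwise_iff_getElem.1 (hN.sublist hN') _ _ _ _ (by omega)
  · beta_reduce
    rw [hc k (by omega)]
    refine ⟨hN'.subset (List.getElem_mem _), ?_⟩
    have h1 : (N'.map j)[k]'(by rw [List.length_map]; omega) = m + k := by
      simp only [← hmap, List.getElem_range']
      omega
    simpa using h1

/-- The descending run ending at the letter of `i`, read backwards, is the chain in the definition
of neighbors. The relation `r` is left open so that one proof covers the word and its reversal. -/
theorem LeadsTo.exists_chain {ι : Type*} {j : ι → ℕ} (hinj : Function.Injective j)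
    {E O : ι → Prop} {r : ι → ι → Prop} {M₁ M₂ : List ι} {i i' : ι}
    (hM : (M₁ ++ i :: M₂).Pairwise fun x y => r y x) (h : LeadsTo j E O M₁ (j i + 1) i') :
    ∃ (t : ℕ) (c : ℕ → ι), 0 < t ∧ c 0 = i ∧ c t = i' ∧ (∀ k < t, r (c k) (c (k + 1))) ∧
      (∀ k, 0 < k → k < t → E (c k) ∧ O (c k)) ∧ ∀ k ≤ t, j (c k) = j i + k := by
  obtain ⟨h1, h2, h3, h4, -⟩ := h
  have hN : (M₁ ++ [i]).reverse.Pairwise r := by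
    rw [List.pairwise_reverse]
    refine hM.sublist ?_
    rw [List.append_sublist_append_left]
    simp
  have hs : (List.range' (j i) (j i' - j i + 1)).Sublist ((M₁ ++ [i]).reverse.map j) := by
    rw [List.map_reverse, ← List.reverse_sublist, List.reverse_reverse, List.map_append,
      show j i' - j i + 1 = j i' + 1 - j i by omega, ← descList,
      descList_append _ _ (by omega)]
    exact h3.append (List.Sublist.refl _)
  obtain ⟨c, hc1, hc2⟩ := exists_chain_of_range'_sublist hN hs
  refine ⟨j i' - j i, c, by omega, hinj ?_, hinj ?_, hc1, fun k hk hkt => ?_,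
    fun k hk => (hc2 k hk).2⟩
  · rw [(hc2 0 (by omega)).2, add_zero]
  · rw [(hc2 _ le_rfl).2]
    omega
  · obtain ⟨h5, h6⟩ := hc2 k hkt.le
    rw [List.mem_reverse, List.mem_append, List.mem_singleton] at h5
    refine h4 _ (h5.resolve_right fun h' => ?_) (by omega) (by omega)
    rw [h'] at h6
    omega

variable {n l : ℕ} {j : Fin l → ℕ} {k : ℕ} {e o r : Prop}

theorem isBlock_one (he : ¬ e) (ho : ¬ o) : IsBlock (n := n) k e o r 1 where
  fix _ _ := rfl
  none _ _ := rfl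
  double h _ := absurd h he
  single_fix h := absurd (iff_of_false he ho) h
  single_move h := absurd (iff_of_false he ho) h

theorem isBlock_double (hk : 1 ≤ k ∧ k < n) (he : e) (ho : o) :
    IsBlock (n := n) k e o r (wordProd (2 * n) (block k)) := by
  have key : ∀ x : Fin (2 * n), (wordProd (2 * n) (block k) x).val =
      if x.val % 2 = 0 then 2 * (simpleRefl n k (pairOf x)).val
        else 2 * (simpleRefl n k (pairOf x)).val + 1 := fun x => by
    rw [← parityPerm_simpleRefl k hk, parityPerm_val]
  have hx : ∀ x : Fin (2 * n), (pairOf x).val = x.val / 2 := fun _ => rfl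
  refine ⟨fun x h => Fin.ext ?_, fun h => absurd he h, fun _ _ x h1 h2 => ?_,
    fun h => absurd (iff_of_true he ho) h, fun h => absurd (iff_of_true he ho) h⟩ <;>
  · have h3 := simpleRefl_spec hk (pairOf x)
    rw [key]
    rw [hx] at h3
    split_ifs <;> omega

theorem isBlock_single (hk : 1 ≤ k ∧ k < n) (he : ¬ (e ↔ o)) {L : List ℕ}
    (hL : L = [2 * k] ∧ ¬ r ∨ L = [2 * k, 2 * k + 1] ∧ ¬ r ∨ L = [2 * k + 1, 2 * k] ∧ r) :
    IsBlock (n := n) k e o r (wordProd (2 * n) L) := by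
  have h1 := simpleRefl_spec (m := 2 * n) (k := 2 * k) (by omega)
  have h2 := simpleRefl_spec (m := 2 * n) (k := 2 * k + 1) (by omega)
  have key : ∀ x : Fin (2 * n),
      (x.val + 2 < 2 * k ∨ 2 * k + 2 ≤ x.val ∨ x.val + 2 = 2 * k →
        (wordProd (2 * n) L x).val = x.val) ∧
      (x.val + 1 = 2 * k → (wordProd (2 * n) L x).val = if r then 2 * k + 1 else 2 * k) := by
    intro x
    rcases hL with ⟨rfl, hr⟩ | ⟨rfl, hr⟩ | ⟨rfl, hr⟩
    · rw [wordProd_cons, wordProd_nil, mul_one, if_neg hr]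
      have := h1 x
      omega
    · rw [wordProd_cons, wordProd_cons, wordProd_nil, mul_one, if_neg hr, Perm.mul_apply]
      have := h2 x
      have := h1 (simpleRefl (2 * n) (2 * k + 1) x)
      omega
    · rw [wordProd_cons, wordProd_cons, wordProd_nil, mul_one, if_pos hr, Perm.mul_apply]
      have := h1 x
      have := h2 (simpleRefl (2 * n) (2 * k) x)
      omega
  exact ⟨fun x h => Fin.ext ((key x).1 (by omega)),
    fun h h' => absurd (iff_of_false h h') he, fun h h' => absurd (iff_of_true h h') he,
    fun _ x h => Fin.ext ((key x).1 (by omega)), fun _ x h => (key x).2 h⟩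

/-- `s_{2k+1} s_{2k}` sends the letter `2k` to `2k+2`, whereas `s_{2k}` and `s_{2k} s_{2k+1}` send
it to `2k+1`. Inversion exchanges the two-letter words, and with them left and right neighbors. -/
theorem isBlock_repBlock (hj : ∀ i, 1 ≤ j i ∧ j i < n) (hinj : Function.Injective j)
    {Q : Triplet l} {E O : Finset (Fin l)} (hE : E ∪ O = Q.Ie) (hO : E ∩ O = Q.If) (i : Fin l) :
    IsBlock (j i) (i ∈ E) (i ∈ O) (i ∈ Q.I ∩ leftNbrs j Q.If univ)
        (wordProd (2 * n) (repBlock j Q i)) ∧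
      IsBlock (j i) (i ∈ E) (i ∈ O) (i ∈ Q.I ∩ rightNbrs j Q.If univ)
        (wordProd (2 * n) (repBlock j Q i))⁻¹ := by
  have hdisj : i ∈ Q.I ∩ rightNbrs j Q.If univ → i ∉ Q.I ∩ leftNbrs j Q.If univ := by
    simp only [mem_inter, rightNbrs, leftNbrs, mem_filter, mem_univ, true_and]
    rintro ⟨-, i', h1⟩ ⟨-, i'', h2⟩
    exact not_isLeftNeighbor_of_isRightNeighbor hinj h1 h2
  have hIe : i ∈ Q.Ie ↔ i ∈ E ∨ i ∈ O := by rw [← hE, mem_union]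
  have hIf : i ∈ Q.If ↔ i ∈ E ∧ i ∈ O := by rw [← hO, mem_inter]
  rw [repBlock, ← wordProd_reverse]
  by_cases he : i ∈ E <;> by_cases ho : i ∈ O
  · rw [if_neg (by simp [hIe, he]), if_pos (hIf.2 ⟨he, ho⟩)]
    refine ⟨isBlock_double (hj i) he ho, ?_⟩
    rw [show (block (j i)).reverse = [2 * j i, 2 * j i + 1, 2 * j i - 1, 2 * j i] from rfl]
    have h1 : (parityPerm (simpleRefl n (j i), simpleRefl n (j i)))⁻¹ =
        parityPerm (simpleRefl n (j i), simpleRefl n (j i)) := by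
      rw [← map_inv, Prod.inv_mk, simpleRefl_inv]
    have h2 : wordProd (2 * n) [2 * j i, 2 * j i + 1, 2 * j i - 1, 2 * j i] =
        wordProd (2 * n) (block (j i)) := by
      rw [show [2 * j i, 2 * j i + 1, 2 * j i - 1, 2 * j i] = (block (j i)).reverse from rfl,
        wordProd_reverse, ← parityPerm_simpleRefl _ (hj i), h1]
    rw [h2]
    exact isBlock_double (hj i) he ho
  pick_goal 3
  · rw [if_pos (by simp [hIe, he, ho]), List.reverse_nil, wordProd_nil]
    exact ⟨isBlock_one he ho, isBlock_one he ho⟩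
  all_goals
    have hs : ¬ (i ∈ E ↔ i ∈ O) := by simp [he, ho]
    rw [if_neg (by simp [hIe, he, ho]), if_neg (by simp [hIf, he, ho])]
    by_cases hr : i ∈ Q.I ∩ rightNbrs j Q.If univ
    · rw [if_pos hr]
      exact ⟨isBlock_single (hj i) hs (by simp [hdisj hr]),
        isBlock_single (hj i) hs (Or.inr (Or.inr ⟨rfl, hr⟩))⟩
    · rw [if_neg hr]
      by_cases hl : i ∈ Q.I ∩ leftNbrs j Q.If univ
      · rw [if_pos hl]
        exact ⟨isBlock_single (hj i) hs (Or.inr (Or.inr ⟨rfl, hl⟩)),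
          isBlock_single (hj i) hs (Or.inr (Or.inl ⟨rfl, hr⟩))⟩
      · rw [if_neg hl]
        exact ⟨isBlock_single (hj i) hs (Or.inl ⟨rfl, hl⟩),
          isBlock_single (hj i) hs (Or.inl ⟨rfl, hr⟩)⟩

theorem mem_I_iff_of_isNeighbor (hinj : Function.Injective j) {Q : Triplet l}
    (hQ : Q.IsAdmissible j) {E O : Finset (Fin l)} (h : pairTriplet j E O = Q) {i i' : Fin l}
    (hi : ¬ (i ∈ E ↔ i ∈ O)) (hi' : ¬ (i' ∈ E ↔ i' ∈ O)) (hn : IsNeighbor j Q.If univ i i') :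
    i ∈ Q.I ↔ (i ∈ E ↔ i' ∈ E) := by
  obtain ⟨h1, -, h3⟩ := (pairTriplet_eq_iff hQ E O).1 h
  have hmem : ∀ x, ¬ (x ∈ E ↔ x ∈ O) → x ∈ Q.Ie := by
    intro x hx
    rw [← h1, mem_union]
    tauto
  rw [h3 i i' (hn.of_subset (hmem i hi) (hmem i' hi'))]
  constructor
  · rintro ⟨i'', h4, h5⟩
    obtain rfl := hn.unique hinj h4
    tauto
  · intro h4
    exact ⟨i', hn, by tauto⟩

/-- The blocks of 𝐪(Q) record in `I` which neighbors share a side, which is what the rank formula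
for products of blocks asks for. Left neighbors govern the ranks above the diagonal; right neighbors
govern those of the inverse, whose blocks come in reverse order. -/
theorem evenRankEq_repOf (hj : ∀ i, 1 ≤ j i ∧ j i < n) (hinj : Function.Injective j)
    {Q : Triplet l} (hQ : Q.IsAdmissible j) {E O : Finset (Fin l)} (h : pairTriplet j E O = Q) :
    EvenRankEq (repOf n j Q) (parityPerm (subwordElt n j E, subwordElt n j O)) := by
  obtain ⟨h1, h2, -⟩ := (pairTriplet_eq_iff hQ E O).1 h
  have hblock := isBlock_repBlock hj hinj h1 h2
  have hrep : repOf n j Q =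
      ((List.finRange l).map fun i => wordProd (2 * n) (repBlock j Q i)).prod := by
    rw [repOf, wordProd_flatten, List.ofFn_eq_map, List.map_map]
    rfl
  have hnd : ((List.finRange l).map j).Nodup := (List.nodup_finRange l).map hinj
  have hout : ∀ i, ¬ (i ∈ E ↔ i ∈ O) → i ∈ univ \ Q.If := by
    intro i hi
    rw [← h2, mem_sdiff, mem_inter]
    exact ⟨mem_univ _, by tauto⟩
  have hsort : (List.finRange l).Pairwise fun x y => x < y := List.pairwise_lt_finRange l
  have hsub : ∀ S : Finset (Fin l),
      subword j S = ((List.finRange l).filter fun x => @decide (x ∈ S) (Classical.propDecidable _)).map j := by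
    intro S
    refine congrArg (List.map j) (List.filter_congr fun x _ => ?_)
    congr
  refine evenRankEq_of_le_half (fun a b hab => ?_) fun a b hab => ?_
  · rw [hrep, rankCount_prod_blocks j _ (fun i => i ∈ E) (fun i => i ∈ O)
      (fun i => i ∈ Q.I ∩ leftNbrs j Q.If univ) (List.finRange l) (fun i _ => hj i) hnd
      (fun i _ => (hblock i).1) ?_ a b hab, rankCount_parityPerm_even,
      rankCount_subwordElt hj hinj _ _ _ hab, rankCount_subwordElt hj hinj _ _ _ hab]
    · rw [hsub, hsub]
    · intro M₁ i M₂ hM hi i' hl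
      rw [hM] at hsort
      have hchain := hl.exists_chain (r := fun x y => y < x) hinj hsort
      have hnb : IsLeftNeighbor j Q.If univ i i' := by
        obtain ⟨t, c, c1, c2, c3, c4, c5, c6⟩ := hchain
        exact ⟨hout i hi, hout i' hl.2.2.2.2, t, c, c1, c2, c3, c4,
          fun k hk hk' => h2 ▸ mem_inter.2 (c5 k hk hk'), c6⟩
      have hmem : i ∈ leftNbrs j Q.If univ := mem_filter.2 ⟨mem_univ _, i', hnb⟩
      rw [mem_inter, and_iff_left hmem]
      exact mem_I_iff_of_isNeighbor hinj hQ h hi hl.2.2.2.2 (Or.inr hnb)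
  · have hinv : (repOf n j Q)⁻¹ = ((List.finRange l).reverse.map
        fun i => (wordProd (2 * n) (repBlock j Q i))⁻¹).prod := by
      rw [hrep, List.prod_inv_reverse, List.map_map, ← List.map_reverse]
      rfl
    rw [hinv, rankCount_prod_blocks j _ (fun i => i ∈ E) (fun i => i ∈ O)
      (fun i => i ∈ Q.I ∩ rightNbrs j Q.If univ) (List.finRange l).reverse (fun i _ => hj i)
      (by rw [List.map_reverse, List.nodup_reverse]; exact hnd)
      (fun i _ => (hblock i).2) ?_ a b hab, ← map_inv, Prod.inv_mk, rankCount_parityPerm_even,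
      rankCount_subwordElt_inv hj hinj _ _ _ hab, rankCount_subwordElt_inv hj hinj _ _ _ hab,
      List.filter_reverse, List.filter_reverse, List.map_reverse, List.map_reverse]
    · rw [hsub, hsub]
      simp only [descList, List.reverse_sublist]
    · intro M₁ i M₂ hM hi i' hl
      rw [← List.pairwise_reverse, hM] at hsort
      have hchain := hl.exists_chain (r := fun x y => x < y) hinj hsort
      have hnb : IsRightNeighbor j Q.If univ i i' := by
        obtain ⟨t, c, c1, c2, c3, c4, c5, c6⟩ := hchain
        exact ⟨hout i hi, hout i' hl.2.2.2.2, t, c, c1, c2, c3, c4,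
          fun k hk hk' => h2 ▸ mem_inter.2 (c5 k hk hk'), c6⟩
      have hmem : i ∈ rightNbrs j Q.If univ := mem_filter.2 ⟨mem_univ _, i', hnb⟩
      rw [mem_inter, and_iff_left hmem]
      exact mem_I_iff_of_isNeighbor hinj hQ h hi hl.2.2.2.2 (Or.inl hnb)

end Representative

/-! ### Signed sums and the double coset of 𝐪(Q) -/

section DoubleCoset

variable {n l : ℕ} {j : Fin l → ℕ}

/-- The indicator function of 𝐩(u) = Q is constant on double cosets, so `sum_maskSign_mul` applies
to it. -/
theorem sum_maskSign_tripletOf (hj : ∀ i, 1 ≤ j i ∧ j i < n) (hinj : Function.Injective j)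
    {Q : Triplet l} (hQ : Q.IsAdmissible j) :
    (∑ x : Fin l → Fin 4 → Fin 2 with
        tripletOf n j (wordProd (2 * n) (maskedWord j x)) = Q, maskSign x) =
      2 ^ (Q.Ie \ (Q.If ∪ nbrs j Q.If Q.Ie)).card * (-1) ^ (Q.Ie \ Q.If).card := by
  have h := sum_maskSign_mul (n := n) j hj hinj (fun u => if tripletOf n j u = Q then (1 : ℤ) else 0)
    (fun h hh u => by rw [tripletOf_congr hj (evenRankEq_mul_left hh u)])
    (fun h hh u => by rw [tripletOf_congr hj (evenRankEq_mul_right hh u)])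
  simp only [mul_ite, mul_one, mul_zero, tripletOf_parityPerm hj hinj] at h
  rw [← sum_filter, ← sum_filter] at h
  rw [h, sum_pairTriplet_eq hinj hQ]

theorem filter_tripletOf_eq_image (hj : ∀ i, 1 ≤ j i ∧ j i < n) (hinj : Function.Injective j)
    (Q : Triplet l) :
    (univ.filter fun u : Perm (Fin (2 * n)) => u ∈ paritySubgroup n ∧
        BruhatLE u (tilde (wordProd n (List.ofFn j))) ∧ tripletOf n j u = Q) =
      (univ.filter fun p : Finset (Fin l) × Finset (Fin l) => pairTriplet j p.1 p.2 = Q).image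
        fun p => parityPerm (subwordElt n j p.1, subwordElt n j p.2) := by
  have hL : ∀ k ∈ List.ofFn j, 1 ≤ k ∧ k < n := by simpa [List.forall_mem_ofFn_iff] using hj
  have hd : (List.ofFn j).Nodup := List.nodup_ofFn.2 hinj
  ext u
  simp only [mem_filter, mem_univ, true_and, mem_image]
  constructor
  · rintro ⟨h1, h2, h3⟩
    have h4 : parityPerm (evenPart ⟨u, h1⟩, oddPart ⟨u, h1⟩) = u := parityPerm_parts ⟨u, h1⟩
    rw [← h4, bruhatLE_parityPerm_tilde_iff hL hd, bruhatLE_word_iff hj hinj,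
      bruhatLE_word_iff hj hinj] at h2
    obtain ⟨⟨E, hE⟩, O, hO⟩ := h2
    rw [hE, hO] at h4
    refine ⟨(E, O), ?_, h4⟩
    rw [← tripletOf_parityPerm hj hinj, h4, h3]
  · rintro ⟨p, hp, rfl⟩
    refine ⟨parityPerm_mem _ _, ?_, by rw [tripletOf_parityPerm hj hinj, hp]⟩
    rw [bruhatLE_parityPerm_tilde_iff hL hd, bruhatLE_word_iff hj hinj,
      bruhatLE_word_iff hj hinj]
    exact ⟨⟨_, rfl⟩, _, rfl⟩

theorem parityPerm_subwordElt_injective (hj : ∀ i, 1 ≤ j i ∧ j i < n)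
    (hinj : Function.Injective j) :
    Function.Injective fun p : Finset (Fin l) × Finset (Fin l) =>
      parityPerm (subwordElt n j p.1, subwordElt n j p.2) := by
  intro p p' h
  have h1 := parityPerm_injective h
  rw [Prod.mk.injEq] at h1
  exact Prod.ext (subwordElt_injective hj hinj h1.1) (subwordElt_injective hj hinj h1.2)

theorem sum_sign_tripletOf (hj : ∀ i, 1 ≤ j i ∧ j i < n) (hinj : Function.Injective j)
    {Q : Triplet l} (hQ : Q.IsAdmissible j) :
    (∑ u : Perm (Fin (2 * n)) with u ∈ paritySubgroup n ∧
        BruhatLE u (tilde (wordProd n (List.ofFn j))) ∧ tripletOf n j u = Q,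
      (Perm.sign u : ℤ)) =
      2 ^ (Q.Ie \ (Q.If ∪ nbrs j Q.If Q.Ie)).card * (-1) ^ (Q.Ie \ Q.If).card := by
  rw [filter_tripletOf_eq_image hj hinj,
    sum_image (parityPerm_subwordElt_injective hj hinj).injOn, ← sum_pairTriplet_eq hinj hQ]
  refine sum_congr rfl fun p _ => ?_
  rw [sign_parityPerm, Units.val_mul, sign_subwordElt hj, sign_subwordElt hj, pow_add]

theorem doubleCoset_repOf_inter_eq (hj : ∀ i, 1 ≤ j i ∧ j i < n) (hinj : Function.Injective j)
    {Q : Triplet l} (hQ : Q.IsAdmissible j) :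
    DoubleCoset.doubleCoset (repOf n j Q) (pairSubgroup n) (pairSubgroup n) ∩
        (paritySubgroup n : Set (Perm (Fin (2 * n)))) =
      ((univ.filter fun p : Finset (Fin l) × Finset (Fin l) => pairTriplet j p.1 p.2 = Q).image
        fun p => parityPerm (subwordElt n j p.1, subwordElt n j p.2) :
          Finset (Perm (Fin (2 * n)))) := by
  have hL : ∀ k ∈ List.ofFn j, 1 ≤ k ∧ k < n := by simpa [List.forall_mem_ofFn_iff] using hj
  have hd : (List.ofFn j).Nodup := List.nodup_ofFn.2 hinj
  -- The count is a power of 2, so some pair has triplet `Q`; it serves as a base point of the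
  -- double coset.
  have hpos : 0 < (univ.filter fun p : Finset (Fin l) × Finset (Fin l) =>
      pairTriplet j p.1 p.2 = Q).card := by
    rw [card_pairTriplet_eq hinj hQ]
    positivity
  obtain ⟨p, hp⟩ := card_pos.1 hpos
  have hpQ : pairTriplet j p.1 p.2 = Q := (mem_filter.1 hp).2
  have hrep := evenRankEq_repOf hj hinj hQ hpQ
  have hple := mem_image_of_mem
    (fun p : Finset (Fin l) × Finset (Fin l) =>
      parityPerm (subwordElt n j p.1, subwordElt n j p.2)) hp
  rw [← filter_tripletOf_eq_image hj hinj Q, mem_filter] at hple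
  ext u
  rw [← filter_tripletOf_eq_image hj hinj, mem_coe, mem_filter, Set.mem_inter_iff,
    SetLike.mem_coe]
  constructor
  · rintro ⟨h1, h2⟩
    have h3 := (evenRankEq_of_mem_doubleCoset h1).trans hrep
    refine ⟨mem_univ _, h2, ?_, by rw [tripletOf_congr hj h3, hple.2.2.2]⟩
    have h4 : parityPerm (evenPart ⟨u, h2⟩, oddPart ⟨u, h2⟩) = u := parityPerm_parts ⟨u, h2⟩
    rw [← h4, bruhatLE_parityPerm_tilde_iff hL hd]
    -- An element of `K` lies below w̃ as soon as its even ranks allow it, and these are the even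
    -- ranks of the base point.
    refine rankCount_parityPerm_le_iff hL hd _ _ fun a b _ _ => ?_
    rw [h4, h3 a b]
    exact hple.2.2.1.rankCount_le _ _
  · rintro ⟨-, h1, h2, h3⟩
    have h4 : u ∈ univ.filter fun u : Perm (Fin (2 * n)) => u ∈ paritySubgroup n ∧
        BruhatLE u (tilde (wordProd n (List.ofFn j))) ∧ tripletOf n j u = Q :=
      mem_filter.2 ⟨mem_univ _, h1, h2, h3⟩
    rw [filter_tripletOf_eq_image hj hinj, mem_image] at h4
    obtain ⟨p', hp', rfl⟩ := h4
    exact ⟨mem_doubleCoset_of_evenRankEq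
      (evenRankEq_repOf hj hinj hQ (mem_filter.1 hp').2).symm, h1⟩

theorem ncard_doubleCoset_repOf_inter (hj : ∀ i, 1 ≤ j i ∧ j i < n)
    (hinj : Function.Injective j) {Q : Triplet l} (hQ : Q.IsAdmissible j) :
    (DoubleCoset.doubleCoset (repOf n j Q) (pairSubgroup n) (pairSubgroup n) ∩
        (paritySubgroup n : Set (Perm (Fin (2 * n))))).ncard =
      2 ^ (Q.Ie \ (Q.If ∪ nbrs j Q.If Q.Ie)).card := by
  rw [doubleCoset_repOf_inter_eq hj hinj hQ, Set.ncard_coe_finset,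
    card_image_of_injective _ (parityPerm_subwordElt_injective hj hinj),
    card_pairTriplet_eq hinj hQ]

end DoubleCoset

end

theorem mainTheorem5 (n l : ℕ) (j : Fin l → ℕ) (hj : ∀ i, 1 ≤ j i ∧ j i < n)
    (hinj : Function.Injective j) (w : Equiv.Perm (Fin n)) (hw : w = wordProd n (List.ofFn j)) :
    (∀ u : paritySubgroup n,
      BruhatLE (u : Equiv.Perm (Fin (2 * n))) (tilde w) ↔
        BruhatLE (evenPart u) w ∧ BruhatLE (oddPart u) w) ∧
    ∀ Q : Triplet l, Q.IsAdmissible j →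
      (∑ x : Fin l → Fin 4 → Fin 2 with
          tripletOf n j (wordProd (2 * n) (maskedWord j x)) = Q, maskSign x)
        = 2 ^ (Q.Ie \ (Q.If ∪ nbrs j Q.If Q.Ie)).card * (-1) ^ (Q.Ie \ Q.If).card ∧
      (2 ^ (Q.Ie \ (Q.If ∪ nbrs j Q.If Q.Ie)).card * (-1) ^ (Q.Ie \ Q.If).card : ℤ)
        = ∑ u : Equiv.Perm (Fin (2 * n)) with
            u ∈ paritySubgroup n ∧ BruhatLE u (tilde w) ∧ tripletOf n j u = Q,
          (Equiv.Perm.sign u : ℤ) ∧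
      ((∑ u : Equiv.Perm (Fin (2 * n)) with
            u ∈ paritySubgroup n ∧ BruhatLE u (tilde w) ∧ tripletOf n j u = Q,
          (Equiv.Perm.sign u : ℤ))
          = ((DoubleCoset.doubleCoset (repOf n j Q) (pairSubgroup n) (pairSubgroup n) ∩
              (paritySubgroup n : Set (Equiv.Perm (Fin (2 * n))))).ncard : ℤ) ∨
        (∑ u : Equiv.Perm (Fin (2 * n)) with
            u ∈ paritySubgroup n ∧ BruhatLE u (tilde w) ∧ tripletOf n j u = Q,
          (Equiv.Perm.sign u : ℤ))
          = -((DoubleCoset.doubleCoset (repOf n j Q) (pairSubgroup n) (pairSubgroup n) ∩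
              (paritySubgroup n : Set (Equiv.Perm (Fin (2 * n))))).ncard : ℤ)) := by
  subst hw
  refine ⟨fun u => ?_, fun Q hQ => ⟨sum_maskSign_tripletOf hj hinj hQ,
    (sum_sign_tripletOf hj hinj hQ).symm, ?_⟩⟩
  · conv_lhs => rw [← parityPerm_parts u]
    exact bruhatLE_parityPerm_tilde_iff (by simpa [List.forall_mem_ofFn_iff] using hj)
      (List.nodup_ofFn.2 hinj) _ _
  · rw [sum_sign_tripletOf hj hinj hQ, ncard_doubleCoset_repOf_inter hj hinj hQ]
    rcases neg_one_pow_eq_or ℤ (Q.Ie \ Q.If).card with h | h <;> simp [h]
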